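/- A fan is an acyclic connected graph with a distinguished vertex $r$ (the root) such that every vertex other than $r$ has degree at most $2$; its vertices carry the tree order ($s\preceq t$ iff $s$ lies on the path from $r$ to $t$), and its branches are the maximal chains of this order. Let $\mathcal F_<$ be the class of structures $(A,R^A,S^A)$, where $A$ is a finite fan all of whose branches have the same height, $R^A(s,t)$ holds iff $s=t$ or $t$ is an immediate successor of $s$, and, for some ordering $a_1<\dots<a_n$ of the branches of $A$, $S^A(x,y)$ holds iff $x\in a_i$ and $y\in a_j$ for some $i\le j$. A topological structure is a compact Hausdorff zero-dimensional second countable space with closed binary relations $R,S$; an epimorphism is a continuous surjection under which $R$ and $S$ of the target are exactly the images of $R$ and $S$ of the source (finite structures being discrete). Let $\mathbb L_<=(\mathbb L,R^{\mathbb L},S^{\mathbb L})$ be a projective Fraïssé limit of $\mathcal F_<$, that is, a topological structure such that (L1) every $A\in\mathcal F_<$ is the image of an epimorphism from $\mathbb L_<$; (L2) every continuous map from $\mathbb L$ to a finite discrete space factors through an epimorphism from $\mathbb L_<$ onto some $A\in\mathcal F_<$; (L3) for any epimorphisms $\phi_1,\phi_2$ from $\mathbb L_<$ onto some $A\in\mathcal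 F_<$ there is a bijective epimorphism $\psi:\mathbb L_<\to\mathbb L_<$ with $\phi_2=\phi_1\circ\psi$. Let $\mathrm{Aut}(\mathbb L_<)$ be the group of homeomorphisms of $\mathbb L$ preserving $R^{\mathbb L}$ and $S^{\mathbb L}$. Then the symmetrization $R_S^{\mathbb L}$ of $R^{\mathbb L}$ is an equivalence relation, and the quotient space $L=\mathbb L/R_S^{\mathbb L}$ is the Lelek fan, i.e. it is homeomorphic to a non-degenerate subcontinuum of the Cantor fan (the quotient of $2^{\mathbb N}\times[0,1]$ that collapses $2^{\mathbb N}\times\{0\}$ to a point), and its endpoints are dense, where $x\in L$ is an endpoint if for every embedding $h:[0,1]\to L$ with $x$ in its image, $x=h(0)$ or $x=h(1)$. Let $\pi:\mathbb L\to L$ be the quotient map, let $H(L)$ be the group of homeomorphisms of $L$ with the compact-open topology, and for $h\in\mathrm{Aut}(\mathbb L_<)$ let $h^*\in H(L)$ be given by $h^*\circ\pi=\pi\circ h$. Let $H$ be the closure of $\{h^*:h\in\mathrm{Aut}(\mathbb L_<)\}$ in $H(L)$. Then $H$ is a subgroup of $H(L)$ and it is extremely amenable: every continuous action of $H$ on a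 non-empty compact Hausdorff space has a fixed point. Moreover, $H=\{h\in H(L): \text{for all } x,y\in L,\ x\le_L y \text{ implies } h(x)\le_L h(y)\}$, where $\le_L$ is the image of the relation $S^{\mathbb L}$ under $\pi\times\pi$. -/

import Mathlib

open Set Topology

universe u v

/-! ### Fans -/

/-- A fan: an acyclic connected graph with a distinguished root `r` such that every vertex other
than `r` has degree at most 2. -/
structure IsFan {T : Type*} (G : SimpleGraph T) (r : T) : Prop where
  isTree : G.IsTree
  degree_le : ∀ t, t ≠ r → (G.neighborSet t).encard ≤ 2

/-- The tree order with root `r`: `s ≼ t` iff `s` lies on the path from the root to `t`. -/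
def TreeLE {T : Type*} (G : SimpleGraph T) (r : T) (s t : T) : Prop :=
  ∃ p : G.Walk r t, p.IsPath ∧ s ∈ p.support

/-- `t` is an immediate successor of `s` in the tree order. -/
def IsImmSucc {T : Type*} (G : SimpleGraph T) (r : T) (s t : T) : Prop :=
  TreeLE G r s t ∧ s ≠ t ∧ ∀ p, TreeLE G r s p → TreeLE G r p t → p = s ∨ p = t

/-- A branch is a maximal chain of the tree order. -/
def IsBranch {T : Type*} (G : SimpleGraph T) (r : T) (b : Set T) : Prop :=
  IsMaxChain (TreeLE G r) b

/-! ### Structures with two binary relations -/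

/-- A structure for the language `{R, S}` of two binary relation symbols. -/
structure RSStructure (X : Type*) where
  R : X → X → Prop
  S : X → X → Prop

namespace RSStructure

/-- `𝓧` is a topological structure: the underlying space is compact (Hausdorff), zero-dimensional
and second countable, and the relations are closed.  For compact Hausdorff spaces,
zero-dimensional is the same as totally disconnected. -/
structure IsTopological {X : Type*} [TopologicalSpace X] (𝓧 : RSStructure X) : Prop where
  compact : CompactSpace X
  t2 : T2Space X
  totallyDisconnected : TotallyDisconnectedSpace X
  secondCountable : SecondCountableTopology X
  isClosed_R : IsClosed {p : X × X | 𝓧.R p.1 p.2}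
  isClosed_S : IsClosed {p : X × X | 𝓧.S p.1 p.2}

/-- Epimorphisms: continuous surjections such that each relation on the target is the image
of the corresponding relation on the source. -/
structure IsEpi {X Y : Type*} [TopologicalSpace X] [TopologicalSpace Y]
    (𝓧 : RSStructure X) (𝓨 : RSStructure Y) (φ : X → Y) : Prop where
  continuous : Continuous φ
  surjective : Function.Surjective φ
  map_R : ∀ y₁ y₂, 𝓨.R y₁ y₂ ↔ ∃ x₁ x₂, φ x₁ = y₁ ∧ φ x₂ = y₂ ∧ 𝓧.R x₁ x₂
  map_S : ∀ y₁ y₂, 𝓨.S y₁ y₂ ↔ ∃ x₁ x₂, φ x₁ = y₁ ∧ φ x₂ = y₂ ∧ 𝓧.S x₁ x₂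

/-- `𝓛` is a projective Fraïssé limit of the class `𝓖` of finite structures. -/
structure IsProjFraisseLimit {X : Type*} [TopologicalSpace X]
    (𝓖 : (A : Type) → RSStructure A → Prop) (𝓛 : RSStructure X) : Prop where
  isTopological : 𝓛.IsTopological
  /-- projective universality -/
  universal : ∀ (A : Type) [TopologicalSpace A] [DiscreteTopology A] (𝓐 : RSStructure A),
    𝓖 A 𝓐 → ∃ φ : X → A, IsEpi 𝓛 𝓐 φ
  /-- continuous maps to finite discrete spaces factor through members of the class -/
  factor : ∀ (D : Type) [TopologicalSpace D] [DiscreteTopology D] [Finite D] (f : X → D),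
    Continuous f → ∃ (A : Type) (_ : TopologicalSpace A) (_ : DiscreteTopology A)
      (𝓐 : RSStructure A), 𝓖 A 𝓐 ∧ ∃ φ : X → A, IsEpi 𝓛 𝓐 φ ∧ ∃ f₀ : A → D, f = f₀ ∘ φ
  /-- projective ultrahomogeneity -/
  homogeneous : ∀ (A : Type) [TopologicalSpace A] [DiscreteTopology A] (𝓐 : RSStructure A),
    𝓖 A 𝓐 → ∀ φ₁ φ₂ : X → A, IsEpi 𝓛 𝓐 φ₁ → IsEpi 𝓛 𝓐 φ₂ →
      ∃ ψ : X → X, IsEpi 𝓛 𝓛 ψ ∧ Function.Bijective ψ ∧ φ₂ = φ₁ ∘ ψ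

/-- The class of finite fans, all of whose branches have the same height, with a linear
ordering `a 0 < a 1 < ⋯` of the branches.  Here `R s t` means that `s = t` or that `t` is an
immediate successor of `s`, and `S x y` means that `x ∈ a i` and `y ∈ a j` for some `i ≤ j`. -/
def IsOrderedFan (A : Type) (𝓐 : RSStructure A) : Prop :=
  Finite A ∧ ∃ (G : SimpleGraph A) (r : A), IsFan G r ∧
    (∃ k : ℕ, ∀ b, IsBranch G r b → b.ncard = k + 1) ∧
    (∀ s t, 𝓐.R s t ↔ s = t ∨ IsImmSucc G r s t) ∧
    ∃ (n : ℕ) (a : Fin n ≃ {b : Set A // IsBranch G r b}),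
      ∀ x y, 𝓐.S x y ↔ ∃ i j, i ≤ j ∧ x ∈ (a i).1 ∧ y ∈ (a j).1

/-- The automorphism group: the homeomorphisms that preserve both relations. -/
def aut {X : Type*} [TopologicalSpace X] (𝓧 : RSStructure X) : Subgroup (X ≃ₜ X) where
  carrier := {h | (∀ x y, 𝓧.R (h x) (h y) ↔ 𝓧.R x y) ∧ ∀ x y, 𝓧.S (h x) (h y) ↔ 𝓧.S x y}
  one_mem' := ⟨fun _ _ => Iff.rfl, fun _ _ => Iff.rfl⟩
  mul_mem' := fun {a b} ha hb =>
    ⟨fun x y => (ha.1 (b x) (b y)).trans (hb.1 x y),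
      fun x y => (ha.2 (b x) (b y)).trans (hb.2 x y)⟩
  inv_mem' := fun {a} ha =>
    ⟨fun x y => by
        have h := ha.1 (a.symm x) (a.symm y)
        rw [a.apply_symm_apply, a.apply_symm_apply] at h
        exact h.symm,
      fun x y => by
        have h := ha.2 (a.symm x) (a.symm y)
        rw [a.apply_symm_apply, a.apply_symm_apply] at h
        exact h.symm⟩

/-- The symmetrization of `R`. -/
def symmR {X : Type*} (𝓧 : RSStructure X) (x y : X) : Prop := 𝓧.R x y ∨ 𝓧.R y x

/-- The quotient space of `X` by the symmetrization of `R`, with the quotient topology. -/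
abbrev Space {X : Type*} (𝓧 : RSStructure X) : Type _ := Quot 𝓧.symmR

/-- The quotient map `π`. -/
def proj {X : Type*} (𝓧 : RSStructure X) (x : X) : 𝓧.Space := Quot.mk _ x

/-- The image of the relation `S` under the quotient map. -/
def branchLE {X : Type*} (𝓧 : RSStructure X) (p q : 𝓧.Space) : Prop :=
  ∃ x y, 𝓧.proj x = p ∧ 𝓧.proj y = q ∧ 𝓧.S x y

theorem symmR_of_mem_aut {X : Type*} [TopologicalSpace X] {𝓧 : RSStructure X} {h : X ≃ₜ X}
    (hh : h ∈ 𝓧.aut) (x y : X) (hxy : 𝓧.symmR x y) : 𝓧.symmR (h x) (h y) :=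
  hxy.imp (hh.1 x y).2 (hh.1 y x).2

/-- The homomorphism `h ↦ h*` from automorphisms of the structure to homeomorphisms of the quotient
space; `h*` is determined by `h* (π x) = π (h x)`. -/
def inducedHom {X : Type*} [TopologicalSpace X] (𝓧 : RSStructure X) :
    𝓧.aut →* (𝓧.Space ≃ₜ 𝓧.Space) where
  toFun h :=
    { toFun := Quot.map h.1 (symmR_of_mem_aut h.2)
      invFun := Quot.map (h⁻¹).1 (symmR_of_mem_aut (h⁻¹).2)
      left_inv := by
        rintro ⟨x⟩
        exact congrArg (Quot.mk _) (h.1.symm_apply_apply x)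
      right_inv := by
        rintro ⟨x⟩
        exact congrArg (Quot.mk _) (h.1.apply_symm_apply x)
      continuous_toFun :=
        continuous_quot_lift _ (continuous_quot_mk.comp h.1.continuous)
      continuous_invFun :=
        continuous_quot_lift _ (continuous_quot_mk.comp (h⁻¹).1.continuous) }
  map_one' := by
    ext ⟨x⟩
    rfl
  map_mul' a b := by
    ext ⟨x⟩
    rfl

end RSStructure

/-! ### Groups of homeomorphisms and extreme amenability -/

/-- The compact-open topology on the homeomorphism group of a (compact Hausdorff) space. -/
instance homeoCompactOpen (X : Type*) [TopologicalSpace X] : TopologicalSpace (X ≃ₜ X) :=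
  TopologicalSpace.induced (fun h => (⟨h, h.continuous⟩ : C(X, X))) inferInstance

/-- A group with a topology is extremely amenable if every continuous action on a nonempty compact
Hausdorff space has a fixed point. -/
def ExtremelyAmenable (G : Type u) [Group G] [TopologicalSpace G] : Prop :=
  ∀ (X : Type v) [TopologicalSpace X] [CompactSpace X] [T2Space X] [Nonempty X]
    [MulAction G X] [ContinuousSMul G X], ∃ x : X, ∀ g : G, g • x = x

/-! ### The Lelek fan -/

/-- The equivalence relation on `C × [0,1]`, `C = 2^ℕ` the Cantor set, that collapses `C × {0}`. -/
def cantorFanSetoid : Setoid ((ℕ → Bool) × unitInterval) where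
  r p q := p = q ∨ (p.2 = 0 ∧ q.2 = 0)
  iseqv :=
    { refl := fun _ => Or.inl rfl
      symm := fun h => h.imp Eq.symm And.symm
      trans := by
        rintro p q s (rfl | h) (rfl | h')
        · exact Or.inl rfl
        · exact Or.inr h'
        · exact Or.inr h
        · exact Or.inr ⟨h.1, h'.2⟩ }

/-- The Cantor fan. -/
abbrev CantorFan : Type := Quotient cantorFanSetoid

/-- `x` is an endpoint of `X` if it is an end of every arc in `X` that contains it. -/
def IsEndpoint {X : Type*} [TopologicalSpace X] (x : X) : Prop :=
  ∀ h : unitInterval → X, IsEmbedding h → x ∈ range h → x = h 0 ∨ x = h 1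

/-- `X` is a Lelek fan: it is (homeomorphic to) a non-degenerate subcontinuum of the Cantor fan
whose set of endpoints is dense. -/
structure IsLelekFan (X : Type*) [TopologicalSpace X] : Prop where
  compact : CompactSpace X
  connected : ConnectedSpace X
  nontrivial : Nontrivial X
  exists_embedding : ∃ f : X → CantorFan, IsEmbedding f
  dense_endpoints : Dense {x : X | IsEndpoint x}

/-!
The finite structures of the class are, up to isomorphism and except for the one-point structure,
the standard fans `Fan n k` with `n` branches `0, …, n - 1` of height `k` (`Fan.isOrderedFan_str`,
`exists_equiv_fan`).  An epimorphism between standard fans is a *pattern*: a monotone surjection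
`β` of the branches and, on each branch, a map of heights that starts at `0` and climbs by steps of
size at most one (`Climb`, `Climb.exists_pattern`).  The epimorphisms `A : Approx 𝓛` from the limit
onto standard fans form a directed system that determines the topology and both relations
(`exists_refines₂`, `eq_of_forall_approx`, `R_iff`, `S_iff`).  Everything about the limit is
obtained from compactness (`exists_forall_approx`, `exists_pair`) and from the fact that an
approximation lifts along every pattern (`exists_lift`).

*The quotient.*  Lifting along the map that halves heights shows that a point is `R`-related to at
most one other point (`symmR_subsingleton`), so the symmetrization of `R` is an equivalence
relation.
Iterated doubling also gives continuous real height functions that are constant on the classes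
and monotone on the branches (`exists_height`); a weighted sum of them separates the classes on each
branch (`exists_total_height`).  Together with a code for the branches (`exists_code`) it embeds the
quotient into the Cantor fan.  Initial segments of branches are connected since every approximation
of such a segment is a path.  Endpoints are dense because a branch that ends over any prescribed
vertex can be added to an approximation (`dense_endpoints`).

*The group.*  Elements of the closure preserve the closed relation `branchLE`.  Conversely, a
homeomorphism `h` that preserves it fixes the apex and is monotone on the branches
(`height_le_of_TLE`).  Given an approximation `A`, the composition of `h` with `A` is rounded to an
epimorphism from a fine approximation onto the same fan (`exists_rounding`, `exists_aut_close`);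
homogeneity turns this epimorphism into an automorphism of the limit whose induced homeomorphism is
close to `h`.

*Extreme amenability.*  This is the Kechris–Pestov–Todorčević correspondence, with a Ramsey theorem
for patterns (`Climb.exists_good_near`).  Epimorphisms from fans of unbounded size onto `Fan n k`
are coded by words of climbing maps labelled by branches.  Climbing maps act on the words and on the
ultrafilters on words; an equivariant family of ultrafilters that is a semilattice under
multiplication (`Climb.exists_coherent`) is built from idempotents, as in the theorem of Gowers
on `FIN_k`.  A pattern sends the product of labelled copies of this family for its source to the one
for its target (`Climb.map_labelProd`), so a generic word for the source has all its images under
finitely many patterns generic for the target, and any function to a compact space takes almost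
the same value at these images.  Applied to the translates of a point under a continuous action this
gives points that are almost fixed by finitely many automorphisms (`exists_almost_fixed`), hence a
fixed point by compactness.
-/

/-! ### Standard fans -/

/-- The standard finite ordered fan with branches `0, …, n - 1` of height `k`.  A vertex is given by
its branch and its height; the root is normalized to have branch `0`. -/
@[ext]
structure Fan (n k : ℕ) : Type where
  /-- The branch of a vertex, `0` for the root. -/
  br : ℕ
  /-- The height of a vertex. -/
  ht : ℕ
  prop : (br = 0 ∧ ht = 0) ∨ (br < n ∧ 1 ≤ ht ∧ ht ≤ k)

namespace Fan

variable {n k N K : ℕ}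

theorem ht_le (a : Fan n k) : a.ht ≤ k := by
  have := a.prop; omega

theorem br_lt {a : Fan n k} (h : a.ht ≠ 0) : a.br < n := by
  have := a.prop; omega

theorem br_eq_zero {a : Fan n k} (h : a.ht = 0) : a.br = 0 := by
  have := a.prop; omega

/-- The vertex of height `j` on branch `i`; the root if there is no such vertex. -/
def vtx (n k i j : ℕ) : Fan n k :=
  if h : i < n ∧ 1 ≤ j ∧ j ≤ k then ⟨i, j, Or.inr h⟩ else ⟨0, 0, Or.inl ⟨rfl, rfl⟩⟩

theorem ht_vtx {i j : ℕ} (hi : i < n) (hj : j ≤ k) : (vtx n k i j).ht = j := by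
  unfold vtx
  split_ifs with h
  · rfl
  · change 0 = j
    omega

theorem ht_vtx_zero (i : ℕ) : (vtx n k i 0).ht = 0 := by
  unfold vtx
  split_ifs with h
  · omega
  · rfl

theorem br_vtx {i j : ℕ} (hi : i < n) (hj : j ≤ k) (h0 : j ≠ 0) : (vtx n k i j).br = i := by
  unfold vtx
  rw [dif_pos ⟨hi, by omega, hj⟩]

theorem vtx_br_ht (a : Fan n k) : vtx n k a.br a.ht = a := by
  rcases a.prop with ⟨h1, h2⟩ | ⟨h1, h2, h3⟩
  · apply Fan.ext
    · rw [h2, br_eq_zero (ht_vtx_zero _), h1]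
    · rw [h2, ht_vtx_zero]
  · exact Fan.ext (br_vtx h1 h3 (by omega)) (ht_vtx h1 h3)

/-- The root. -/
def root : Fan n k := ⟨0, 0, Or.inl ⟨rfl, rfl⟩⟩

theorem ht_root : (root : Fan n k).ht = 0 := rfl

theorem eq_root {a : Fan n k} (h : a.ht = 0) : a = root :=
  Fan.ext (br_eq_zero h) h

theorem vtx_zero (i : ℕ) : vtx n k i 0 = root := eq_root (ht_vtx_zero i)

instance : Finite (Fan n k) := by
  refine Finite.of_injective (β := Fin (n + 1) × Fin (k + 1))
    (fun a => (⟨a.br, by have := a.prop; omega⟩, ⟨a.ht, by have := a.prop; omega⟩)) ?_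
  intro a b h
  simp only [Prod.mk.injEq, Fin.mk.injEq] at h
  exact Fan.ext h.1 h.2

instance : Nonempty (Fan n k) := ⟨root⟩

instance : TopologicalSpace (Fan n k) := ⊥

instance : DiscreteTopology (Fan n k) := ⟨rfl⟩

/-- The tree order of the standard fan. -/
instance : PartialOrder (Fan n k) where
  le a b := a.ht = 0 ∨ (a.ht ≤ b.ht ∧ a.br = b.br)
  le_refl a := Or.inr ⟨le_rfl, rfl⟩
  le_trans a b c h₁ h₂ := by
    have := br_eq_zero (a := b)
    omega
  le_antisymm a b h₁ h₂ := by
    have h3 := a.prop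
    have h4 := b.prop
    apply Fan.ext <;> omega

theorem le_def {a b : Fan n k} : a ≤ b ↔ a.ht = 0 ∨ (a.ht ≤ b.ht ∧ a.br = b.br) := Iff.rfl

theorem root_le (a : Fan n k) : root ≤ a := Or.inl rfl

theorem ht_mono {a b : Fan n k} (h : a ≤ b) : a.ht ≤ b.ht := by
  rcases h with h | h <;> omega

/-- The relation `R` of the standard fan: equal or an immediate successor. -/
def R (a b : Fan n k) : Prop := a = b ∨ (b.ht = a.ht + 1 ∧ a ≤ b)

/-- The relation `S` of the standard fan: the branch of the first vertex is not to the right of the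
branch of the second one, the root being on all branches. -/
def S (a b : Fan n k) : Prop := a.ht = 0 ∨ b.ht = 0 ∨ a.br ≤ b.br

/-- The standard fan as a structure. -/
def str (n k : ℕ) : RSStructure (Fan n k) := ⟨R, S⟩

theorem R.le {a b : Fan n k} (h : R a b) : a ≤ b := by
  rcases h with rfl | h
  · exact le_rfl
  · exact h.2

theorem R.ht_le {a b : Fan n k} (h : R a b) : b.ht ≤ a.ht + 1 := by
  rcases h with rfl | h <;> omega

theorem le_of_S {a b : Fan n k} (h₁ : S a b) (h₂ : S b a) (h : a.ht ≤ b.ht) : a ≤ b := by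
  unfold S at *
  rw [le_def]
  omega

theorem S_of_le {a b : Fan n k} (h : a ≤ b) : S a b ∧ S b a := by
  unfold S
  rw [le_def] at h
  omega

theorem S_total (a b : Fan n k) : S a b ∨ S b a := by
  unfold S
  omega

theorem le_total_of_le {a b c : Fan n k} (h₁ : a ≤ c) (h₂ : b ≤ c) : a ≤ b ∨ b ≤ a := by
  simp only [le_def] at *
  omega

/-- Below a vertex there is exactly one vertex of each smaller height. -/
theorem exists_le {a : Fan n k} {j : ℕ} (h : j ≤ a.ht) : ∃ b, b ≤ a ∧ b.ht = j := by
  by_cases h0 : j = 0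
  · exact ⟨root, root_le _, h0 ▸ rfl⟩
  · have := a.prop
    refine ⟨vtx n k a.br j, Or.inr ⟨?_, ?_⟩, ?_⟩
    · rw [ht_vtx (by omega) (by omega)]; exact h
    · rw [br_vtx (by omega) (by omega) h0]
    · rw [ht_vtx (by omega) (by omega)]

theorem eq_of_le_of_le {a b c : Fan n k} (h₁ : a ≤ c) (h₂ : b ≤ c) (h : a.ht = b.ht) : a = b := by
  rw [le_def] at h₁ h₂
  have h3 := a.prop
  have h4 := b.prop
  apply Fan.ext <;> omega

/-- A map of fans that fixes the root and preserves `R` is monotone. -/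
theorem monotone_of_R {q : Fan N K → Fan n k} (hR : ∀ a b, R a b → R (q a) (q b)) :
    Monotone q := by
  suffices ∀ j, ∀ a b : Fan N K, a ≤ b → b.ht = a.ht + j → q a ≤ q b by
    intro a b h
    exact this _ a b h (Nat.add_sub_of_le (ht_mono h)).symm
  intro j
  induction j with
  | zero =>
    intro a b h hj
    rw [eq_of_le_of_le h le_rfl (by omega)]
  | succ j ih =>
    intro a b h hj
    obtain ⟨c, hc, hcj⟩ := exists_le (a := b) (j := a.ht + j) (by omega)
    refine (ih a c ?_ hcj).trans (hR c b (Or.inr ⟨by omega, hc⟩)).le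
    rcases le_total_of_le h hc with h' | h'
    · exact h'
    · have := ht_mono h'
      rw [eq_of_le_of_le h hc (by omega)]

/-- An edge below the image of a vertex is the image of an edge below that vertex. -/
theorem exists_edge {q : Fan N K → Fan n k} (h0 : q root = root)
    (hR : ∀ a b, R a b → R (q a) (q b)) (j : ℕ) :
    ∀ b : Fan N K, j + 1 ≤ (q b).ht →
      ∃ c d, R c d ∧ d ≤ b ∧ (q c).ht = j ∧ (q d).ht = j + 1 := by
  suffices ∀ i, ∀ b : Fan N K, b.ht = i → j + 1 ≤ (q b).ht →
      ∃ c d, R c d ∧ d ≤ b ∧ (q c).ht = j ∧ (q d).ht = j + 1 from fun b => this _ b rfl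
  intro i
  induction i with
  | zero =>
    intro b hb h
    rw [eq_root hb, h0, ht_root] at h
    omega
  | succ i ih =>
    intro b hb h
    obtain ⟨c, hc, hci⟩ := exists_le (a := b) (j := i) (by omega)
    have hcb : R c b := Or.inr ⟨by omega, hc⟩
    by_cases h' : j + 1 ≤ (q c).ht
    · obtain ⟨x, y, hxy, hyc, h1⟩ := ih c hci h'
      exact ⟨x, y, hxy, hyc.trans hc, h1⟩
    · have := (hR c b hcb).ht_le
      exact ⟨c, b, hcb, le_rfl, by omega, by omega⟩

/-- A criterion for a map of standard fans to be an epimorphism. -/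
theorem isEpi_of {q : Fan N K → Fan n k} (hk : 1 ≤ k) (h0 : q root = root)
    (hR : ∀ a b, R a b → R (q a) (q b)) (hS : ∀ a b, S a b → S (q a) (q b))
    (htop : ∀ i < n, ∃ b, q b = vtx n k i k) :
    RSStructure.IsEpi (str N K) (str n k) q := by
  have hmono := monotone_of_R hR
  have hle : ∀ b a, a ≤ q b → ∃ b', b' ≤ b ∧ q b' = a := by
    intro b a hab
    rcases Nat.eq_zero_or_pos a.ht with h | h
    · exact ⟨root, root_le _, by rw [h0, eq_root h]⟩
    · obtain ⟨c, d, hcd, hdb, -, h2⟩ := exists_edge h0 hR (a.ht - 1) b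
        (by have := ht_mono hab; omega)
      exact ⟨d, hdb, eq_of_le_of_le (hmono hdb) hab (by omega)⟩
  have htop' : ∀ a : Fan n k, a.ht ≠ 0 → ∃ b, q b = vtx n k a.br k ∧ a ≤ q b := by
    intro a ha
    have := a.prop
    obtain ⟨b, hb⟩ := htop a.br (br_lt ha)
    refine ⟨b, hb, ?_⟩
    rw [hb, le_def, ht_vtx (br_lt ha) le_rfl, br_vtx (br_lt ha) le_rfl (by omega)]
    omega
  have hsurj : ∀ a : Fan n k, ∃ b, q b = a := by
    intro a
    by_cases ha : a.ht = 0
    · exact ⟨root, by rw [h0, eq_root ha]⟩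
    · obtain ⟨b, hb, hab⟩ := htop' a ha
      obtain ⟨b', -, h⟩ := hle b a hab
      exact ⟨b', h⟩
  refine ⟨continuous_of_discreteTopology, hsurj, ?_, ?_⟩
  · intro a b
    constructor
    · rintro (rfl | ⟨h1, h2⟩)
      · obtain ⟨x, hx⟩ := hsurj a
        exact ⟨x, x, hx, hx, Or.inl rfl⟩
      · obtain ⟨x, hx⟩ := hsurj b
        obtain ⟨c, d, hcd, hdx, h3, h4⟩ := exists_edge h0 hR a.ht x (by rw [hx, h1])
        have hd : q d ≤ b := hx ▸ hmono hdx
        exact ⟨c, d, eq_of_le_of_le ((hmono hcd.le).trans hd) h2 h3,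
          eq_of_le_of_le hd le_rfl (by omega), hcd⟩
    · rintro ⟨x, y, rfl, rfl, h⟩
      exact hR _ _ h
  · intro a b
    constructor
    · intro h
      by_cases ha : a.ht = 0
      · obtain ⟨y, hy⟩ := hsurj b
        exact ⟨root, y, by rw [h0, eq_root ha], hy, Or.inl rfl⟩
      by_cases hb : b.ht = 0
      · obtain ⟨x, hx⟩ := hsurj a
        exact ⟨x, root, hx, by rw [h0, eq_root hb], Or.inr (Or.inl rfl)⟩
      obtain ⟨x, hx, hax⟩ := htop' a ha
      obtain ⟨y, hy, hby⟩ := htop' b hb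
      have hab : a.br ≤ b.br := by
        unfold str S at h
        simp only at h
        omega
      rcases hab.eq_or_lt with he | hlt
      · obtain ⟨x', hx', h1⟩ := hle y a (by rw [hy, ← he, ← hx]; exact hax)
        obtain ⟨y', hy', h2⟩ := hle y b hby
        rcases le_total_of_le hx' hy' with h3 | h3
        · exact ⟨x', y', h1, h2, (S_of_le h3).1⟩
        · exact ⟨x', y', h1, h2, (S_of_le h3).2⟩
      · obtain ⟨x', hx', h1⟩ := hle x a hax
        obtain ⟨y', hy', h2⟩ := hle y b hby
        rcases S_total x' y' with h3 | h3
        · exact ⟨x', y', h1, h2, h3⟩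
        · have := hS _ _ h3
          rw [h1, h2] at this
          unfold S at this
          omega
    · rintro ⟨x, y, rfl, rfl, h⟩
      exact hS _ _ h

theorem epi_R {q : Fan N K → Fan n k} (hq : RSStructure.IsEpi (str N K) (str n k) q)
    {a b : Fan N K} (h : R a b) : R (q a) (q b) :=
  (hq.map_R _ _).2 ⟨a, b, rfl, rfl, h⟩

theorem epi_S {q : Fan N K → Fan n k} (hq : RSStructure.IsEpi (str N K) (str n k) q)
    {a b : Fan N K} (h : S a b) : S (q a) (q b) :=
  (hq.map_S _ _).2 ⟨a, b, rfl, rfl, h⟩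

theorem epi_monotone {q : Fan N K → Fan n k} (hq : RSStructure.IsEpi (str N K) (str n k) q) :
    Monotone q :=
  monotone_of_R fun _ _ => epi_R hq

theorem epi_root {q : Fan N K → Fan n k} (hq : RSStructure.IsEpi (str N K) (str n k) q) :
    q root = root := by
  obtain ⟨b, hb⟩ := hq.surjective root
  apply eq_root
  have := ht_mono (epi_monotone hq (root_le b))
  rw [hb, ht_root] at this
  omega

end Fan

namespace RSStructure.IsEpi

theorem comp {X Y Z : Type*} [TopologicalSpace X] [TopologicalSpace Y] [TopologicalSpace Z]
    {𝓧 : RSStructure X} {𝓨 : RSStructure Y} {𝓩 : RSStructure Z} {ψ : Y → Z} {φ : X → Y}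
    (hψ : IsEpi 𝓨 𝓩 ψ) (hφ : IsEpi 𝓧 𝓨 φ) : IsEpi 𝓧 𝓩 (ψ ∘ φ) where
  continuous := hψ.continuous.comp hφ.continuous
  surjective := hψ.surjective.comp hφ.surjective
  map_R z₁ z₂ := by
    rw [hψ.map_R]
    constructor
    · rintro ⟨y₁, y₂, h₁, h₂, h⟩
      obtain ⟨x₁, x₂, rfl, rfl, h'⟩ := (hφ.map_R _ _).1 h
      exact ⟨x₁, x₂, h₁, h₂, h'⟩
    · rintro ⟨x₁, x₂, h₁, h₂, h⟩
      exact ⟨φ x₁, φ x₂, h₁, h₂, (hφ.map_R _ _).2 ⟨x₁, x₂, rfl, rfl, h⟩⟩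
  map_S z₁ z₂ := by
    rw [hψ.map_S]
    constructor
    · rintro ⟨y₁, y₂, h₁, h₂, h⟩
      obtain ⟨x₁, x₂, rfl, rfl, h'⟩ := (hφ.map_S _ _).1 h
      exact ⟨x₁, x₂, h₁, h₂, h'⟩
    · rintro ⟨x₁, x₂, h₁, h₂, h⟩
      exact ⟨φ x₁, φ x₂, h₁, h₂, (hφ.map_S _ _).2 ⟨x₁, x₂, rfl, rfl, h⟩⟩

/-- If `ψ ∘ φ` and `φ` are epimorphisms and the middle structure is discrete, then `ψ` is an
epimorphism. -/
theorem of_comp {X Y Z : Type*} [TopologicalSpace X] [TopologicalSpace Y] [DiscreteTopology Y]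
    [TopologicalSpace Z]
    {𝓧 : RSStructure X} {𝓨 : RSStructure Y} {𝓩 : RSStructure Z} {ψ : Y → Z} {φ : X → Y}
    (h : IsEpi 𝓧 𝓩 (ψ ∘ φ)) (hφ : IsEpi 𝓧 𝓨 φ) : IsEpi 𝓨 𝓩 ψ where
  continuous := continuous_of_discreteTopology
  surjective := h.surjective.of_comp
  map_R z₁ z₂ := by
    rw [h.map_R]
    constructor
    · rintro ⟨x₁, x₂, h₁, h₂, h⟩
      exact ⟨φ x₁, φ x₂, h₁, h₂, (hφ.map_R _ _).2 ⟨x₁, x₂, rfl, rfl, h⟩⟩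
    · rintro ⟨y₁, y₂, h₁, h₂, h⟩
      obtain ⟨x₁, x₂, rfl, rfl, h'⟩ := (hφ.map_R _ _).1 h
      exact ⟨x₁, x₂, h₁, h₂, h'⟩
  map_S z₁ z₂ := by
    rw [h.map_S]
    constructor
    · rintro ⟨x₁, x₂, h₁, h₂, h⟩
      exact ⟨φ x₁, φ x₂, h₁, h₂, (hφ.map_S _ _).2 ⟨x₁, x₂, rfl, rfl, h⟩⟩
    · rintro ⟨y₁, y₂, h₁, h₂, h⟩
      obtain ⟨x₁, x₂, rfl, rfl, h'⟩ := (hφ.map_S _ _).1 h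
      exact ⟨x₁, x₂, h₁, h₂, h'⟩

/-- A bijection that carries the relations of one finite structure to those of the other is an
epimorphism. -/
theorem of_equiv {X Y : Type*} [TopologicalSpace X] [DiscreteTopology X] [TopologicalSpace Y]
    {𝓧 : RSStructure X} {𝓨 : RSStructure Y} (e : X ≃ Y)
    (hR : ∀ x y, 𝓧.R x y ↔ 𝓨.R (e x) (e y)) (hS : ∀ x y, 𝓧.S x y ↔ 𝓨.S (e x) (e y)) :
    IsEpi 𝓧 𝓨 e where
  continuous := continuous_of_discreteTopology
  surjective := e.surjective
  map_R y₁ y₂ := by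
    constructor
    · intro h
      exact ⟨e.symm y₁, e.symm y₂, by simp, by simp, by rw [hR]; simpa using h⟩
    · rintro ⟨x₁, x₂, rfl, rfl, h⟩
      exact (hR _ _).1 h
  map_S y₁ y₂ := by
    constructor
    · intro h
      exact ⟨e.symm y₁, e.symm y₂, by simp, by simp, by rw [hS]; simpa using h⟩
    · rintro ⟨x₁, x₂, rfl, rfl, h⟩
      exact (hS _ _).1 h

end RSStructure.IsEpi

/-! ### The standard fans represent all finite ordered fans -/

namespace Fan

variable {n k : ℕ}

/-- The graph of the standard fan. -/
def graph (n k : ℕ) : SimpleGraph (Fan n k) := SimpleGraph.fromRel R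

theorem graph_adj {a b : Fan n k} : (graph n k).Adj a b ↔ a ≠ b ∧ (R a b ∨ R b a) :=
  SimpleGraph.fromRel_adj _ _ _

theorem adj_succ {a b : Fan n k} (h : b.ht = a.ht + 1) (hab : a ≤ b) : (graph n k).Adj a b := by
  rw [graph_adj]
  refine ⟨?_, Or.inl (Or.inr ⟨h, hab⟩)⟩
  rintro rfl
  omega

/-- Walking up a branch is a path from the root, and its vertices are those below its end. -/
theorem exists_path (i : ℕ) : ∀ t : Fan n k, t.ht = i →
    ∃ p : (graph n k).Walk root t, p.IsPath ∧ ∀ s, s ∈ p.support ↔ s ≤ t := by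
  induction i with
  | zero =>
    intro t ht
    obtain rfl := eq_root ht
    refine ⟨SimpleGraph.Walk.nil, SimpleGraph.Walk.IsPath.nil, fun s => ?_⟩
    rw [SimpleGraph.Walk.support_nil, List.mem_singleton]
    constructor
    · rintro rfl
      exact le_rfl
    · intro h
      exact le_antisymm h (root_le s)
  | succ i ih =>
    intro t ht
    obtain ⟨c, hc, hci⟩ := exists_le (a := t) (j := i) (by omega)
    obtain ⟨p, hp, hps⟩ := ih c hci
    have hadj : (graph n k).Adj c t := adj_succ (by omega) hc
    refine ⟨p.concat hadj, hp.concat ?_ hadj, fun s => ?_⟩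
    · rw [hps]
      intro h
      have := ht_mono h
      omega
    · rw [SimpleGraph.Walk.support_concat, List.mem_append,
        List.mem_singleton, hps]
      constructor
      · rintro (h | rfl)
        · exact h.trans hc
        · exact le_rfl
      · intro h
        by_cases h1 : s.ht ≤ i
        · left
          rcases le_total_of_le h hc with h2 | h2
          · exact h2
          · have := ht_mono h2
            rw [eq_of_le_of_le h hc (by omega)]
        · right
          have := ht_mono h
          exact eq_of_le_of_le h le_rfl (by omega)

theorem graph_isTree : (graph n k).IsTree where
  connected := by
    have h : ∀ t, (graph n k).Reachable root t := fun t =>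
      let ⟨p, _⟩ := exists_path _ t rfl
      p.reachable
    exact { preconnected := fun a b => (h a).symm.trans (h b) }
  isAcyclic := by
    classical
    intro v c hc
    -- the two neighbours of a highest vertex of the cycle are both its predecessor
    obtain ⟨m, hm, hmax⟩ := Set.exists_max_image {x | x ∈ c.support} ht (Set.toFinite _)
      ⟨v, c.start_mem_support⟩
    have hc' := hc.rotate hm
    have hmem : ∀ x ∈ (c.rotate m hm).support, x.ht ≤ m.ht := by
      intro x hx
      exact hmax x ((SimpleGraph.Walk.mem_support_rotate_iff _ _ hm).1 hx)
    have key : ∀ x ∈ (c.rotate m hm).support, (graph n k).Adj m x → x.ht + 1 = m.ht ∧ x ≤ m := by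
      intro x hx hadj
      obtain ⟨hne, (h | ⟨h1, h2⟩) | h | ⟨h1, h2⟩⟩ := graph_adj.1 hadj
      · exact absurd h hne
      · have := hmem x hx; omega
      · exact absurd h.symm hne
      · exact ⟨h1.symm, h2⟩
    have h1 := key _ ((c.rotate m hm).getVert_mem_support 1)
      (SimpleGraph.Walk.adj_snd hc'.not_nil)
    have h2 := key _ ((c.rotate m hm).getVert_mem_support _)
      (SimpleGraph.Walk.adj_penultimate hc'.not_nil).symm
    exact hc'.snd_ne_penultimate (eq_of_le_of_le h1.2 h2.2
      (Nat.succ_injective (h1.1.trans h2.1.symm)))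

theorem treeLE_iff {s t : Fan n k} : TreeLE (graph n k) root s t ↔ s ≤ t := by
  obtain ⟨p, hp, hps⟩ := exists_path _ t rfl
  constructor
  · rintro ⟨p', hp', h⟩
    obtain rfl := (graph_isTree.existsUnique_path root t).unique hp hp'
    exact (hps s).1 h
  · intro h
    exact ⟨p, hp, (hps s).2 h⟩

theorem graph_isFan : IsFan (graph n k) root where
  isTree := graph_isTree
  degree_le t ht := by
    have h0 : t.ht ≠ 0 := fun h => ht (eq_root h)
    have hsub : (graph n k).neighborSet t ⊆ {vtx n k t.br (t.ht - 1), vtx n k t.br (t.ht + 1)} := by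
      intro x hx
      have hx' := x.prop
      have ht' := t.prop
      obtain ⟨hne, (h | ⟨h1, h2⟩) | h | ⟨h1, h2⟩⟩ := graph_adj.1 hx
      · exact absurd h hne
      · rw [le_def] at h2
        right
        change x = _
        rw [← h1, show t.br = x.br by omega, vtx_br_ht]
      · exact absurd h.symm hne
      · left
        rw [show t.ht - 1 = x.ht by omega]
        rw [le_def] at h2
        rcases h2 with h2 | h2
        · rw [h2, vtx_zero, eq_root h2]
        · rw [← h2.2, vtx_br_ht]
    refine (Set.encard_le_encard hsub).trans ?_
    refine (Set.encard_insert_le _ _).trans ?_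
    rw [Set.encard_singleton]
    norm_num

theorem isImmSucc_iff {s t : Fan n k} :
    IsImmSucc (graph n k) root s t ↔ t.ht = s.ht + 1 ∧ s ≤ t := by
  unfold IsImmSucc
  simp only [treeLE_iff]
  constructor
  · rintro ⟨h1, h2, h3⟩
    refine ⟨?_, h1⟩
    have h4 := ht_mono h1
    rcases h4.eq_or_lt with h | h
    · exact absurd (eq_of_le_of_le h1 le_rfl h) h2
    · obtain ⟨p, hp, hpt⟩ := exists_le (a := t) (j := s.ht + 1) (by omega)
      have hsp : s ≤ p := by
        rcases le_total_of_le h1 hp with h5 | h5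
        · exact h5
        · have := ht_mono h5; omega
      rcases h3 p hsp hp with rfl | rfl
      · omega
      · exact hpt
  · rintro ⟨h1, h2⟩
    refine ⟨h2, ?_, fun p hp hpt => ?_⟩
    · rintro rfl
      omega
    · have h3 := ht_mono hp
      have h4 := ht_mono hpt
      rcases Nat.lt_or_ge s.ht p.ht with h | h
      · exact Or.inr (eq_of_le_of_le hpt le_rfl (by omega))
      · exact Or.inl (eq_of_le_of_le hpt h2 (by omega))

/-- The vertices of the branch `i`. -/
def branch (n k i : ℕ) : Set (Fan n k) := {s | s ≤ vtx n k i k}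

theorem mem_branch {i : ℕ} (hi : i < n) {s : Fan n k} :
    s ∈ branch n k i ↔ s.ht = 0 ∨ s.br = i := by
  have hs := s.prop
  have h2 := ht_vtx (k := k) hi le_rfl
  rcases Nat.eq_zero_or_pos k with rfl | hk
  · change s ≤ _ ↔ _
    rw [le_def]
    omega
  · have h1 := br_vtx hi (le_refl k) (by omega)
    change s ≤ _ ↔ _
    rw [le_def, h1, h2]
    omega

theorem isChain_branch (i : ℕ) : IsChain (· ≤ ·) (branch n k i) :=
  fun _ ha _ hb _ => le_total_of_le ha hb

theorem isMaxChain_iff (hn : 1 ≤ n) (hk : 1 ≤ k) {b : Set (Fan n k)} :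
    IsMaxChain (· ≤ ·) b ↔ ∃ i < n, b = branch n k i := by
  have key : ∀ c : Set (Fan n k), IsChain (· ≤ ·) c → ∃ i < n, c ⊆ branch n k i := by
    intro c hc
    by_cases h : ∃ x ∈ c, x.ht ≠ 0
    · obtain ⟨x, hx, hx0⟩ := h
      refine ⟨x.br, br_lt hx0, fun y hy => ?_⟩
      rw [mem_branch (br_lt hx0)]
      by_cases hxy : x = y
      · exact Or.inr (by rw [hxy])
      · have := hc hx hy hxy
        simp only [le_def] at this
        omega
    · push Not at h
      refine ⟨0, hn, fun y hy => ?_⟩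
      rw [mem_branch hn]
      exact Or.inl (h y hy)
  constructor
  · intro hb
    obtain ⟨i, hi, hbi⟩ := key b hb.1
    exact ⟨i, hi, hb.2 (isChain_branch i) hbi⟩
  · rintro ⟨i, hi, rfl⟩
    refine ⟨isChain_branch i, fun c hc hic => ?_⟩
    refine hic.antisymm fun y hy => ?_
    have htop : vtx n k i k ∈ c := hic (le_refl (vtx n k i k))
    have h2 := ht_vtx hi (le_refl k)
    have h1 := br_vtx hi (le_refl k) (by omega)
    rw [mem_branch hi]
    by_cases hxy : vtx n k i k = y
    · exact Or.inr (by rw [← hxy, h1])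
    · have := hc htop hy hxy
      simp only [le_def] at this
      omega

theorem ncard_branch {i : ℕ} (hi : i < n) : (branch n k i).ncard = k + 1 := by
  have h : branch n k i = (fun j => vtx n k i j) '' Set.Iic k := by
    ext s
    rw [mem_branch hi, Set.mem_image]
    constructor
    · rintro (h | h)
      · exact ⟨0, Nat.zero_le k, by rw [vtx_zero, eq_root h]⟩
      · exact ⟨s.ht, s.ht_le, by rw [← h, vtx_br_ht]⟩
    · rintro ⟨j, hj, rfl⟩
      by_cases h0 : j = 0
      · exact Or.inl (by rw [h0, ht_vtx_zero])
      · exact Or.inr (br_vtx hi hj h0)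
  rw [h, Set.InjOn.ncard_image, ncard_Iic_nat]
  · intro j hj j' hj' h
    have := congrArg ht h
    simpa only [ht_vtx hi hj, ht_vtx hi hj'] using this

theorem isOrderedFan_str (hn : 1 ≤ n) (hk : 1 ≤ k) :
    RSStructure.IsOrderedFan (Fan n k) (str n k) := by
  have hbr : ∀ b : Set (Fan n k), IsBranch (graph n k) root b ↔ ∃ i < n, b = branch n k i := by
    intro b
    rw [← isMaxChain_iff hn hk]
    unfold IsBranch
    rw [show TreeLE (graph n k) root = (· ≤ ·) by
      funext s t; exact propext treeLE_iff]
  refine ⟨inferInstance, graph n k, root, graph_isFan, ⟨k, ?_⟩, ?_, n, ?_⟩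
  · intro b hb
    obtain ⟨i, hi, rfl⟩ := (hbr b).1 hb
    exact ncard_branch hi
  · intro s t
    rw [isImmSucc_iff]
    rfl
  · let f : Fin n → {b : Set (Fan n k) // IsBranch (graph n k) root b} :=
      fun i => ⟨branch n k i, (hbr _).2 ⟨i, i.2, rfl⟩⟩
    have hf : Function.Bijective f := by
      constructor
      · intro i j hij
        have h1 : branch n k i = branch n k j := congrArg Subtype.val hij
        have h2 : vtx n k i k ∈ branch n k j := h1 ▸ le_refl (vtx n k i k)
        rw [mem_branch j.2, ht_vtx i.2 le_rfl, br_vtx i.2 le_rfl (by omega)] at h2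
        exact Fin.ext (by omega)
      · rintro ⟨b, hb⟩
        obtain ⟨i, hi, rfl⟩ := (hbr b).1 hb
        exact ⟨⟨i, hi⟩, rfl⟩
    refine ⟨Equiv.ofBijective f hf, fun x y => ?_⟩
    change S x y ↔ ∃ i j : Fin n, i ≤ j ∧ x ∈ branch n k i ∧ y ∈ branch n k j
    simp only [mem_branch (Fin.is_lt _)]
    unfold S
    have hx := x.prop
    have hy := y.prop
    constructor
    · intro h
      by_cases hx0 : x.ht = 0
      · by_cases hy0 : y.ht = 0
        · exact ⟨⟨0, hn⟩, ⟨0, hn⟩, le_rfl, Or.inl hx0, Or.inl hy0⟩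
        · exact ⟨⟨y.br, by omega⟩, ⟨y.br, by omega⟩, le_rfl, Or.inl hx0, Or.inr rfl⟩
      · by_cases hy0 : y.ht = 0
        · exact ⟨⟨x.br, by omega⟩, ⟨x.br, by omega⟩, le_rfl, Or.inr rfl, Or.inl hy0⟩
        · exact ⟨⟨x.br, by omega⟩, ⟨y.br, by omega⟩, Fin.mk_le_mk.2 (by omega), Or.inr rfl,
            Or.inr rfl⟩
    · rintro ⟨i, j, hij, h1, h2⟩
      have : (i : ℕ) ≤ j := hij
      omega

end Fan

section Tree

variable {A : Type} {G : SimpleGraph A} {r : A}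

/-- The order-theoretic properties of the tree order of a fan, with a height function. -/
structure IsFanOrder (le : A → A → Prop) (r : A) (ht : A → ℕ) : Prop where
  refl : ∀ t, le t t
  trans : ∀ s t u, le s t → le t u → le s u
  root_le : ∀ t, le r t
  ht_root : ht r = 0
  ht_mono : ∀ s t, le s t → ht s ≤ ht t
  eq_of_ht : ∀ s t, le s t → ht s = ht t → s = t
  exists_le : ∀ t, ∀ j ≤ ht t, ∃ s, le s t ∧ ht s = j
  down : ∀ s s' t, le s t → le s' t → le s s' ∨ le s' s
  up : ∀ s t t', s ≠ r → le s t → le s t' → le t t' ∨ le t' t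

/-- The tree order of a fan: points are compared through the unique paths from the root, the height
is the length of this path, and the degree condition keeps the paths through a vertex other than the
root from splitting. -/
theorem exists_isFanOrder (hG : IsFan G r) : ∃ ht, IsFanOrder (TreeLE G r) r ht := by
  classical
  choose P hP using fun t => (hG.isTree.existsUnique_path r t).exists
  have huniq : ∀ t (p : G.Walk r t), p.IsPath → p = P t := fun t p hp =>
    (hG.isTree.existsUnique_path r t).unique hp (hP t)
  have hle : ∀ s t, TreeLE G r s t ↔ s ∈ (P t).support := by
    intro s t
    constructor
    · rintro ⟨p, hp, h⟩
      rwa [huniq t p hp] at h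
    · intro h
      exact ⟨P t, hP t, h⟩
  have htake : ∀ s t (h : s ∈ (P t).support), (P t).takeUntil s h = P s := fun s t h =>
    huniq s _ ((hP t).takeUntil h)
  have hlen : ∀ s t, TreeLE G r s t → (P s).length ≤ (P t).length := by
    intro s t h
    rw [hle] at h
    rw [← htake s t h]
    exact SimpleGraph.Walk.length_takeUntil_le_length _ _
  have hvert : ∀ s t, TreeLE G r s t → ∀ j ≤ (P s).length, (P s).getVert j = (P t).getVert j := by
    intro s t h j hj
    rw [hle] at h
    rw [← htake s t h]
    exact SimpleGraph.Walk.getVert_takeUntil h (by rw [htake s t h]; exact hj)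
  have hvert' : ∀ s t, TreeLE G r s t → (P t).getVert (P s).length = s := by
    intro s t h
    rw [← hvert s t h _ le_rfl, SimpleGraph.Walk.getVert_length]
  have hinj : ∀ t i j, i ≤ (P t).length → j ≤ (P t).length →
      (P t).getVert i = (P t).getVert j → i = j :=
    fun t i j hi hj h => (hP t).getVert_injOn hi hj h
  have hmem : ∀ t i, TreeLE G r ((P t).getVert i) t := fun t i =>
    (hle _ _).2 ((P t).getVert_mem_support i)
  have hlenv : ∀ t i, i ≤ (P t).length → (P ((P t).getVert i)).length = i := by
    intro t i hi
    exact hinj t _ _ (hlen _ _ (hmem t i)) hi (hvert' _ _ (hmem t i))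
  refine ⟨fun t => (P t).length, ?_, ?_, ?_, ?_, hlen, ?_, ?_, ?_, ?_⟩
  · intro t
    exact (hle t t).2 (P t).end_mem_support
  · intro s t u hst htu
    rw [hle] at hst htu ⊢
    rw [← htake t u htu] at hst
    exact (P u).support_takeUntil_subset_support htu hst
  · intro t
    exact (hle r t).2 (P t).start_mem_support
  · rw [← huniq r SimpleGraph.Walk.nil SimpleGraph.Walk.IsPath.nil]
    rfl
  · intro s t h h1
    change (P s).length = (P t).length at h1
    rw [← hvert' s t h, h1, SimpleGraph.Walk.getVert_length]
  · intro t j hj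
    exact ⟨(P t).getVert j, hmem t j, hlenv t j hj⟩
  · intro s s' t h h'
    wlog hss : (P s).length ≤ (P s').length generalizing s s'
    · exact (this s' s h' h (by omega)).symm
    left
    rw [← hvert' s t h, ← hvert s' t h' _ hss]
    exact hmem s' _
  · intro s t t' hs h h'
    wlog htt : (P t).length ≤ (P t').length generalizing t t'
    · exact (this t' t h' h (by omega)).symm
    left
    have hs1 : 1 ≤ (P s).length := by
      by_contra h0
      have h1 := hvert' s s ((hle s s).2 (P s).end_mem_support)
      rw [show (P s).length = 0 by omega, SimpleGraph.Walk.getVert_zero] at h1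
      exact hs h1.symm
    have key : ∀ j ≤ (P t).length, (P t).getVert j = (P t').getVert j := by
      intro j
      induction j using Nat.strong_induction_on with
      | _ j ih =>
        intro hj
        by_cases hjs : j ≤ (P s).length
        · rw [← hvert s t h j hjs, ← hvert s t' h' j hjs]
        · obtain ⟨i, rfl⟩ : ∃ i, j = i + 2 := ⟨j - 2, by omega⟩
          have e1 := ih (i + 1) (by omega) (by omega)
          have e0 := ih i (by omega) (by omega)
          by_contra hne
          have hv : (P t).getVert (i + 1) ≠ r := by
            intro hv
            have := hinj t (i + 1) 0 (by omega) (by omega)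
              (by rw [hv, SimpleGraph.Walk.getVert_zero])
            omega
          have hdeg := hG.degree_le _ hv
          have a1 : G.Adj ((P t).getVert (i + 1)) ((P t).getVert i) :=
            ((P t).adj_getVert_succ (by omega)).symm
          have a2 : G.Adj ((P t).getVert (i + 1)) ((P t).getVert (i + 2)) :=
            (P t).adj_getVert_succ (by omega)
          have a3 : G.Adj ((P t).getVert (i + 1)) ((P t').getVert (i + 2)) := by
            rw [e1]
            exact (P t').adj_getVert_succ (by omega)
          have n1 : (P t).getVert i ≠ (P t).getVert (i + 2) := fun e => by
            have := hinj t _ _ (by omega) (by omega) e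
            omega
          have n2 : (P t).getVert i ≠ (P t').getVert (i + 2) := fun e => by
            rw [e0] at e
            have := hinj t' _ _ (by omega) (by omega) e
            omega
          have hsub : {(P t).getVert i, (P t).getVert (i + 2), (P t').getVert (i + 2)} ⊆
              G.neighborSet ((P t).getVert (i + 1)) := by
            rintro x (rfl | rfl | rfl)
            · exact a1
            · exact a2
            · exact a3
          have hcard := (Set.encard_le_encard hsub).trans hdeg
          rw [Set.encard_insert_of_notMem (by
            rintro (e | e)
            · exact n1 e
            · exact n2 e), Set.encard_pair hne] at hcard
          exact absurd hcard (by norm_num)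
    have : (P t').getVert (P t).length = t := by
      rw [← key _ le_rfl, SimpleGraph.Walk.getVert_length]
    rw [← this]
    exact hmem t' _

/-- Every finite ordered fan is isomorphic to a standard one. -/
theorem exists_equiv_fan {𝓐 : RSStructure A} (h : RSStructure.IsOrderedFan A 𝓐) :
    ∃ n k, 1 ≤ n ∧ ∃ e : A ≃ Fan n k,
      (∀ x y, 𝓐.R x y ↔ (Fan.str n k).R (e x) (e y)) ∧
      ∀ x y, 𝓐.S x y ↔ (Fan.str n k).S (e x) (e y) := by
  classical
  obtain ⟨hfin, G, r, hG, ⟨k, hk⟩, hR, n, a, hS⟩ := h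
  obtain ⟨ht, H⟩ := exists_isFanOrder hG
  set le := TreeLE G r with hle
  have htot : ∀ b, IsBranch G r b → ∀ x ∈ b, ∀ y ∈ b, le x y ∨ le y x := by
    intro b hb x hx y hy
    by_cases hxy : x = y
    · exact Or.inl (hxy ▸ H.refl x)
    · exact hb.1 hx hy hxy
  have hmem : ∀ b, IsBranch G r b → ∀ x, (∀ y ∈ b, le x y ∨ le y x) → x ∈ b := by
    intro b hb x hx
    have hc : IsChain le (insert x b) := hb.1.insert fun y hy _ => hx y hy
    rw [hb.2 hc (Set.subset_insert x b)]
    exact Set.mem_insert x b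
  have hroot : ∀ b, IsBranch G r b → r ∈ b := fun b hb =>
    hmem b hb r fun y _ => Or.inl (H.root_le y)
  have hdown : ∀ b, IsBranch G r b → ∀ t ∈ b, ∀ s, le s t → s ∈ b := by
    intro b hb t ht s hst
    refine hmem b hb s fun y hy => ?_
    rcases htot b hb t ht y hy with h | h
    · exact Or.inl (H.trans _ _ _ hst h)
    · exact H.down _ _ _ hst h
  have huniq : ∀ b, IsBranch G r b → ∀ b', IsBranch G r b' → ∀ t, t ≠ r → t ∈ b → t ∈ b' →
      b ⊆ b' := by
    intro b hb b' hb' t htr htb htb' x hx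
    refine hmem b' hb' x fun y hy => ?_
    rcases htot b hb x hx t htb with h1 | h1 <;> rcases htot b' hb' t htb' y hy with h2 | h2
    · exact Or.inl (H.trans _ _ _ h1 h2)
    · exact H.down _ _ _ h1 h2
    · exact H.up _ _ _ htr h1 h2
    · exact Or.inr (H.trans _ _ _ h2 h1)
  have hinj : ∀ b, IsBranch G r b → Set.InjOn ht b := by
    intro b hb x hx y hy hxy
    rcases htot b hb x hx y hy with h | h
    · exact H.eq_of_ht _ _ h hxy
    · exact (H.eq_of_ht _ _ h hxy.symm).symm
  have hlek : ∀ b, IsBranch G r b → ∀ t ∈ b, ht t ≤ k := by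
    intro b hb t htb
    have h1 : Set.Iic (ht t) ⊆ ht '' b := by
      intro j hj
      obtain ⟨s, hs, hsj⟩ := H.exists_le t j hj
      exact ⟨s, hdown b hb t htb s hs, hsj⟩
    have h2 := Set.ncard_le_ncard h1 (Set.toFinite _)
    rw [(hinj b hb).ncard_image, hk b hb, ncard_Iic_nat] at h2
    omega
  have hex : ∀ b, IsBranch G r b → ∀ j ≤ k, ∃ t ∈ b, ht t = j := by
    intro b hb j hj
    have h1 : ht '' b ⊆ Set.Iic k := by
      rintro _ ⟨t, htb, rfl⟩
      exact hlek b hb t htb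
    have h2 : ht '' b = Set.Iic k := by
      refine Set.eq_of_subset_of_ncard_le h1 ?_ (Set.toFinite _)
      rw [(hinj b hb).ncard_image, hk b hb, ncard_Iic_nat]
    have : j ∈ ht '' b := h2 ▸ hj
    exact this
  have hbranch : ∀ t, ∃ i : Fin n, t ∈ (a i).1 := by
    intro t
    obtain ⟨M, hM, hsub⟩ := (IsChain.singleton (r := le) (a := t)).exists_maxChain
    refine ⟨a.symm ⟨M, hM⟩, ?_⟩
    rw [a.apply_symm_apply]
    exact hsub rfl
  choose idx hidx using hbranch
  have hidxu : ∀ t, t ≠ r → ∀ i, t ∈ (a i).1 → i = idx t := by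
    intro t htr i hi
    apply a.injective
    apply Subtype.ext
    exact (huniq _ (a i).2 _ (a (idx t)).2 t htr hi (hidx t)).antisymm
      (huniq _ (a (idx t)).2 _ (a i).2 t htr (hidx t) hi)
  have hr0 : ∀ t, ht t = 0 ↔ t = r := by
    intro t
    constructor
    · intro h
      exact (H.eq_of_ht _ _ (H.root_le t) (by rw [h, H.ht_root])).symm
    · rintro rfl
      exact H.ht_root
  let e : A → Fan n k := fun t => Fan.vtx n k (idx t) (ht t)
  have ehk : ∀ t, ht t ≤ k := fun t => hlek _ (a (idx t)).2 t (hidx t)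
  have eht : ∀ t, (e t).ht = ht t := fun t => Fan.ht_vtx (idx t).2 (ehk t)
  have ebr : ∀ t, t ≠ r → (e t).br = idx t := fun t h =>
    Fan.br_vtx (idx t).2 (ehk t) fun h' => h ((hr0 t).1 h')
  have ele : ∀ s t, le s t ↔ e s ≤ e t := by
    intro s t
    rw [Fan.le_def, eht, eht, hr0]
    constructor
    · intro h
      by_cases hs : s = r
      · exact Or.inl hs
      · have htr : t ≠ r := by
          rintro rfl
          have := H.ht_mono _ _ h
          rw [H.ht_root] at this
          exact hs ((hr0 s).1 (by omega))
        refine Or.inr ⟨H.ht_mono _ _ h, ?_⟩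
        rw [ebr s hs, ebr t htr,
          hidxu s hs (idx t) (hdown _ (a (idx t)).2 t (hidx t) s h)]
    · rintro (rfl | ⟨h1, h2⟩)
      · exact H.root_le t
      · by_cases hs : s = r
        · exact hs ▸ H.root_le t
        have htr : t ≠ r := by
          rintro rfl
          rw [H.ht_root] at h1
          exact hs ((hr0 s).1 (by omega))
        rw [ebr s hs, ebr t htr] at h2
        have hst : s ∈ (a (idx t)).1 := by
          rw [← Fin.ext h2]
          exact hidx s
        rcases htot _ (a (idx t)).2 s hst t (hidx t) with h | h
        · exact h
        · rw [H.eq_of_ht _ _ h (le_antisymm (H.ht_mono _ _ h) h1)]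
          exact H.refl s
  have einj : Function.Injective e := by
    intro s t h
    exact H.eq_of_ht s t ((ele s t).2 h.le) (by rw [← eht, ← eht, h])
  have esurj : Function.Surjective e := by
    intro x
    by_cases hx : x.ht = 0
    · exact ⟨r, Fan.eq_root (by rw [eht, H.ht_root]) |>.trans (Fan.eq_root hx).symm⟩
    · have hxp := x.prop
      obtain ⟨t, htb, htx⟩ := hex _ (a ⟨x.br, Fan.br_lt hx⟩).2 x.ht x.ht_le
      have htr : t ≠ r := fun h => hx (by rw [← htx, h, H.ht_root])
      refine ⟨t, Fan.ext ?_ ?_⟩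
      · rw [ebr t htr, ← hidxu t htr _ htb]
      · rw [eht, htx]
  have hn : 1 ≤ n := by
    have := (idx r).2
    omega
  refine ⟨n, k, hn, Equiv.ofBijective e ⟨einj, esurj⟩, fun x y => ?_, fun x y => ?_⟩
  · rw [hR]
    change _ ↔ e x = e y ∨ ((e y).ht = (e x).ht + 1 ∧ e x ≤ e y)
    rw [einj.eq_iff]
    refine or_congr Iff.rfl ?_
    rw [← Fan.isImmSucc_iff]
    unfold IsImmSucc
    simp only [Fan.treeLE_iff, ← ele]
    change _ ∧ _ ∧ (∀ p, le x p → le p y → _) ↔ le x y ∧ _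
    refine and_congr Iff.rfl (and_congr einj.ne_iff.symm ?_)
    constructor
    · intro h p hp hp'
      obtain ⟨p, rfl⟩ := esurj p
      rw [← ele] at hp hp'
      exact (h p hp hp').imp (congrArg e) (congrArg e)
    · intro h p hp hp'
      exact (h (e p) ((ele _ _).1 hp) ((ele _ _).1 hp')).imp (@einj _ _) (@einj _ _)
  · rw [hS]
    change _ ↔ (e x).ht = 0 ∨ (e y).ht = 0 ∨ (e x).br ≤ (e y).br
    rw [eht, eht, hr0, hr0]
    constructor
    · rintro ⟨i, j, hij, hx, hy⟩
      by_cases hxr : x = r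
      · exact Or.inl hxr
      by_cases hyr : y = r
      · exact Or.inr (Or.inl hyr)
      right; right
      rw [ebr x hxr, ebr y hyr, ← hidxu x hxr i hx, ← hidxu y hyr j hy]
      exact hij
    · intro h
      by_cases hxr : x = r
      · exact ⟨idx y, idx y, le_rfl, by rw [hxr]; exact hroot _ (a _).2, hidx y⟩
      by_cases hyr : y = r
      · exact ⟨idx x, idx x, le_rfl, hidx x, by rw [hyr]; exact hroot _ (a _).2⟩
      refine ⟨idx x, idx y, ?_, hidx x, hidx y⟩
      rcases h with h | h | h
      · exact absurd h hxr
      · exact absurd h hyr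
      · rw [ebr x hxr, ebr y hyr] at h
        exact h

end Tree

/-! ### A Ramsey theorem for words of climbing maps -/

section Ramsey

open Filter

attribute [local instance] Ultrafilter.semigroup

namespace Ultrafilter

theorem map_mul_of_hom {S T : Type*} [Semigroup S] [Semigroup T] (F : S → T)
    (hF : ∀ a b, F (a * b) = F a * F b) (u v : Ultrafilter S) :
    (u * v).map F = u.map F * v.map F := by
  refine Ultrafilter.coe_inj.mp (Filter.ext' fun p => ?_)
  rw [Ultrafilter.coe_map, Filter.eventually_map, Ultrafilter.eventually_mul,
    Ultrafilter.eventually_mul]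
  simp only [Ultrafilter.coe_map, Filter.eventually_map, hF]

theorem continuous_map {S T : Type*} (F : S → T) :
    Continuous (Ultrafilter.map F : Ultrafilter S → Ultrafilter T) :=
  ultrafilterBasis_is_basis.continuous_iff.2 <| Set.forall_mem_range.mpr fun s ↦
    ultrafilter_isOpen_basic (F ⁻¹' s)

theorem eventually_bind {S T : Type*} (u : Ultrafilter S) (F : S → Ultrafilter T) (p : T → Prop) :
    (∀ᶠ y in (u.bind F : Ultrafilter T), p y) ↔ ∀ᶠ x in u, ∀ᶠ y in F x, p y :=
  Iff.rfl

end Ultrafilter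

/-- A climbing map: it starts at `0` and each step goes up by `0` or `1`.  An epimorphism of fans
restricts to a climbing map on each branch. -/
@[ext]
structure Climb where
  /-- The underlying map. -/
  toFun : ℕ → ℕ
  zero : toFun 0 = 0
  le_succ : ∀ i, toFun i ≤ toFun (i + 1)
  succ_le : ∀ i, toFun (i + 1) ≤ toFun i + 1

namespace Climb

instance : CoeFun Climb fun _ => ℕ → ℕ := ⟨toFun⟩

theorem monotone (f : Climb) : Monotone f := monotone_nat_of_le_succ f.le_succ

theorem le_self (f : Climb) (j : ℕ) : f j ≤ j := by
  induction j with
  | zero => exact f.zero.le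
  | succ j ih => have := f.succ_le j; omega

/-- Composition of climbing maps. -/
def comp (f g : Climb) : Climb where
  toFun i := f (g i)
  zero := by rw [g.zero, f.zero]
  le_succ i := f.monotone (g.le_succ i)
  succ_le i := by
    have h1 := g.succ_le i
    have h2 := g.le_succ i
    have h3 := f.succ_le (g i)
    rcases h2.eq_or_lt with h | h
    · rw [← h]; omega
    · rw [show g (i + 1) = g i + 1 by omega]; exact h3

theorem comp_apply (f g : Climb) (i : ℕ) : f.comp g i = f (g i) := rfl

/-- The constant climbing map. -/
def const : Climb := ⟨fun _ => 0, rfl, fun _ => le_rfl, fun _ => by omega⟩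

/-- Follow `g` up to the time `p`, make one step up at that time, and stay there. -/
def jump (g : Climb) (p : ℕ) : Climb where
  toFun i := if i ≤ p then g i else g p + 1
  zero := by simp [g.zero]
  le_succ i := by
    have := g.le_succ i
    split_ifs with h1 h2 h2
    · exact this
    · rw [show i = p by omega]; omega
    · omega
    · exact le_rfl
  succ_le i := by
    have := g.succ_le i
    split_ifs with h1 h2 h2
    · exact this
    · omega
    · rw [show i = p by omega]
    · omega

/-- The words over climbing maps whose values are at most `k`, in which the value `k` occurs. -/
def Full (k : ℕ) (w : FreeMonoid Climb) : Prop :=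
  (∀ g ∈ w.toList, ∀ i, g i ≤ k) ∧ ∃ g ∈ w.toList, ∃ i, g i = k

theorem Full.mul {i j : ℕ} {v w : FreeMonoid Climb} (hv : Full i v) (hw : Full j w) :
    Full (max i j) (v * w) := by
  obtain ⟨h1, g, hg, a, ha⟩ := hv
  obtain ⟨h2, g', hg', a', ha'⟩ := hw
  constructor
  · intro f hf c
    rw [FreeMonoid.toList_mul, List.mem_append] at hf
    rcases hf with hf | hf
    · exact (h1 f hf c).trans (le_max_left _ _)
    · exact (h2 f hf c).trans (le_max_right _ _)
  · rcases le_total i j with h | h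
    · exact ⟨g', by simp [hg'], a', by rw [ha', max_eq_right h]⟩
    · exact ⟨g, by simp [hg], a, by rw [ha, max_eq_left h]⟩

/-- The action of a climbing map on words. -/
def act (f : Climb) : FreeMonoid Climb →* FreeMonoid Climb := FreeMonoid.map f.comp

/-- Climbing maps of height `k` whose `k` jumps are generic for a nonprincipal ultrafilter. -/
noncomputable def generic : ℕ → Ultrafilter Climb
  | 0 => pure const
  | k + 1 => (generic k).bind fun g => (hyperfilter ℕ).map g.jump

theorem eventually_generic (k : ℕ) :
    ∀ᶠ g in (generic k : Filter Climb), ∃ p, ∀ i, g i ≤ k ∧ (p ≤ i → g i = k) := by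
  induction k with
  | zero =>
    change ∀ᶠ g in (pure const : Filter Climb), _
    rw [eventually_pure]
    exact ⟨0, fun i => ⟨le_rfl, fun _ => rfl⟩⟩
  | succ k ih =>
    rw [generic, Ultrafilter.eventually_bind]
    filter_upwards [ih] with g hg
    obtain ⟨p, hp⟩ := hg
    rw [Ultrafilter.coe_map, eventually_map]
    have h : ∀ᶠ m in (hyperfilter ℕ : Filter ℕ), p ≤ m :=
      Nat.hyperfilter_le_atTop (eventually_ge_atTop p)
    filter_upwards [h] with m hm
    refine ⟨m + 1, fun i => ?_⟩
    have h1 := hp i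
    have h2 := hp m
    simp only [jump]
    split_ifs with h3
    · exact ⟨by omega, fun _ => by omega⟩
    · exact ⟨by omega, fun _ => by omega⟩

theorem map_comp_generic (f : Climb) (k : ℕ) : (generic k).map f.comp = generic (f k) := by
  induction k with
  | zero =>
    rw [f.zero, generic, Ultrafilter.map_pure]
    congr 1
    ext i
    exact f.zero
  | succ k ih =>
    have h1 := f.le_succ k
    have h2 := f.succ_le k
    refine Ultrafilter.coe_inj.mp (Filter.ext' fun P => ?_)
    rw [Ultrafilter.coe_map, eventually_map, generic, Ultrafilter.eventually_bind]
    have key : ∀ᶠ g in (generic k : Filter Climb), ∀ᶠ m in (hyperfilter ℕ : Filter ℕ),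
        f.comp (g.jump m) = if f (k + 1) = f k then f.comp g else (f.comp g).jump m := by
      filter_upwards [eventually_generic k] with g hg
      obtain ⟨p, hp⟩ := hg
      have h : ∀ᶠ m in (hyperfilter ℕ : Filter ℕ), p ≤ m :=
        Nat.hyperfilter_le_atTop (eventually_ge_atTop p)
      filter_upwards [h] with m hm
      have hm1 := (hp m).2 hm
      split_ifs with h4
      · ext i
        simp only [comp, jump]
        split_ifs with h3
        · rfl
        · rw [hm1, (hp i).2 (by omega), h4]
      · ext i
        simp only [comp, jump]
        split_ifs with h3
        · rfl
        · rw [hm1]; omega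
    split_ifs at key with h4
    · rw [h4, ← ih, Ultrafilter.coe_map, eventually_map]
      apply eventually_congr
      filter_upwards [key] with g hg
      rw [Ultrafilter.coe_map, eventually_map, eventually_congr (hg.mono fun m hm => by rw [hm])]
      exact eventually_const
    · rw [show f (k + 1) = f k + 1 by omega, generic, Ultrafilter.eventually_bind, ← ih,
        Ultrafilter.coe_map, eventually_map]
      apply eventually_congr
      filter_upwards [key] with g hg
      rw [Ultrafilter.coe_map, eventually_map, Ultrafilter.coe_map, eventually_map]
      exact eventually_congr (hg.mono fun m hm => by rw [hm])

/-- The equivariant families of ultrafilters: `z k` lives on the words of height `k`, and the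
action of a climbing map `f` takes `z k` to `z (f k)`. -/
def families : Set (ℕ → Ultrafilter (FreeMonoid Climb)) :=
  {z | (∀ k, {w | Full k w} ∈ z k) ∧ ∀ (f : Climb) k, (z k).map f.act = z (f k)}

theorem families_nonempty : families.Nonempty := by
  refine ⟨fun k => (generic k).map FreeMonoid.of, fun k => ?_, fun f k => ?_⟩
  · rw [Ultrafilter.mem_map]
    filter_upwards [eventually_generic k] with g hg
    obtain ⟨p, hp⟩ := hg
    refine ⟨fun f hf i => ?_, g, ?_, p, (hp p).2 le_rfl⟩
    · rw [FreeMonoid.toList_of, List.mem_singleton] at hf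
      exact hf ▸ (hp i).1
    · rw [FreeMonoid.toList_of]; exact List.mem_singleton.2 rfl
  · change ((generic k).map FreeMonoid.of).map f.act = (generic (f k)).map FreeMonoid.of
    rw [Ultrafilter.map_map, ← map_comp_generic f k, Ultrafilter.map_map]
    rfl

theorem isClosed_families : IsClosed families := by
  have h1 : families = (⋂ k, {z | {w | Full k w} ∈ z k}) ∩
      ⋂ (f : Climb) (k : ℕ), {z | (z k).map f.act = z (f k)} := by
    ext z
    simp [families]
  rw [h1]
  refine (isClosed_iInter fun k => ?_).inter (isClosed_iInter fun f => isClosed_iInter fun k => ?_)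
  · exact IsClosed.preimage (f := fun z : ℕ → Ultrafilter (FreeMonoid Climb) => z k)
      (continuous_apply k) (ultrafilter_isClosed_basic {w | Full k w})
  · exact isClosed_eq ((Ultrafilter.continuous_map _).comp (continuous_apply k))
      (continuous_apply _)

theorem mul_mem_families {y z : ℕ → Ultrafilter (FreeMonoid Climb)} (hy : y ∈ families)
    (hz : z ∈ families) : y * z ∈ families := by
  refine ⟨fun k => ?_, fun f k => ?_⟩
  · change ∀ᶠ w in ((y k * z k : Ultrafilter _) : Filter (FreeMonoid Climb)), Full k w
    rw [Ultrafilter.eventually_mul]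
    filter_upwards [hy.1 k] with v hv
    filter_upwards [hz.1 k] with w hw
    have := hv.mul hw
    rwa [max_self] at this
  · change (y k * z k).map f.act = y (f k) * z (f k)
    rw [Ultrafilter.map_mul_of_hom _ (map_mul _), hy.2, hz.2]

theorem mem_mul_full {y z : Ultrafilter (FreeMonoid Climb)} {i j : ℕ}
    (hy : {w | Full i w} ∈ y) (hz : {w | Full j w} ∈ z) : {w | Full (max i j) w} ∈ y * z := by
  change ∀ᶠ w in ((y * z : Ultrafilter _) : Filter (FreeMonoid Climb)), Full _ w
  rw [Ultrafilter.eventually_mul]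
  filter_upwards [hy] with v hv
  filter_upwards [hz] with w hw
  exact hv.mul hw

/-- One step of the construction of an equivariant family of idempotents that absorb each other on
the right.  The products `e i * e (i - 1) * ⋯ * e j` of an idempotent equivariant family are again
equivariant because climbing maps have steps of size at most one, and they absorb `e j`. -/
theorem exists_absorbing (j : ℕ) :
    ∃ e ∈ families, ∀ i < j, ∀ i', i ≤ i' → e i' * e i = e i' := by
  induction j with
  | zero =>
    obtain ⟨e, he⟩ := families_nonempty
    exact ⟨e, he, fun i hi => absurd hi (Nat.not_lt_zero i)⟩
  | succ j ih =>
    obtain ⟨d, hd, hdj⟩ := ih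
    let Q : Set (ℕ → Ultrafilter (FreeMonoid Climb)) :=
      {y | y ∈ families ∧ (∀ i < j, y i = d i) ∧ ∀ i < j, ∀ i', i ≤ i' → y i' * d i = y i'}
    have hQ : IsClosed Q := by
      refine isClosed_families.inter (IsClosed.inter ?_ ?_)
      · have : {y : ℕ → Ultrafilter (FreeMonoid Climb) | ∀ i < j, y i = d i} =
            ⋂ (i) (_ : i < j), {y | y i = d i} := by
          ext; simp
        change IsClosed {y : ℕ → Ultrafilter (FreeMonoid Climb) | ∀ i < j, y i = d i}
        rw [this]
        exact isClosed_iInter fun i => isClosed_iInter fun _ =>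
          isClosed_eq (continuous_apply i) continuous_const
      · have : {y : ℕ → Ultrafilter (FreeMonoid Climb) |
              ∀ i < j, ∀ i', i ≤ i' → y i' * d i = y i'} =
            ⋂ (i) (_ : i < j) (i') (_ : i ≤ i'), {y | y i' * d i = y i'} := by
          ext; simp
        change IsClosed {y : ℕ → Ultrafilter (FreeMonoid Climb) |
              ∀ i < j, ∀ i', i ≤ i' → y i' * d i = y i'}
        rw [this]
        exact isClosed_iInter fun i => isClosed_iInter fun _ => isClosed_iInter fun i' =>
          isClosed_iInter fun _ => isClosed_eq
            ((Ultrafilter.continuous_mul_left (d i)).comp (continuous_apply i'))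
            (continuous_apply i')
    obtain ⟨e, ⟨he, hed, heQ⟩, hee⟩ := exists_idempotent_in_compact_subsemigroup
      (M := ℕ → Ultrafilter (FreeMonoid Climb))
      (fun r => continuous_pi fun i =>
        (Ultrafilter.continuous_mul_left (r i)).comp (continuous_apply i))
      Q ⟨d, hd, fun _ _ => rfl, hdj⟩ hQ.isCompact (by
        rintro x ⟨hx1, hx2, hx3⟩ y ⟨hy1, hy2, hy3⟩
        refine ⟨mul_mem_families hx1 hy1, fun i hi => ?_, fun i hi i' hi' => ?_⟩
        · change x i * y i = d i
          rw [hx2 i hi, hy2 i hi, hdj i hi i le_rfl]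
        · change x i' * y i' * d i = x i' * y i'
          rw [mul_assoc, hy3 i hi i' hi'])
    have hee' : ∀ i, e i * e i = e i := fun i => congrFun hee i
    have hee2 : ∀ i < j, ∀ i', i ≤ i' → e i' * e i = e i' := fun i hi i' hi' => by
      rw [hed i hi]; exact heQ i hi i' hi'
    let y : ℕ → Ultrafilter (FreeMonoid Climb) :=
      fun i => Nat.rec (e 0) (fun i yi => if i + 1 ≤ j then e (i + 1) else e (i + 1) * yi) i
    have hy0 : y 0 = e 0 := rfl
    have hys : ∀ i, y (i + 1) = if i + 1 ≤ j then e (i + 1) else e (i + 1) * y i := fun i => rfl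
    have hyle : ∀ i ≤ j, y i = e i := by
      intro i hi
      cases i with
      | zero => rfl
      | succ i => rw [hys, if_pos hi]
    have hygt : ∀ i, j ≤ i → y (i + 1) = e (i + 1) * y i := by
      intro i hi
      rw [hys, if_neg (by omega)]
    -- absorbing a factor `e i` on the left
    have hleft : ∀ i, e i * y i = y i := by
      intro i
      by_cases hi : i ≤ j
      · rw [hyle i hi, hee']
      · obtain ⟨i, rfl⟩ : ∃ i', i = i' + 1 := ⟨i - 1, by omega⟩
        rw [hygt i (by omega), ← mul_assoc, hee']
    have hyfull : ∀ k, {w | Full k w} ∈ y k := by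
      intro k
      induction k with
      | zero => exact he.1 0
      | succ k ihk =>
        rw [hys]
        split_ifs
        · exact he.1 _
        · have := mem_mul_full (he.1 (k + 1)) ihk
          rwa [max_eq_left (Nat.le_succ k)] at this
    have hyact : ∀ (f : Climb) k, (y k).map f.act = y (f k) := by
      intro f k
      induction k with
      | zero => rw [f.zero, hy0, he.2, f.zero]
      | succ k ihk =>
        have h1 := f.le_succ k
        have h2 := f.succ_le k
        have h3 := f.le_self (k + 1)
        by_cases hk : k + 1 ≤ j
        · rw [hyle _ hk, hyle _ (h3.trans hk), he.2]
        · rw [hygt k (by omega), Ultrafilter.map_mul_of_hom _ (map_mul _), he.2, ihk]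
          rcases h1.eq_or_lt with h | h
          · rw [← h, hleft]
          · have h4 : f (k + 1) = f k + 1 := by omega
            rw [h4]
            by_cases h5 : j ≤ f k
            · rw [hygt _ h5]
            · rw [hyle (f k) (by omega), hyle (f k + 1) (by omega)]
              exact hee2 _ (by omega) _ (Nat.le_succ _)
    have habs : ∀ i < j, ∀ i', i ≤ i' → y i' * e i = y i' := by
      intro i hi i' hi'
      by_cases h : i' ≤ j
      · rw [hyle _ h]; exact hee2 i hi i' hi'
      · induction i' with
        | zero => omega
        | succ k ihk =>
          rw [hygt k (by omega), mul_assoc]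
          by_cases hk : k ≤ j
          · rw [hyle k hk, hee2 i hi k (by omega)]
          · rw [ihk (by omega) hk]
    have habsj : ∀ i', j ≤ i' → y i' * e j = y i' := by
      intro i' hi'
      induction i', hi' using Nat.le_induction with
      | base => rw [hyle j le_rfl, hee']
      | succ k hk ihk => rw [hygt k hk, mul_assoc, ihk]
    refine ⟨y, ⟨hyfull, hyact⟩, fun i hi i' hi' => ?_⟩
    rw [hyle i (by omega)]
    rcases Nat.lt_succ_iff_lt_or_eq.1 hi with h | rfl
    · exact habs i h i' hi'
    · exact habsj i' hi'

/-- For each bound `K` there is an equivariant family of ultrafilters on words that is a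
semilattice in the heights up to `K`. -/
theorem exists_coherent (K : ℕ) : ∃ z : ℕ → Ultrafilter (FreeMonoid Climb),
    (∀ k ≤ K, {w | Full k w} ∈ z k) ∧ (∀ (f : Climb), ∀ k ≤ K, (z k).map f.act = z (f k)) ∧
    ∀ i ≤ K, ∀ j ≤ K, z i * z j = z (max i j) := by
  obtain ⟨e, he, hee⟩ := exists_absorbing (K + 1)
  obtain ⟨z, hz0, hzs⟩ : ∃ z : ℕ → Ultrafilter (FreeMonoid Climb),
      z 0 = e 0 ∧ ∀ i, z (i + 1) = z i * e (i + 1) :=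
    ⟨fun i => Nat.rec (e 0) (fun i zi => zi * e (i + 1)) i, rfl, fun _ => rfl⟩
  -- `z i` absorbs `e j` on the right for `j ≤ i`
  have hr : ∀ i ≤ K, ∀ j ≤ i, z i * e j = z i := by
    intro i hi j hj
    cases i with
    | zero =>
      obtain rfl : j = 0 := by omega
      rw [hz0]; exact hee 0 (by omega) 0 le_rfl
    | succ i => rw [hzs, mul_assoc, hee j (by omega) _ hj]
  have h1 : ∀ j ≤ K, ∀ i ≤ j, z i * z j = z j := by
    intro j hj i hi
    induction j with
    | zero =>
      obtain rfl : i = 0 := by omega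
      rw [hz0]; exact hee 0 (by omega) 0 le_rfl
    | succ j ih =>
      rcases hi.eq_or_lt with rfl | h
      · have : z (j + 1) * z j = z (j + 1) := by
          suffices ∀ a ≤ j, z (j + 1) * z a = z (j + 1) from this j le_rfl
          intro a ha
          induction a with
          | zero => rw [hz0]; exact hr (j + 1) hj 0 (by omega)
          | succ a iha =>
            rw [hzs a, ← mul_assoc, iha (by omega), hr (j + 1) hj (a + 1) (by omega)]
        calc z (j + 1) * z (j + 1) = z (j + 1) * z j * e (j + 1) := by
              rw [mul_assoc, ← hzs j]
          _ = z (j + 1) := by rw [this, hr _ hj _ le_rfl]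
      · rw [hzs j, ← mul_assoc, ih (by omega) (by omega)]
  have h2 : ∀ i ≤ K, ∀ j ≤ i, z i * z j = z i := by
    intro i hi j hj
    induction j with
    | zero => rw [hz0]; exact hr i hi 0 hj
    | succ j ih => rw [hzs j, ← mul_assoc, ih (by omega), hr i hi _ hj]
  refine ⟨z, fun k _ => ?_, fun f k hk => ?_, fun i hi j hj => ?_⟩
  · induction k with
    | zero => rw [hz0]; exact he.1 0
    | succ k ih =>
      rw [hzs]
      have := mem_mul_full (ih (by omega)) (he.1 (k + 1))
      rwa [max_eq_right (Nat.le_succ k)] at this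
  · induction k with
    | zero => rw [f.zero, hz0, he.2, f.zero]
    | succ k ih =>
      have h3 := f.le_succ k
      have h4 := f.succ_le k
      have h5 := f.le_self k
      rw [hzs, Ultrafilter.map_mul_of_hom _ (map_mul _), he.2, ih (by omega)]
      rcases h3.eq_or_lt with h | h
      · rw [← h, hr _ (by omega) _ le_rfl]
      · rw [show f (k + 1) = f k + 1 by omega, hzs]
  · rcases le_total i j with h | h
    · rw [max_eq_right h, h1 j hj i h]
    · rw [max_eq_left h, h2 i hi j h]

/-! ### Words labelled by branches -/

/-- Put a branch label on all letters of a word. -/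
def label (b : ℕ) : FreeMonoid Climb →* FreeMonoid (ℕ × Climb) := FreeMonoid.map fun g => (b, g)

/-- The action of a family of climbing maps, one for each branch, with relabelling by `β`. -/
def relabel (β : ℕ → ℕ) (f : ℕ → Climb) : FreeMonoid (ℕ × Climb) →* FreeMonoid (ℕ × Climb) :=
  FreeMonoid.map fun p => (β p.1, (f p.1).comp p.2)

/-- The product of the copies of an ultrafilter with labels `0, …, m - 1`. -/
noncomputable def labelProd (u : Ultrafilter (FreeMonoid Climb)) :
    ℕ → Ultrafilter (FreeMonoid (ℕ × Climb))
  | 0 => pure 1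
  | m + 1 => labelProd u m * u.map (label m)

theorem pure_one_mul {S : Type*} [Monoid S] (u : Ultrafilter S) :
    (pure 1 : Ultrafilter S) * u = u := by
  refine Ultrafilter.coe_inj.mp (Filter.ext' fun P => ?_)
  rw [Ultrafilter.eventually_mul, Ultrafilter.coe_pure, eventually_pure]
  simp only [one_mul]

theorem labelProd_one (u : Ultrafilter (FreeMonoid Climb)) :
    labelProd u 1 = u.map (label 0) :=
  pure_one_mul _

/-- The combinatorial content of an epimorphism from the fan with `m` branches of height `l` to the
fan with `n` branches of height `k`: the branch `b` is mapped by `f b` to the branch `β b`. -/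
structure IsPattern (m l n k : ℕ) (β : ℕ → ℕ) (f : ℕ → Climb) : Prop where
  mono : ∀ b b', b ≤ b' → b' < m → β b ≤ β b'
  lt : ∀ b < m, β b < n
  le : ∀ b < m, f b l ≤ k
  full : ∀ i < n, ∃ b < m, β b = i ∧ f b l = k

/-- The words that code an epimorphism to the fan with `m` branches of height `l`. -/
structure Good (m l : ℕ) (w : FreeMonoid (ℕ × Climb)) : Prop where
  sorted : w.toList.Pairwise fun p q => p.1 ≤ q.1
  lt : ∀ p ∈ w.toList, p.1 < m
  le : ∀ p ∈ w.toList, ∀ i, p.2 i ≤ l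
  full : ∀ b < m, ∃ p ∈ w.toList, p.1 = b ∧ ∃ i, p.2 i = l

theorem good_labelProd {u : Ultrafilter (FreeMonoid Climb)} {l : ℕ} (hu : {w | Full l w} ∈ u)
    (m : ℕ) : ∀ᶠ w in (labelProd u m : Filter (FreeMonoid (ℕ × Climb))), Good m l w := by
  induction m with
  | zero =>
    rw [labelProd, Ultrafilter.coe_pure, eventually_pure]
    exact ⟨by simp, by simp, by simp, by simp⟩
  | succ m ih =>
    rw [labelProd, Ultrafilter.eventually_mul]
    filter_upwards [ih] with v hv
    rw [Ultrafilter.coe_map, eventually_map]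
    filter_upwards [hu] with w hw
    have hmem : ∀ p, p ∈ (v * label m w).toList ↔
        p ∈ v.toList ∨ ∃ g ∈ w.toList, (m, g) = p := by
      intro p
      simp [label, FreeMonoid.toList_mul, FreeMonoid.toList_map]
    refine ⟨?_, ?_, ?_, ?_⟩
    · rw [FreeMonoid.toList_mul, List.pairwise_append]
      refine ⟨hv.sorted, ?_, ?_⟩
      · rw [label, FreeMonoid.toList_map, List.pairwise_map]
        exact List.pairwise_of_forall fun _ _ => le_rfl
      · intro p hp q hq
        rw [label, FreeMonoid.toList_map, List.mem_map] at hq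
        obtain ⟨g, -, rfl⟩ := hq
        exact (hv.lt p hp).le
    · intro p hp
      rcases (hmem p).1 hp with h | ⟨g, hg, rfl⟩
      · exact (hv.lt p h).trans (Nat.lt_succ_self m)
      · exact Nat.lt_succ_self m
    · intro p hp
      rcases (hmem p).1 hp with h | ⟨g, hg, rfl⟩
      · exact hv.le p h
      · exact hw.1 g hg
    · intro b hb
      rcases Nat.lt_succ_iff_lt_or_eq.1 hb with h | rfl
      · obtain ⟨p, hp, h1⟩ := hv.full b h
        exact ⟨p, (hmem p).2 (Or.inl hp), h1⟩
      · obtain ⟨g, hg, h1⟩ := hw.2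
        exact ⟨(b, g), (hmem _).2 (Or.inr ⟨g, hg, rfl⟩), rfl, h1⟩

theorem map_relabel_label (β : ℕ → ℕ) (f : ℕ → Climb) (b : ℕ)
    (u : Ultrafilter (FreeMonoid Climb)) :
    (u.map (label b)).map (relabel β f) = (u.map (f b).act).map (label (β b)) := by
  rw [Ultrafilter.map_map, Ultrafilter.map_map]
  congr 1
  funext w
  simp only [Function.comp_apply, relabel, label, act, FreeMonoid.map_map]
  rfl

/-- A pattern takes the generic words for its source to the generic words for its target. -/
theorem map_labelProd {z : ℕ → Ultrafilter (FreeMonoid Climb)} {K m l n k : ℕ}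
    (hact : ∀ (f : Climb), ∀ k ≤ K, (z k).map f.act = z (f k))
    (hmul : ∀ i ≤ K, ∀ j ≤ K, z i * z j = z (max i j)) (hl : l ≤ K) (hk : k ≤ K) (hm : 1 ≤ m)
    {β : ℕ → ℕ} {f : ℕ → Climb} (hp : IsPattern m l n k β f) :
    (labelProd (z l) m).map (relabel β f) = labelProd (z k) n := by
  have step : ∀ b, (labelProd (z l) (b + 1)).map (relabel β f) =
      (labelProd (z l) b).map (relabel β f) * (z (f b l)).map (label (β b)) := by
    intro b
    rw [labelProd, Ultrafilter.map_mul_of_hom _ (map_mul _), map_relabel_label, hact _ _ hl]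
  have base : (labelProd (z l) 1).map (relabel β f) = (z (f 0 l)).map (label (β 0)) := by
    rw [labelProd_one, map_relabel_label, hact _ _ hl]
  have inv : ∀ b < m, ∃ t ≤ k, (∀ c ≤ b, β c = β b → f c l ≤ t) ∧
      (labelProd (z l) (b + 1)).map (relabel β f) =
        labelProd (z k) (β b) * (z t).map (label (β b)) := by
    intro b
    induction b with
    | zero =>
      intro hb
      have h0 : β 0 = 0 := by
        obtain ⟨c, hc, hc0, -⟩ := hp.full 0 (by have := hp.lt 0 hb; omega)
        have := hp.mono 0 c (Nat.zero_le c) hc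
        omega
      refine ⟨f 0 l, hp.le 0 hb, fun c hc _ => ?_, ?_⟩
      · rw [Nat.le_zero.1 hc]
      · rw [base, h0]
        exact (pure_one_mul _).symm
    | succ b ih =>
      intro hb
      obtain ⟨t, ht, htc, hprod⟩ := ih (by omega)
      have hmono := hp.mono b (b + 1) (by omega) hb
      rcases hmono.eq_or_lt with h | h
      · refine ⟨max t (f (b + 1) l), max_le ht (hp.le _ hb), fun c hc hcb => ?_, ?_⟩
        · rcases Nat.lt_succ_iff_lt_or_eq.1 (Nat.lt_succ_of_le hc) with h1 | rfl
          · exact (htc c (by omega) (by rw [hcb, h])).trans (le_max_left _ _)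
          · exact le_max_right _ _
        · rw [step, hprod, ← h, mul_assoc, ← Ultrafilter.map_mul_of_hom _ (map_mul _),
            hmul _ (ht.trans hk) _ ((hp.le _ hb).trans hk)]
      · have h1 : β (b + 1) = β b + 1 := by
          by_contra h2
          obtain ⟨c, hc, hc1, -⟩ := hp.full (β b + 1) (by have := hp.lt _ hb; omega)
          by_cases h3 : c ≤ b
          · have := hp.mono c b h3 (by omega); omega
          · have := hp.mono (b + 1) c (by omega) hc; omega
        have h2 : t = k := by
          obtain ⟨c, hc, hc1, hc2⟩ := hp.full (β b) (hp.lt b (by omega))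
          have h3 : c ≤ b := by
            by_contra h3
            have := hp.mono (b + 1) c (by omega) hc
            omega
          exact le_antisymm ht (hc2 ▸ htc c h3 hc1)
        refine ⟨f (b + 1) l, hp.le _ hb, fun c hc hcb => ?_, ?_⟩
        · rcases Nat.lt_succ_iff_lt_or_eq.1 (Nat.lt_succ_of_le hc) with h3 | rfl
          · have := hp.mono c b (by omega) (by omega)
            omega
          · exact le_rfl
        · rw [step, hprod, h1, h2]
          rfl
  obtain ⟨t, ht, htc, hprod⟩ := inv (m - 1) (by omega)
  have hn : β (m - 1) + 1 = n := by
    have h1 := hp.lt (m - 1) (by omega)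
    obtain ⟨c, hc, hc1, -⟩ := hp.full (n - 1) (by omega)
    have := hp.mono c (m - 1) (by omega) (by omega)
    omega
  have h2 : t = k := by
    obtain ⟨c, hc, hc1, hc2⟩ := hp.full (β (m - 1)) (hp.lt _ (by omega))
    exact le_antisymm ht (hc2 ▸ htc c (by omega) hc1)
  rw [← hn, show m = m - 1 + 1 by omega, hprod, h2, Nat.add_sub_cancel]
  rfl

/-- The Ramsey theorem for words: for a map `F` from words to a compact space there is a point
such that, for any finite set of patterns with a common source, some word for the source has all
images under the patterns mapped close to that point. -/
theorem exists_good_near {X : Type*} [TopologicalSpace X] [CompactSpace X]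
    (F : FreeMonoid (ℕ × Climb) → X) (m l n k : ℕ) (hm : 1 ≤ m) :
    ∃ x : X, ∀ O ∈ 𝓝 x, ∀ Q : Set ((ℕ → ℕ) × (ℕ → Climb)), Q.Finite →
      (∀ q ∈ Q, IsPattern m l n k q.1 q.2) →
      ∃ w, Good m l w ∧ ∀ q ∈ Q, F (relabel q.1 q.2 w) ∈ O := by
  obtain ⟨z, hfull, hact, hmul⟩ := exists_coherent (max l k)
  let u := (labelProd (z k) n).map F
  obtain ⟨x, -, hx⟩ := isCompact_univ.ultrafilter_le_nhds u (by simp)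
  refine ⟨x, fun O hO Q hQ hpat => ?_⟩
  have h1 : ∀ q ∈ Q, ∀ᶠ w in (labelProd (z l) m : Filter (FreeMonoid (ℕ × Climb))),
      F (relabel q.1 q.2 w) ∈ O := by
    intro q hq
    have h2 : O ∈ (labelProd (z k) n).map F := hx hO
    rw [← map_labelProd hact hmul (le_max_left _ _) (le_max_right _ _) hm (hpat q hq)] at h2
    exact h2
  have h3 := (good_labelProd (hfull l (le_max_left _ _)) m).and
    ((Filter.eventually_all_finite hQ).2 h1)
  exact h3.exists

end Climb

end Ramsey

/-! ### Epimorphisms between standard fans as patterns -/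

namespace Climb

/-- The map of fans coded by a pattern. -/
def patMap {m l : ℕ} (n k : ℕ) (β : ℕ → ℕ) (f : ℕ → Climb) (a : Fan m l) : Fan n k :=
  Fan.vtx n k (β a.br) (f a.br a.ht)

namespace IsPattern

variable {m l n k : ℕ} {β : ℕ → ℕ} {f : ℕ → Climb}

theorem le' (h : IsPattern m l n k β f) {b j : ℕ} (hb : b < m) (hj : j ≤ l) : f b j ≤ k :=
  ((f b).monotone hj).trans (h.le b hb)

theorem ht_patMap (h : IsPattern m l n k β f) (a : Fan m l) :
    (patMap n k β f a).ht = f a.br a.ht := by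
  unfold patMap
  by_cases ha : a.ht = 0
  · rw [ha, (f a.br).zero, Fan.ht_vtx_zero]
  · exact Fan.ht_vtx (h.lt _ (Fan.br_lt ha)) (h.le' (Fan.br_lt ha) a.ht_le)

theorem br_patMap (h : IsPattern m l n k β f) (a : Fan m l) (ha : (patMap n k β f a).ht ≠ 0) :
    a.ht ≠ 0 ∧ (patMap n k β f a).br = β a.br := by
  rw [h.ht_patMap] at ha
  have h0 : a.ht ≠ 0 := by
    intro h0
    rw [h0, (f a.br).zero] at ha
    exact ha rfl
  exact ⟨h0, Fan.br_vtx (h.lt _ (Fan.br_lt h0)) (h.le' (Fan.br_lt h0) a.ht_le) ha⟩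

theorem isEpi (h : IsPattern m l n k β f) (hk : 1 ≤ k) :
    RSStructure.IsEpi (Fan.str m l) (Fan.str n k) (patMap n k β f) := by
  refine Fan.isEpi_of hk ?_ ?_ ?_ ?_
  · apply Fan.eq_root
    rw [h.ht_patMap]
    exact (f _).zero
  · rintro a b (rfl | ⟨h1, h2⟩)
    · exact Or.inl rfl
    · have e1 := h.ht_patMap a
      have e2 := h.ht_patMap b
      by_cases ha : a.ht = 0
      · rw [ha, (f _).zero] at e1
        have h3 := (f b.br).le_self b.ht
        rcases Nat.eq_zero_or_pos (patMap n k β f b).ht with h4 | h4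
        · exact Or.inl (by rw [Fan.eq_root e1, Fan.eq_root h4])
        · exact Or.inr ⟨by omega, Or.inl e1⟩
      · have hbr : a.br = b.br := by
          rw [Fan.le_def] at h2
          omega
        have h3 := (f b.br).le_succ a.ht
        have h4 := (f b.br).succ_le a.ht
        rw [hbr] at e1
        rw [h1] at e2
        have h5 : patMap n k β f a ≤ patMap n k β f b := by
          rcases Nat.eq_zero_or_pos (patMap n k β f a).ht with h6 | h6
          · exact Or.inl h6
          · refine Or.inr ⟨by omega, ?_⟩
            rw [(h.br_patMap a (by omega)).2, (h.br_patMap b (by omega)).2, hbr]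
        rcases h3.eq_or_lt with h6 | h6
        · exact Or.inl (Fan.eq_of_le_of_le h5 le_rfl (by omega))
        · exact Or.inr ⟨by omega, h5⟩
  · intro a b hab
    by_cases ha : (patMap n k β f a).ht = 0
    · exact Or.inl ha
    by_cases hb : (patMap n k β f b).ht = 0
    · exact Or.inr (Or.inl hb)
    obtain ⟨ha0, ha1⟩ := h.br_patMap a ha
    obtain ⟨hb0, hb1⟩ := h.br_patMap b hb
    right; right
    rw [ha1, hb1]
    unfold Fan.S at hab
    exact h.mono _ _ (by omega) (Fan.br_lt hb0)
  · intro i hi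
    obtain ⟨b, hb, hbi, hbk⟩ := h.full i hi
    have hl : l ≠ 0 := by
      rintro rfl
      rw [(f b).zero] at hbk
      omega
    refine ⟨Fan.vtx m l b l, ?_⟩
    unfold patMap
    rw [Fan.ht_vtx hb le_rfl, Fan.br_vtx hb le_rfl hl, hbi, hbk]

end IsPattern

/-- Every epimorphism of standard fans is given by a pattern. -/
theorem exists_pattern {m l n k : ℕ} (hn : 1 ≤ n) (hk : 1 ≤ k) {q : Fan m l → Fan n k}
    (hq : RSStructure.IsEpi (Fan.str m l) (Fan.str n k) q) :
    ∃ β f, IsPattern m l n k β f ∧ q = patMap n k β f := by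
  have hmono := Fan.epi_monotone hq
  let top : ℕ → Fan n k := fun b => q (Fan.vtx m l b l)
  let β : ℕ → ℕ := fun b => (Finset.range (b + 1)).sup fun b' => (top b').br
  have hvle : ∀ b < m, ∀ j j', j ≤ j' → j' ≤ l → Fan.vtx m l b j ≤ Fan.vtx m l b j' := by
    intro b hb j j' hj hj'
    rw [Fan.le_def, Fan.ht_vtx hb hj', Fan.ht_vtx hb (hj.trans hj')]
    by_cases h0 : j = 0
    · exact Or.inl h0
    · rw [Fan.br_vtx hb hj' (by omega), Fan.br_vtx hb (hj.trans hj') h0]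
      exact Or.inr ⟨hj, rfl⟩
  let f : ℕ → Climb := fun b =>
    if hb : b < m then
      { toFun := fun j => (q (Fan.vtx m l b (min j l))).ht
        zero := by
          rw [Nat.zero_min, Fan.vtx_zero, Fan.epi_root hq, Fan.ht_root]
        le_succ := fun j => Fan.ht_mono (hmono (hvle b hb _ _ (by omega) (by omega)))
        succ_le := fun j => by
          by_cases hj : j + 1 ≤ l
          · rw [min_eq_left hj, min_eq_left (by omega)]
            refine (Fan.epi_R hq (Or.inr ⟨?_, hvle b hb _ _ (by omega) hj⟩)).ht_le
            rw [Fan.ht_vtx hb hj, Fan.ht_vtx hb (by omega)]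
          · rw [min_eq_right (by omega), min_eq_right (by omega)]
            omega }
    else const
  have hf : ∀ b < m, ∀ j ≤ l, f b j = (q (Fan.vtx m l b j)).ht := by
    intro b hb j hj
    simp only [f, dif_pos hb, min_eq_left hj]
  have htopβ : ∀ b < m, (top b).ht ≠ 0 → (top b).br = β b := by
    intro b hb h0
    apply le_antisymm
    · exact Finset.le_sup (f := fun b' => (top b').br) (Finset.mem_range.2 (Nat.lt_succ_self b))
    · refine Finset.sup_le fun b' hb' => ?_
      rw [Finset.mem_range] at hb'
      have hS : Fan.S (top b') (top b) := by
        refine Fan.epi_S hq ?_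
        unfold Fan.S
        by_cases hl : l = 0
        · left
          rw [Fan.ht_vtx (by omega) le_rfl, hl]
        · rw [Fan.br_vtx (by omega) le_rfl hl, Fan.br_vtx (by omega) le_rfl hl]
          omega
      have hp := (top b').prop
      unfold Fan.S at hS
      omega
  have hle_top : ∀ a : Fan m l, a.ht ≠ 0 → q a ≤ top a.br := by
    intro a ha
    conv_lhs => rw [← Fan.vtx_br_ht a]
    exact hmono (hvle _ (Fan.br_lt ha) _ _ a.ht_le le_rfl)
  refine ⟨β, f, ⟨?_, ?_, ?_, ?_⟩, ?_⟩
  · intro b b' h _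
    exact Finset.sup_mono (Finset.range_mono (by omega))
  · intro b hb
    refine (Finset.sup_lt_iff hn).2 fun b' _ => ?_
    have := (top b').prop
    omega
  · intro b hb
    rw [hf b hb l le_rfl]
    exact Fan.ht_le _
  · intro i hi
    obtain ⟨a, ha⟩ := hq.surjective (Fan.vtx n k i k)
    have hht : (q a).ht = k := by rw [ha, Fan.ht_vtx hi le_rfl]
    have hbr : (q a).br = i := by rw [ha, Fan.br_vtx hi le_rfl (by omega)]
    have ha0 : a.ht ≠ 0 := by
      intro h0
      rw [Fan.eq_root h0, Fan.epi_root hq, Fan.ht_root] at hht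
      omega
    have hab := Fan.br_lt ha0
    have h1 := hle_top a ha0
    have h2 := Fan.ht_mono h1
    have h3 := (top a.br).ht_le
    rw [Fan.le_def] at h1
    refine ⟨a.br, hab, ?_, ?_⟩
    · rw [← htopβ _ hab (by omega)]
      omega
    · rw [hf _ hab l le_rfl]
      change (top a.br).ht = k
      omega
  · funext a
    by_cases ha : a.ht = 0
    · rw [Fan.eq_root ha, Fan.epi_root hq]
      unfold patMap
      rw [Fan.ht_root, (f _).zero, Fan.vtx_zero]
    · have hab := Fan.br_lt ha
      unfold patMap
      rw [hf _ hab _ a.ht_le, Fan.vtx_br_ht]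
      by_cases h0 : (q a).ht = 0
      · rw [h0, Fan.vtx_zero, Fan.eq_root h0]
      · have h1 := hle_top a ha
        have h2 := Fan.ht_mono h1
        rw [← htopβ _ hab (by omega)]
        rw [Fan.le_def] at h1
        rw [show (top a.br).br = (q a).br by omega, Fan.vtx_br_ht]

/-- Divide the height by two. -/
def half : Climb := ⟨fun j => j / 2, rfl, fun i => by omega, fun i => by omega⟩

/-- Lower the height by `c`. -/
def lower (c : ℕ) : Climb := ⟨fun j => j - c, by omega, fun i => by omega, fun i => by omega⟩

/-- Climb up to height `c` and stay there. -/
def cap (c : ℕ) : Climb := ⟨fun j => min j c, by omega, fun i => by omega, fun i => by omega⟩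

theorem isPattern_same {n K k : ℕ} (f : Climb) (hf : f K = k) :
    IsPattern n K n k id fun _ => f where
  mono _ _ h _ := h
  lt _ h := h
  le _ _ := hf.le
  full i hi := ⟨i, hi, rfl, hf⟩

/-- The pattern that adds a branch after the branch `i` which follows that branch up to height
`j`. -/
theorem isPattern_add_branch {n k i : ℕ} (j : ℕ) (hi : i < n) :
    IsPattern (n + 1) k n k (fun b => if b ≤ i then b else b - 1)
      fun b => if b = i + 1 then cap (min j k) else cap k where
  mono b b' h h' := by split_ifs <;> omega
  lt b h := by split_ifs <;> omega
  le b h := by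
    split_ifs
    · exact (min_le_right _ _).trans (min_le_right _ _)
    · exact min_le_right _ _
  full b hb := by
    by_cases h : b ≤ i
    · refine ⟨b, by omega, if_pos h, ?_⟩
      rw [if_neg (by omega)]
      exact min_self k
    · refine ⟨b + 1, by omega, ?_, ?_⟩
      · rw [if_neg (by omega)]
        omega
      · rw [if_neg (by omega)]
        exact min_self k

end Climb

/-! ### Approximations of the limit by standard fans -/

/-- An approximation of the structure `𝓛`: an epimorphism onto a standard fan with at least one
branch of positive height. -/
structure Approx {𝕃 : Type u} [TopologicalSpace 𝕃] (𝓛 : RSStructure 𝕃) where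
  /-- The number of branches. -/
  n : ℕ
  /-- The height. -/
  k : ℕ
  hn : 1 ≤ n
  hk : 1 ≤ k
  /-- The epimorphism. -/
  map : 𝕃 → Fan n k
  epi : RSStructure.IsEpi 𝓛 (Fan.str n k) map

namespace Approx

variable {𝕃 : Type u} [TopologicalSpace 𝕃] {𝓛 : RSStructure 𝕃}

/-- `B` refines `A`. -/
def Refines (B A : Approx 𝓛) : Prop := ∃ q : Fan B.n B.k → Fan A.n A.k, A.map = q ∘ B.map

theorem Refines.exists_epi {B A : Approx 𝓛} (h : B.Refines A) :
    ∃ q : Fan B.n B.k → Fan A.n A.k,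
      RSStructure.IsEpi (Fan.str B.n B.k) (Fan.str A.n A.k) q ∧ ∀ x, A.map x = q (B.map x) := by
  obtain ⟨q, hq⟩ := h
  refine ⟨q, RSStructure.IsEpi.of_comp (hq ▸ A.epi) B.epi, fun x => congrFun hq x⟩

theorem Refines.refl (A : Approx 𝓛) : A.Refines A := ⟨id, rfl⟩

theorem Refines.trans {A B C : Approx 𝓛} (h : C.Refines B) (h' : B.Refines A) : C.Refines A := by
  obtain ⟨q, hq⟩ := h
  obtain ⟨q', hq'⟩ := h'
  exact ⟨q' ∘ q, by rw [hq', hq]; rfl⟩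

theorem Refines.eq {B A : Approx 𝓛} (h : B.Refines A) {x y : 𝕃} (hxy : B.map x = B.map y) :
    A.map x = A.map y := by
  obtain ⟨q, -, hq⟩ := h.exists_epi
  rw [hq, hq, hxy]

theorem Refines.le {B A : Approx 𝓛} (h : B.Refines A) {x y : 𝕃} (hxy : B.map x ≤ B.map y) :
    A.map x ≤ A.map y := by
  obtain ⟨q, hq', hq⟩ := h.exists_epi
  rw [hq, hq]
  exact Fan.epi_monotone hq' hxy

theorem Refines.R {B A : Approx 𝓛} (h : B.Refines A) {x y : 𝕃}
    (hxy : Fan.R (B.map x) (B.map y)) : Fan.R (A.map x) (A.map y) := by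
  obtain ⟨q, hq', hq⟩ := h.exists_epi
  rw [hq, hq]
  exact Fan.epi_R hq' hxy

theorem Refines.S {B A : Approx 𝓛} (h : B.Refines A) {x y : 𝕃}
    (hxy : Fan.S (B.map x) (B.map y)) : Fan.S (A.map x) (A.map y) := by
  obtain ⟨q, hq', hq⟩ := h.exists_epi
  rw [hq, hq]
  exact Fan.epi_S hq' hxy

theorem Refines.root {B A : Approx 𝓛} (h : B.Refines A) {x : 𝕃} (hx : (B.map x).ht = 0) :
    (A.map x).ht = 0 := by
  obtain ⟨q, hq', hq⟩ := h.exists_epi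
  rw [hq, Fan.eq_root hx, Fan.epi_root hq', Fan.ht_root]

theorem continuous (A : Approx 𝓛) : Continuous A.map := A.epi.continuous

theorem R_map (A : Approx 𝓛) {x y : 𝕃} (h : 𝓛.R x y) : Fan.R (A.map x) (A.map y) :=
  (A.epi.map_R _ _).2 ⟨x, y, rfl, rfl, h⟩

theorem S_map (A : Approx 𝓛) {x y : 𝕃} (h : 𝓛.S x y) : Fan.S (A.map x) (A.map y) :=
  (A.epi.map_S _ _).2 ⟨x, y, rfl, rfl, h⟩

theorem isClosed_fiber (A : Approx 𝓛) (P : Fan A.n A.k → Prop) : IsClosed {x | P (A.map x)} :=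
  (isClosed_discrete {a | P a}).preimage A.continuous

theorem isOpen_fiber (A : Approx 𝓛) (P : Fan A.n A.k → Prop) : IsOpen {x | P (A.map x)} :=
  (isOpen_discrete {a | P a}).preimage A.continuous

theorem isClosed_fiber₂ (A : Approx 𝓛) (P : Fan A.n A.k → Fan A.n A.k → Prop) :
    IsClosed {p : 𝕃 × 𝕃 | P (A.map p.1) (A.map p.2)} :=
  (isClosed_discrete {a : Fan A.n A.k × Fan A.n A.k | P a.1 a.2}).preimage
    ((A.continuous.comp continuous_fst).prodMk (A.continuous.comp continuous_snd))

end Approx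

section Limit

variable {𝕃 : Type u} [TopologicalSpace 𝕃] {𝓛 : RSStructure 𝕃}

theorem exists_approx (h𝓛 : 𝓛.IsProjFraisseLimit RSStructure.IsOrderedFan) {n k : ℕ} (hn : 1 ≤ n)
    (hk : 1 ≤ k) : ∃ φ : 𝕃 → Fan n k, RSStructure.IsEpi 𝓛 (Fan.str n k) φ :=
  h𝓛.universal (Fan n k) (Fan.str n k) (Fan.isOrderedFan_str hn hk)

/-- Continuous maps to finite discrete spaces factor through approximations. -/
theorem exists_factor (h𝓛 : 𝓛.IsProjFraisseLimit RSStructure.IsOrderedFan) {D : Type}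
    [TopologicalSpace D] [DiscreteTopology D] [Finite D] {f : 𝕃 → D} (hf : Continuous f) :
    ∃ (A : Approx 𝓛) (g : Fan A.n A.k → D), f = g ∘ A.map := by
  obtain ⟨A, _, _, 𝓐, hA, φ, hφ, f₀, hf₀⟩ := h𝓛.factor D f hf
  obtain ⟨n, k, hn, e, heR, heS⟩ := exists_equiv_fan hA
  rcases Nat.eq_zero_or_pos k with rfl | hk
  -- a one-point structure is replaced by the fan with one edge
  · obtain ⟨ψ, hψ⟩ := exists_approx h𝓛 (le_refl 1) (le_refl 1)
    have hconst : ∀ a b : A, a = b := by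
      intro a b
      apply e.injective
      have h1 := (e a).ht_le
      have h2 := (e b).ht_le
      rw [Fan.eq_root (a := e a) (by omega), Fan.eq_root (a := e b) (by omega)]
    refine ⟨⟨1, 1, le_rfl, le_rfl, ψ, hψ⟩, fun _ => f₀ (e.symm Fan.root), ?_⟩
    funext x
    rw [hf₀]
    exact congrArg f₀ (hconst _ _)
  · refine ⟨⟨n, k, hn, hk, e ∘ φ, (RSStructure.IsEpi.of_equiv e heR heS).comp hφ⟩,
      f₀ ∘ e.symm, ?_⟩
    funext x
    rw [hf₀]
    simp

theorem exists_refines_of_continuous (h𝓛 : 𝓛.IsProjFraisseLimit RSStructure.IsOrderedFan)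
    {D : Type} [TopologicalSpace D] [DiscreteTopology D] [Finite D] {f : 𝕃 → D}
    (hf : Continuous f) (A : Approx 𝓛) :
    ∃ B : Approx 𝓛, B.Refines A ∧ ∃ g : Fan B.n B.k → D, f = g ∘ B.map := by
  obtain ⟨B, g, hg⟩ := exists_factor h𝓛 (hf.prodMk A.continuous)
  refine ⟨B, ⟨fun b => (g b).2, ?_⟩, fun b => (g b).1, ?_⟩
  · funext x
    exact congrArg Prod.snd (congrFun hg x)
  · funext x
    exact congrArg Prod.fst (congrFun hg x)

theorem exists_refines₂ (h𝓛 : 𝓛.IsProjFraisseLimit RSStructure.IsOrderedFan) (A B : Approx 𝓛) :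
    ∃ C : Approx 𝓛, C.Refines A ∧ C.Refines B := by
  obtain ⟨C, hC, g, hg⟩ := exists_refines_of_continuous h𝓛 B.continuous A
  exact ⟨C, hC, g, hg⟩

/-- Ultrahomogeneity in terms of the automorphism group. -/
theorem exists_aut (h𝓛 : 𝓛.IsProjFraisseLimit RSStructure.IsOrderedFan) {n k : ℕ} (hn : 1 ≤ n)
    (hk : 1 ≤ k) {φ₁ φ₂ : 𝕃 → Fan n k} (h₁ : RSStructure.IsEpi 𝓛 (Fan.str n k) φ₁)
    (h₂ : RSStructure.IsEpi 𝓛 (Fan.str n k) φ₂) : ∃ g : 𝓛.aut, ∀ x, φ₂ x = φ₁ (g.1 x) := by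
  obtain ⟨ψ, hψ, hbij, h⟩ := h𝓛.homogeneous _ _ (Fan.isOrderedFan_str hn hk) φ₁ φ₂ h₁ h₂
  have := h𝓛.isTopological.compact
  have := h𝓛.isTopological.t2
  let e := Equiv.ofBijective ψ hbij
  let g : 𝕃 ≃ₜ 𝕃 := Continuous.homeoOfEquivCompactToT2 (f := e) hψ.continuous
  refine ⟨⟨g, fun x y => ?_, fun x y => ?_⟩, fun x => congrFun h x⟩
  · change 𝓛.R (ψ x) (ψ y) ↔ _
    rw [hψ.map_R]
    constructor
    · rintro ⟨a, b, ha, hb, hab⟩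
      rwa [← hbij.1 ha, ← hbij.1 hb]
    · intro h
      exact ⟨x, y, rfl, rfl, h⟩
  · change 𝓛.S (ψ x) (ψ y) ↔ _
    rw [hψ.map_S]
    constructor
    · rintro ⟨a, b, ha, hb, hab⟩
      rwa [← hbij.1 ha, ← hbij.1 hb]
    · intro h
      exact ⟨x, y, rfl, rfl, h⟩

/-- The extension property: an approximation lifts along any epimorphism of standard fans. -/
theorem exists_lift (h𝓛 : 𝓛.IsProjFraisseLimit RSStructure.IsOrderedFan) (A : Approx 𝓛) {n k : ℕ}
    (hn : 1 ≤ n) (hk : 1 ≤ k) {q : Fan n k → Fan A.n A.k}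
    (hq : RSStructure.IsEpi (Fan.str n k) (Fan.str A.n A.k) q) :
    ∃ φ : 𝕃 → Fan n k, RSStructure.IsEpi 𝓛 (Fan.str n k) φ ∧ ∀ x, A.map x = q (φ x) := by
  obtain ⟨φ, hφ⟩ := exists_approx h𝓛 hn hk
  obtain ⟨g, hg⟩ := exists_aut h𝓛 A.hn A.hk (hq.comp hφ) A.epi
  refine ⟨φ ∘ g.1, ?_, hg⟩
  refine hφ.comp ⟨g.1.continuous, g.1.surjective, fun y₁ y₂ => ?_, fun y₁ y₂ => ?_⟩
  · constructor
    · intro h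
      refine ⟨g.1.symm y₁, g.1.symm y₂, by simp, by simp, ?_⟩
      rw [← g.2.1]
      simpa using h
    · rintro ⟨x₁, x₂, rfl, rfl, h⟩
      exact (g.2.1 _ _).2 h
  · constructor
    · intro h
      refine ⟨g.1.symm y₁, g.1.symm y₂, by simp, by simp, ?_⟩
      rw [← g.2.2]
      simpa using h
    · rintro ⟨x₁, x₂, rfl, rfl, h⟩
      exact (g.2.2 _ _).2 h

theorem nonempty_approx (h𝓛 : 𝓛.IsProjFraisseLimit RSStructure.IsOrderedFan) :
    Nonempty (Approx 𝓛) := by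
  obtain ⟨φ, hφ⟩ := exists_approx h𝓛 (le_refl 1) (le_refl 1)
  exact ⟨⟨1, 1, le_rfl, le_rfl, φ, hφ⟩⟩

/-- The basic compactness argument: closed conditions that get stronger along refinements and can be
satisfied for each approximation can be satisfied simultaneously. -/
theorem exists_forall_approx (h𝓛 : 𝓛.IsProjFraisseLimit RSStructure.IsOrderedFan) {Y : Type*}
    [TopologicalSpace Y] [CompactSpace Y] (F : Approx 𝓛 → Set Y) (hF : ∀ A, IsClosed (F A))
    (hne : ∀ A, (F A).Nonempty) (hanti : ∀ A B : Approx 𝓛, B.Refines A → F B ⊆ F A) :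
    ∃ y, ∀ A, y ∈ F A := by
  have := nonempty_approx h𝓛
  have hdir : Directed (· ⊇ ·) F := by
    intro A B
    obtain ⟨C, hA, hB⟩ := exists_refines₂ h𝓛 A B
    exact ⟨C, hanti _ _ hA, hanti _ _ hB⟩
  obtain ⟨y, hy⟩ := IsCompact.nonempty_iInter_of_directed_nonempty_isCompact_isClosed F hdir hne
    (fun A => (hF A).isCompact) hF
  exact ⟨y, fun A => mem_iInter.1 hy A⟩

theorem eq_of_forall_approx (h𝓛 : 𝓛.IsProjFraisseLimit RSStructure.IsOrderedFan) {x y : 𝕃}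
    (h : ∀ A : Approx 𝓛, A.map x = A.map y) : x = y := by
  have := h𝓛.isTopological.compact
  have := h𝓛.isTopological.t2
  have := h𝓛.isTopological.totallyDisconnected
  by_contra hxy
  obtain ⟨U, hU, hxU, hyU⟩ := exists_isClopen_of_totally_separated hxy
  have hc : Continuous (boolIndicator U) := (continuous_boolIndicator_iff_isClopen U).2 hU
  obtain ⟨A, g, hg⟩ := exists_factor h𝓛 hc
  have h1 : boolIndicator U x = boolIndicator U y := by
    rw [hg]
    exact congrArg g (h A)
  rw [(mem_iff_boolIndicator U x).1 hxU, (notMem_iff_boolIndicator U y).1 hyU] at h1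
  exact absurd h1 (by simp)

/-- A closed relation on the limit that is met by each approximate version of a relation `P` is met
by the limit of these approximate versions. -/
theorem exists_pair (h𝓛 : 𝓛.IsProjFraisseLimit RSStructure.IsOrderedFan) {C : Set (𝕃 × 𝕃)}
    (hC : IsClosed C) (P : ∀ A : Approx 𝓛, Fan A.n A.k → Fan A.n A.k → Prop)
    (hP : ∀ A B : Approx 𝓛, B.Refines A → ∀ x y, P B (B.map x) (B.map y) →
      P A (A.map x) (A.map y))
    (h : ∀ A : Approx 𝓛, ∃ p ∈ C, P A (A.map p.1) (A.map p.2)) :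
    ∃ p ∈ C, ∀ A : Approx 𝓛, P A (A.map p.1) (A.map p.2) := by
  have := h𝓛.isTopological.compact
  obtain ⟨p, hp⟩ := exists_forall_approx h𝓛 (Y := 𝕃 × 𝕃)
    (fun A => C ∩ {p | P A (A.map p.1) (A.map p.2)})
    (fun A => hC.inter (A.isClosed_fiber₂ (P A)))
    (fun A => by
      obtain ⟨p, h1, h2⟩ := h A
      exact ⟨p, h1, h2⟩)
    (fun A B hAB p hp => ⟨hp.1, hP A B hAB _ _ hp.2⟩)
  obtain ⟨A⟩ := nonempty_approx h𝓛
  exact ⟨p, (hp A).1, fun A => (hp A).2⟩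

theorem R_iff (h𝓛 : 𝓛.IsProjFraisseLimit RSStructure.IsOrderedFan) {x y : 𝕃} :
    𝓛.R x y ↔ ∀ A : Approx 𝓛, Fan.R (A.map x) (A.map y) := by
  refine ⟨fun h A => A.R_map h, fun h => ?_⟩
  have := h𝓛.isTopological.compact
  obtain ⟨p, hp⟩ := exists_forall_approx h𝓛 (Y := 𝕃 × 𝕃)
    (fun A => {p | 𝓛.R p.1 p.2} ∩ {p | A.map p.1 = A.map x ∧ A.map p.2 = A.map y})
    (fun A => h𝓛.isTopological.isClosed_R.inter
      (A.isClosed_fiber₂ fun a b => a = A.map x ∧ b = A.map y))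
    (fun A => by
      obtain ⟨a, b, h1, h2, h3⟩ := (A.epi.map_R _ _).1 (h A)
      exact ⟨(a, b), h3, h1, h2⟩)
    (fun A B hAB p hp => ⟨hp.1, hAB.eq hp.2.1, hAB.eq hp.2.2⟩)
  obtain ⟨A⟩ := nonempty_approx h𝓛
  rw [← eq_of_forall_approx h𝓛 fun A => (hp A).2.1, ← eq_of_forall_approx h𝓛 fun A => (hp A).2.2]
  exact (hp A).1

theorem S_iff (h𝓛 : 𝓛.IsProjFraisseLimit RSStructure.IsOrderedFan) {x y : 𝕃} :
    𝓛.S x y ↔ ∀ A : Approx 𝓛, Fan.S (A.map x) (A.map y) := by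
  refine ⟨fun h A => A.S_map h, fun h => ?_⟩
  have := h𝓛.isTopological.compact
  obtain ⟨p, hp⟩ := exists_forall_approx h𝓛 (Y := 𝕃 × 𝕃)
    (fun A => {p | 𝓛.S p.1 p.2} ∩ {p | A.map p.1 = A.map x ∧ A.map p.2 = A.map y})
    (fun A => h𝓛.isTopological.isClosed_S.inter
      (A.isClosed_fiber₂ fun a b => a = A.map x ∧ b = A.map y))
    (fun A => by
      obtain ⟨a, b, h1, h2, h3⟩ := (A.epi.map_S _ _).1 (h A)
      exact ⟨(a, b), h3, h1, h2⟩)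
    (fun A B hAB p hp => ⟨hp.1, hAB.eq hp.2.1, hAB.eq hp.2.2⟩)
  obtain ⟨A⟩ := nonempty_approx h𝓛
  rw [← eq_of_forall_approx h𝓛 fun A => (hp A).2.1, ← eq_of_forall_approx h𝓛 fun A => (hp A).2.2]
  exact (hp A).1

/-- An open neighbourhood of the diagonal contains all pairs that are identified by some
approximation. -/
theorem exists_approx_subset (h𝓛 : 𝓛.IsProjFraisseLimit RSStructure.IsOrderedFan)
    {V : Set (𝕃 × 𝕃)} (hV : IsOpen V) (hd : ∀ x, (x, x) ∈ V) :
    ∃ A : Approx 𝓛, ∀ x y, A.map x = A.map y → (x, y) ∈ V := by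
  by_contra! hcon
  obtain ⟨p, hp, h⟩ := exists_pair h𝓛 hV.isClosed_compl (fun A a b => a = b)
    (fun A B hAB x y h => hAB.eq h)
    (fun A => by
      obtain ⟨x, y, h1, h2⟩ := hcon A
      exact ⟨(x, y), h2, h1⟩)
  have h1 : p.1 = p.2 := eq_of_forall_approx h𝓛 h
  exact hp (by rw [show p = (p.1, p.1) from Prod.ext rfl h1.symm]; exact hd _)

/-- The fibres of the approximations are a basis of the topology. -/
theorem exists_fiber_subset (h𝓛 : 𝓛.IsProjFraisseLimit RSStructure.IsOrderedFan) {U : Set 𝕃}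
    (hU : IsOpen U) {x : 𝕃} (hx : x ∈ U) :
    ∃ A : Approx 𝓛, ∀ y, A.map y = A.map x → y ∈ U := by
  have := h𝓛.isTopological.t2
  obtain ⟨A, hA⟩ := exists_approx_subset h𝓛 (V := {p | p.2 = x → p.1 ∈ U}) (by
      have : {p : 𝕃 × 𝕃 | p.2 = x → p.1 ∈ U} = {p | p.2 ≠ x} ∪ {p | p.1 ∈ U} := by
        ext p
        simp only [mem_ofPred_eq, mem_union, imp_iff_not_or, ne_eq]
      rw [this]
      exact (isOpen_ne.preimage continuous_snd).union (hU.preimage continuous_fst))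
    (fun y hy => by
      simp only at hy ⊢
      rw [hy]
      exact hx)
  exact ⟨A, fun y hy => hA y x hy rfl⟩

/-- The root of the limit. -/
theorem exists_root (h𝓛 : 𝓛.IsProjFraisseLimit RSStructure.IsOrderedFan) :
    ∃ ρ : 𝕃, ∀ A : Approx 𝓛, (A.map ρ).ht = 0 := by
  have := h𝓛.isTopological.compact
  exact exists_forall_approx h𝓛 (fun A => {x | (A.map x).ht = 0})
    (fun A => A.isClosed_fiber fun a => a.ht = 0)
    (fun A => by
      obtain ⟨x, hx⟩ := A.epi.surjective Fan.root
      exact ⟨x, by rw [mem_ofPred_eq, hx, Fan.ht_root]⟩)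
    (fun A B hAB x hx => hAB.root hx)

/-- The tree order of the limit. -/
def TLE (𝓛 : RSStructure 𝕃) (x y : 𝕃) : Prop := ∀ A : Approx 𝓛, A.map x ≤ A.map y

theorem TLE.refl (x : 𝕃) : TLE 𝓛 x x := fun _ => le_rfl

theorem TLE.trans {x y z : 𝕃} (h : TLE 𝓛 x y) (h' : TLE 𝓛 y z) : TLE 𝓛 x z :=
  fun A => (h A).trans (h' A)

theorem TLE.of_R {x y : 𝕃} (h : 𝓛.R x y) : TLE 𝓛 x y := fun A => (A.R_map h).le

theorem TLE.S (h𝓛 : 𝓛.IsProjFraisseLimit RSStructure.IsOrderedFan) {x y : 𝕃} (h : TLE 𝓛 x y) :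
    𝓛.S x y ∧ 𝓛.S y x :=
  ⟨(S_iff h𝓛).2 fun A => (Fan.S_of_le (h A)).1, (S_iff h𝓛).2 fun A => (Fan.S_of_le (h A)).2⟩

theorem isClosed_TLE : IsClosed {p : 𝕃 × 𝕃 | TLE 𝓛 p.1 p.2} := by
  have : {p : 𝕃 × 𝕃 | TLE 𝓛 p.1 p.2} = ⋂ A : Approx 𝓛, {p | A.map p.1 ≤ A.map p.2} := by
    ext p
    simp [TLE]
  rw [this]
  exact isClosed_iInter fun A => A.isClosed_fiber₂ (· ≤ ·)

theorem TLE.total (h𝓛 : 𝓛.IsProjFraisseLimit RSStructure.IsOrderedFan) {x y : 𝕃}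
    (h : ∀ A : Approx 𝓛, A.map x ≤ A.map y ∨ A.map y ≤ A.map x) : TLE 𝓛 x y ∨ TLE 𝓛 y x := by
  by_contra! hcon
  obtain ⟨h1, h2⟩ := hcon
  unfold TLE at h1 h2
  push Not at h1 h2
  obtain ⟨A, hA⟩ := h1
  obtain ⟨B, hB⟩ := h2
  obtain ⟨C, hCA, hCB⟩ := exists_refines₂ h𝓛 A B
  rcases h C with h | h
  · exact hA (hCA.le h)
  · exact hB (hCB.le h)

theorem TLE.total_of_S (h𝓛 : 𝓛.IsProjFraisseLimit RSStructure.IsOrderedFan) {x y : 𝕃}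
    (h₁ : 𝓛.S x y) (h₂ : 𝓛.S y x) : TLE 𝓛 x y ∨ TLE 𝓛 y x := by
  refine TLE.total h𝓛 fun A => ?_
  rcases le_total (A.map x).ht (A.map y).ht with h | h
  · exact Or.inl (Fan.le_of_S (A.S_map h₁) (A.S_map h₂) h)
  · exact Or.inr (Fan.le_of_S (A.S_map h₂) (A.S_map h₁) h)

/-- Points that are not related by `R` in either direction are far apart in some approximation. -/
theorem exists_not_symmR (h𝓛 : 𝓛.IsProjFraisseLimit RSStructure.IsOrderedFan) {x y : 𝕃}
    (h : ¬ 𝓛.symmR x y) :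
    ∃ A : Approx 𝓛, ∀ B : Approx 𝓛, B.Refines A →
      ¬ Fan.R (B.map x) (B.map y) ∧ ¬ Fan.R (B.map y) (B.map x) := by
  unfold RSStructure.symmR at h
  rw [not_or, R_iff h𝓛, R_iff h𝓛] at h
  push Not at h
  obtain ⟨⟨A, hA⟩, B, hB⟩ := h
  obtain ⟨C, hCA, hCB⟩ := exists_refines₂ h𝓛 A B
  exact ⟨C, fun D hD => ⟨fun h => hA ((hD.trans hCA).R h), fun h => hB ((hD.trans hCB).R h)⟩⟩

theorem R_refl (h𝓛 : 𝓛.IsProjFraisseLimit RSStructure.IsOrderedFan) (x : 𝕃) : 𝓛.R x x :=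
  (R_iff h𝓛).2 fun _ => Or.inl rfl

/-- A lift of an approximation to doubled heights. -/
theorem exists_double (h𝓛 : 𝓛.IsProjFraisseLimit RSStructure.IsOrderedFan) (A : Approx 𝓛) :
    ∃ B : Approx 𝓛, B.Refines A ∧ ∀ x, (A.map x).ht = (B.map x).ht / 2 := by
  have hp : Climb.IsPattern A.n (2 * A.k + 1) A.n A.k id fun _ => Climb.half :=
    Climb.isPattern_same _ (by change (2 * A.k + 1) / 2 = A.k; omega)
  obtain ⟨φ, hφ, h⟩ := exists_lift h𝓛 A A.hn (by omega) (hp.isEpi A.hk)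
  refine ⟨⟨A.n, 2 * A.k + 1, A.hn, by omega, φ, hφ⟩,
    ⟨Climb.patMap A.n A.k id fun _ => Climb.half, funext h⟩, fun x => ?_⟩
  rw [h, hp.ht_patMap]
  rfl

/-- A point is related by `R` to at most one other point: in a doubled approximation a vertex has at
most one neighbour with a different image. -/
theorem symmR_subsingleton (h𝓛 : 𝓛.IsProjFraisseLimit RSStructure.IsOrderedFan) {x y z : 𝕃}
    (hyx : 𝓛.symmR y x) (hyz : 𝓛.symmR y z) (hx : x ≠ y) (hz : z ≠ y) : x = z := by
  by_contra hxz
  have hsep : ∀ {a b : 𝕃}, a ≠ b → ∃ A : Approx 𝓛, A.map a ≠ A.map b := by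
    intro a b hab
    by_contra! h
    exact hab (eq_of_forall_approx h𝓛 h)
  obtain ⟨A₁, h₁⟩ := hsep hx
  obtain ⟨A₂, h₂⟩ := hsep hz
  obtain ⟨A₃, h₃⟩ := hsep hxz
  obtain ⟨A₄, h41, h42⟩ := exists_refines₂ h𝓛 A₁ A₂
  obtain ⟨A, hA4, hA3⟩ := exists_refines₂ h𝓛 A₄ A₃
  obtain ⟨B, hBA, hB⟩ := exists_double h𝓛 A
  have key : ∀ w, 𝓛.symmR y w → A.map w ≠ A.map y →
      ((B.map y).ht % 2 = 0 → (B.map w).ht + 1 = (B.map y).ht ∧ B.map w ≤ B.map y) ∧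
      ((B.map y).ht % 2 = 1 → (B.map w).ht = (B.map y).ht + 1 ∧ B.map y ≤ B.map w) := by
    intro w hw hne
    have hht : (A.map w).ht ≠ (A.map y).ht := by
      intro h
      apply hne
      rcases hw with h' | h'
      · exact (Fan.eq_of_le_of_le (A.R_map h').le le_rfl h.symm).symm
      · exact Fan.eq_of_le_of_le (A.R_map h').le le_rfl h
    rw [hB, hB] at hht
    rcases hw with h' | h'
    · rcases B.R_map h' with h | ⟨h, hle⟩
      · rw [h] at hht; exact absurd rfl hht
      · exact ⟨fun _ => by omega, fun _ => ⟨h, hle⟩⟩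
    · rcases B.R_map h' with h | ⟨h, hle⟩
      · rw [h] at hht; exact absurd rfl hht
      · exact ⟨fun _ => ⟨h.symm, hle⟩, fun _ => by omega⟩
  have kx := key x hyx (fun h => h₁ ((hA4.trans h41).eq h))
  have kz := key z hyz (fun h => h₂ ((hA4.trans h42).eq h))
  refine h₃ ((hBA.trans hA3).eq ?_)
  rcases Nat.mod_two_eq_zero_or_one (B.map y).ht with h | h
  · have h5 := kx.1 h
    have h6 := kz.1 h
    exact Fan.eq_of_le_of_le h5.2 h6.2 (by omega)
  · have h5 := kx.2 h
    have h6 := kz.2 h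
    have h7 := h5.2
    have h8 := h6.2
    rw [Fan.le_def] at h7 h8
    exact Fan.ext (by omega) (by omega)

theorem symmR_equivalence (h𝓛 : 𝓛.IsProjFraisseLimit RSStructure.IsOrderedFan) :
    Equivalence 𝓛.symmR where
  refl x := Or.inl (R_refl h𝓛 x)
  symm h := h.symm
  trans {x y z} hxy hyz := by
    by_cases h1 : x = y
    · exact h1 ▸ hyz
    by_cases h2 : z = y
    · exact h2 ▸ hxy
    rw [symmR_subsingleton h𝓛 hxy.symm hyz h1 h2]
    exact Or.inl (R_refl h𝓛 z)

theorem proj_eq_iff (h𝓛 : 𝓛.IsProjFraisseLimit RSStructure.IsOrderedFan) {x y : 𝕃} :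
    𝓛.proj x = 𝓛.proj y ↔ 𝓛.symmR x y :=
  (symmR_equivalence h𝓛).quot_mk_eq_iff x y

end Limit

/-! ### Height functions -/

section Height

variable {𝕃 : Type u} [TopologicalSpace 𝕃] {𝓛 : RSStructure 𝕃}

theorem le_of_forall_le_add_two_div_pow {a b : ℝ} (h : ∀ i : ℕ, a ≤ b + 2 / 2 ^ i) : a ≤ b := by
  have h1 : Filter.Tendsto (fun i : ℕ => b + 2 * (1 / 2 : ℝ) ^ i) Filter.atTop (𝓝 (b + 2 * 0)) :=
    ((tendsto_pow_atTop_nhds_zero_of_lt_one (by norm_num) (by norm_num)).const_mul _).const_add _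
  rw [mul_zero, add_zero] at h1
  refine ge_of_tendsto' h1 fun i => (h i).trans_eq ?_
  rw [one_div, inv_pow, div_eq_mul_inv]

/-- The height function of an approximation can be interpolated by a continuous function that is
constant on the classes of `R` and monotone along the branches: the limit of the rescaled heights in
an iterated doubling of the approximation. -/
theorem exists_height (h𝓛 : 𝓛.IsProjFraisseLimit RSStructure.IsOrderedFan) (A : Approx 𝓛) :
    ∃ H : 𝕃 → ℝ, Continuous H ∧ (∀ x, ((A.map x).ht : ℝ) ≤ H x ∧ H x ≤ (A.map x).ht + 1) ∧
      (∀ x y, 𝓛.symmR x y → H x = H y) ∧ (∀ x y, TLE 𝓛 x y → H x ≤ H y) ∧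
      ∀ ρ, (∀ B : Approx 𝓛, (B.map ρ).ht = 0) → H ρ = 0 := by
  choose dbl _ hdbl using exists_double h𝓛
  let D : ℕ → Approx 𝓛 := fun i => Nat.rec A (fun _ B => dbl B) i
  have hD : ∀ i x, ((D i).map x).ht = ((D (i + 1)).map x).ht / 2 := fun i x => hdbl (D i) x
  let a : ℕ → 𝕃 → ℝ := fun i x => ((D i).map x).ht / 2 ^ i
  have ha : ∀ i x, a i x ≤ a (i + 1) x ∧ a (i + 1) x ≤ a i x + 1 / 2 ^ (i + 1) := by
    intro i x
    have h1 := hD i x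
    have h2 : 2 * ((D i).map x).ht ≤ ((D (i + 1)).map x).ht := by omega
    have h3 : ((D (i + 1)).map x).ht ≤ 2 * ((D i).map x).ht + 1 := by omega
    have h2' : (2 : ℝ) * ((D i).map x).ht ≤ ((D (i + 1)).map x).ht := by exact_mod_cast h2
    have h3' : (((D (i + 1)).map x).ht : ℝ) ≤ 2 * ((D i).map x).ht + 1 := by exact_mod_cast h3
    have hp : (0 : ℝ) < 2 ^ (i + 1) := by positivity
    have h4 : a i x = 2 * ((D i).map x).ht / 2 ^ (i + 1) := by
      change (((D i).map x).ht : ℝ) / 2 ^ i = _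
      rw [pow_succ]
      field_simp
    rw [h4, ← add_div]
    exact ⟨div_le_div_of_nonneg_right h2' hp.le, div_le_div_of_nonneg_right h3' hp.le⟩
  have hmono : ∀ x, Monotone fun i => a i x := fun x => monotone_nat_of_le_succ fun i => (ha i x).1
  have hub : ∀ i x j, i ≤ j → a j x ≤ a i x + 1 / 2 ^ i - 1 / 2 ^ j := by
    intro i x j hij
    induction j, hij using Nat.le_induction with
    | base => simp
    | succ j hij ih =>
      have h1 := (ha j x).2
      have h2 : (1 : ℝ) / 2 ^ j = 1 / 2 ^ (j + 1) + 1 / 2 ^ (j + 1) := by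
        rw [pow_succ]
        field_simp
        norm_num
      linarith
  have hub' : ∀ i x j, a j x ≤ a i x + 1 / 2 ^ i := by
    intro i x j
    rcases le_total i j with h | h
    · have := hub i x j h
      have h2 : (0 : ℝ) ≤ 1 / 2 ^ j := by positivity
      linarith
    · have := hmono x h
      have h2 : (0 : ℝ) ≤ 1 / 2 ^ i := by positivity
      exact this.trans (by linarith)
  have hbdd : ∀ x, BddAbove (Set.range fun i => a i x) := fun x =>
    ⟨a 0 x + 1 / 2 ^ 0, by rintro _ ⟨j, rfl⟩; exact hub' 0 x j⟩
  -- the heights rescaled by `2 ^ i` increase and converge uniformly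
  let H : 𝕃 → ℝ := fun x => ⨆ i, a i x
  have hlow : ∀ i x, a i x ≤ H x := fun i x => le_ciSup (hbdd x) i
  have hup : ∀ i x, H x ≤ a i x + 1 / 2 ^ i := fun i x => ciSup_le fun j => hub' i x j
  have haR : ∀ i x y, 𝓛.R x y → a i y ≤ a i x + 1 / 2 ^ i := by
    intro i x y h
    have h1 := ((D i).R_map h).ht_le
    have h2 : (((D i).map y).ht : ℝ) ≤ ((D i).map x).ht + 1 := by exact_mod_cast h1
    change (((D i).map y).ht : ℝ) / 2 ^ i ≤ ((D i).map x).ht / 2 ^ i + 1 / 2 ^ i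
    rw [← add_div]
    exact div_le_div_of_nonneg_right h2 (by positivity)
  have hT : ∀ x y, TLE 𝓛 x y → H x ≤ H y := by
    intro x y h
    refine ciSup_le fun i => le_trans ?_ (hlow i y)
    refine div_le_div_of_nonneg_right ?_ (by positivity)
    exact_mod_cast Fan.ht_mono (h (D i))
  have hR : ∀ x y, 𝓛.R x y → H x = H y := by
    intro x y h
    refine le_antisymm (hT x y (TLE.of_R h)) (le_of_forall_le_add_two_div_pow fun i => ?_)
    have h1 := hup i y
    have h2 := hlow i x
    have h3 := haR i x y h
    have h4 : (2 : ℝ) / 2 ^ i = 1 / 2 ^ i + 1 / 2 ^ i := by ring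
    linarith
  refine ⟨H, ?_, fun x => ⟨?_, ?_⟩, ?_, hT, ?_⟩
  · refine continuous_of_uniform_approx_of_continuous fun u hu => ?_
    obtain ⟨ε, hε, hu⟩ := Metric.mem_uniformity_dist.1 hu
    obtain ⟨i, hi⟩ := exists_pow_lt_of_lt_one hε (show (1 / 2 : ℝ) < 1 by norm_num)
    refine ⟨a i, ?_, fun x => ?_⟩
    · exact (continuous_of_discreteTopology (f := fun b : Fan (D i).n (D i).k =>
        (b.ht : ℝ) / 2 ^ i)).comp (D i).continuous
    · refine hu ?_
      rw [Real.dist_eq, abs_lt]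
      have h1 := hup i x
      have h2 := hlow i x
      have h3 : (1 / 2 : ℝ) ^ i = 1 / 2 ^ i := by rw [one_div, inv_pow, one_div]
      constructor <;> linarith
  · have := hlow 0 x
    simpa [a, D] using this
  · have := hup 0 x
    simpa [a, D] using this
  · intro x y h
    rcases h with h | h
    · exact hR x y h
    · exact (hR y x h).symm
  · intro ρ hρ
    have h1 : ∀ i, a i ρ = 0 := fun i => by simp [a, hρ]
    simp [H, h1]

theorem Approx.refines_of_eq {A B : Approx 𝓛} (h : ∀ x y, B.map x = B.map y → A.map x = A.map y) :
    B.Refines A := by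
  refine ⟨fun b => A.map (Function.surjInv B.epi.surjective b), funext fun x => ?_⟩
  exact h _ _ (Function.surjInv_eq B.epi.surjective _).symm

/-- There is a cofinal sequence of approximations. -/
theorem exists_sequence (h𝓛 : 𝓛.IsProjFraisseLimit RSStructure.IsOrderedFan) :
    ∃ θ : ℕ → Approx 𝓛, (∀ i, (θ (i + 1)).Refines (θ i)) ∧ ∀ A, ∃ i, (θ i).Refines A := by
  have := h𝓛.isTopological.compact
  have := h𝓛.isTopological.t2
  have := h𝓛.isTopological.totallyDisconnected
  have := h𝓛.isTopological.secondCountable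
  have hc : Countable (TopologicalSpace.Clopens 𝕃) :=
    TopologicalSpace.Clopens.countable_iff_secondCountable.2 inferInstance
  obtain ⟨U, hU⟩ := exists_surjective_nat (TopologicalSpace.Clopens 𝕃)
  have hcont : ∀ i, Continuous (boolIndicator (U i : Set 𝕃)) := fun i =>
    (continuous_boolIndicator_iff_isClopen _).2 (U i).isClopen
  choose nxt hnxt g hg using fun (i : ℕ) (A : Approx 𝓛) =>
    exists_refines_of_continuous h𝓛 (hcont i) A
  obtain ⟨A₀⟩ := nonempty_approx h𝓛
  let θ : ℕ → Approx 𝓛 := fun i => Nat.rec A₀ (fun i A => nxt i A) i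
  have hθ : ∀ i, (θ (i + 1)).Refines (θ i) := fun i => hnxt i (θ i)
  have hθle : ∀ i j, i ≤ j → (θ j).Refines (θ i) := by
    intro i j hij
    induction j, hij using Nat.le_induction with
    | base => exact Approx.Refines.refl _
    | succ j _ ih => exact (hθ j).trans ih
  have hsep : ∀ i j, i < j → ∀ x y, (θ j).map x = (θ j).map y → (x ∈ U i ↔ y ∈ U i) := by
    intro i j hij x y hxy
    have h1 := (hθle (i + 1) j hij).eq hxy
    have h2 : boolIndicator (U i : Set 𝕃) x = boolIndicator (U i : Set 𝕃) y := by
      rw [hg i (θ i)]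
      exact congrArg (g i (θ i)) h1
    have h3 := mem_iff_boolIndicator (U i : Set 𝕃) x
    have h4 := mem_iff_boolIndicator (U i : Set 𝕃) y
    rw [h2] at h3
    exact h3.trans h4.symm
  refine ⟨θ, hθ, fun A => ?_⟩
  have hcl : ∀ a : Fan A.n A.k, ∃ i, (U i : Set 𝕃) = {x | A.map x = a} := by
    intro a
    obtain ⟨i, hi⟩ := hU ⟨{x | A.map x = a}, A.isClosed_fiber (· = a), A.isOpen_fiber (· = a)⟩
    exact ⟨i, by rw [hi]; rfl⟩
  choose idx hidx using hcl
  obtain ⟨N, hN⟩ := (Set.finite_range idx).bddAbove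
  refine ⟨N + 1, Approx.refines_of_eq fun x y hxy => ?_⟩
  have h1 := hsep (idx (A.map y)) (N + 1) (Nat.lt_succ_of_le (hN ⟨_, rfl⟩)) x y hxy
  have h2 : y ∈ (U (idx (A.map y)) : Set 𝕃) := by rw [hidx]; rfl
  have h3 : x ∈ (U (idx (A.map y)) : Set 𝕃) := h1.2 h2
  rw [hidx] at h3
  exact h3

/-- A height function that separates the points of a branch modulo `R`. -/
theorem exists_total_height (h𝓛 : 𝓛.IsProjFraisseLimit RSStructure.IsOrderedFan) :
    ∃ h : 𝕃 → ℝ, Continuous h ∧ (∀ x, 0 ≤ h x ∧ h x ≤ 1) ∧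
      (∀ x y, 𝓛.symmR x y → h x = h y) ∧ (∀ x y, TLE 𝓛 x y → h x ≤ h y) ∧
      (∀ x y, TLE 𝓛 x y → h x = h y → 𝓛.symmR x y) ∧
      ∀ ρ, (∀ B : Approx 𝓛, (B.map ρ).ht = 0) → h ρ = 0 := by
  obtain ⟨θ, -, hθ⟩ := exists_sequence h𝓛
  choose H hc hb hR hT hroot using fun i => exists_height h𝓛 (θ i)
  let w : ℕ → ℝ := fun i => (1 / 2) ^ (i + 1) / ((θ i).k + 1)
  have hw : ∀ i, 0 < w i := fun i => by positivity
  have hH0 : ∀ i x, 0 ≤ H i x := fun i x => (Nat.cast_nonneg _).trans (hb i x).1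
  have hterm0 : ∀ i x, 0 ≤ w i * H i x := fun i x => mul_nonneg (hw i).le (hH0 i x)
  have hterm : ∀ i x, w i * H i x ≤ (1 / 2) ^ (i + 1) := by
    intro i x
    have h1 : H i x ≤ (θ i).k + 1 := by
      refine (hb i x).2.trans ?_
      have : (((θ i).map x).ht : ℝ) ≤ (θ i).k := by exact_mod_cast Fan.ht_le _
      linarith
    have h2 : (0 : ℝ) < (θ i).k + 1 := by positivity
    calc w i * H i x ≤ w i * ((θ i).k + 1) := mul_le_mul_of_nonneg_left h1 (hw i).le
      _ = (1 / 2) ^ (i + 1) := div_mul_cancel₀ _ h2.ne'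
  have hgeo : HasSum (fun i : ℕ => (1 / 2 : ℝ) ^ (i + 1)) 1 := by
    convert hasSum_geometric_two' (1 : ℝ) using 2 with i
    rw [pow_succ, one_div_pow]
    ring
  have hsum : ∀ x, Summable fun i => w i * H i x := fun x =>
    Summable.of_nonneg_of_le (fun i => hterm0 i x) (fun i => hterm i x) hgeo.summable
  refine ⟨fun x => ∑' i, w i * H i x, ?_, fun x => ⟨tsum_nonneg fun i => hterm0 i x, ?_⟩,
    fun x y hxy => ?_, fun x y hxy => ?_, fun x y hxy heq => ?_, fun ρ hρ => ?_⟩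
  · refine continuous_tsum (fun i => (hc i).const_mul _) hgeo.summable fun i x => ?_
    rw [Real.norm_eq_abs, abs_of_nonneg (hterm0 i x)]
    exact hterm i x
  · rw [← hgeo.tsum_eq]
    exact (hsum x).tsum_le_tsum (fun i => hterm i x) hgeo.summable
  · simp only [hR _ x y hxy]
  · exact (hsum x).tsum_le_tsum (fun i => mul_le_mul_of_nonneg_left (hT i x y hxy) (hw i).le)
      (hsum y)
  · by_contra hne
    obtain ⟨A, hA⟩ := exists_not_symmR h𝓛 hne
    obtain ⟨i, hi⟩ := hθ A
    obtain ⟨h1, h2⟩ := hA (θ i) hi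
    have hle := hxy (θ i)
    have hlt : ((θ i).map x).ht + 2 ≤ ((θ i).map y).ht := by
      by_contra hcon
      have h3 := Fan.ht_mono hle
      have h4 : ((θ i).map y).ht = ((θ i).map x).ht ∨
        ((θ i).map y).ht = ((θ i).map x).ht + 1 := by omega
      rcases h4 with h4 | h4
      · exact h1 (Or.inl (Fan.eq_of_le_of_le hle le_rfl h4.symm))
      · exact h1 (Or.inr ⟨h4, hle⟩)
    have hlt' : (((θ i).map x).ht : ℝ) + 2 ≤ ((θ i).map y).ht := by exact_mod_cast hlt
    have hH : H i x < H i y := by linarith [(hb i x).2, (hb i y).1]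
    exact absurd heq ((hsum x).tsum_lt_tsum (fun j =>
      mul_le_mul_of_nonneg_left (hT j x y hxy) (hw j).le)
      (mul_lt_mul_of_pos_left hH (hw i)) (hsum y)).ne
  · simp only [hroot _ ρ hρ, mul_zero, tsum_zero]

end Height

/-! ### Branch codes -/

section Code

variable {𝕃 : Type u} [TopologicalSpace 𝕃] {𝓛 : RSStructure 𝕃}

/-- `x` is the root of the limit. -/
def IsRoot (𝓛 : RSStructure 𝕃) (x : 𝕃) : Prop := ∀ A : Approx 𝓛, (A.map x).ht = 0

theorem IsRoot.TLE {ρ : 𝕃} (h : IsRoot 𝓛 ρ) (x : 𝕃) : TLE 𝓛 ρ x := fun A => Or.inl (h A)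

/-- The branches of the limit (without the root) are distinguished by a sequence of locally constant
functions: the branches of the images in a cofinal sequence of approximations, where a point that is
still mapped to the root of the `i`-th approximation gets its branch from a later one. -/
theorem exists_code (h𝓛 : 𝓛.IsProjFraisseLimit RSStructure.IsOrderedFan) :
    ∃ e : ℕ → 𝕃 → ℕ, (∀ x, ¬ IsRoot 𝓛 x → ∀ i, ∀ᶠ y in 𝓝 x, e i y = e i x) ∧
      (∀ x y, ¬ IsRoot 𝓛 x → TLE 𝓛 x y → ∀ i, e i x = e i y) ∧
      ∀ x y, ¬ IsRoot 𝓛 x → ¬ IsRoot 𝓛 y → (∀ i, e i x = e i y) → 𝓛.S x y ∧ 𝓛.S y x := by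
  classical
  obtain ⟨θ, hθ1, hθ⟩ := exists_sequence h𝓛
  have hpat : ∀ i, ∃ β : ℕ → ℕ, ∀ x, ((θ i).map x).ht ≠ 0 →
      ((θ (i + 1)).map x).ht ≠ 0 ∧ ((θ i).map x).br = β ((θ (i + 1)).map x).br := by
    intro i
    obtain ⟨q, hq', hq⟩ := (hθ1 i).exists_epi
    obtain ⟨β, f, hp, rfl⟩ := Climb.exists_pattern (θ i).hn (θ i).hk hq'
    refine ⟨β, fun x hx => ?_⟩
    rw [hq] at hx ⊢
    exact hp.br_patMap _ hx
  choose β hβ using hpat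
  let E : ℕ → ℕ → ℕ → ℕ := fun i d => Nat.rec id (fun d f => f ∘ β (i + d)) d
  have hE : ∀ i d b, E i (d + 1) b = E i d (β (i + d) b) := fun i d b => rfl
  let e : ℕ → 𝕃 → ℕ := fun i x =>
    if h : ∃ d, ((θ (i + d)).map x).ht ≠ 0 then
      E i (Nat.find h) ((θ (i + Nat.find h)).map x).br else 0
  have hup : ∀ i x, ((θ i).map x).ht ≠ 0 → ∀ d, ((θ (i + d)).map x).ht ≠ 0 := by
    intro i x hx d
    induction d with
    | zero => exact hx
    | succ d ih => exact (hβ (i + d) x ih).1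
  have hstab : ∀ i d x, ((θ (i + d)).map x).ht ≠ 0 → ∀ c,
      E i (d + c) ((θ (i + (d + c))).map x).br = E i d ((θ (i + d)).map x).br := by
    intro i d x hx c
    induction c with
    | zero => rfl
    | succ c ih =>
      rw [← ih]
      change E i (d + c + 1) ((θ (i + (d + c) + 1)).map x).br = _
      rw [hE]
      refine congrArg _ (hβ (i + (d + c)) x ?_).2.symm
      rw [← add_assoc]
      exact hup _ _ hx c
  have he : ∀ i d x, ((θ (i + d)).map x).ht ≠ 0 → e i x = E i d ((θ (i + d)).map x).br := by
    intro i d x hx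
    have h : ∃ d, ((θ (i + d)).map x).ht ≠ 0 := ⟨d, hx⟩
    simp only [e, dif_pos h]
    have h1 := hstab i _ x (Nat.find_spec h) (d - Nat.find h)
    have h2 : Nat.find h + (d - Nat.find h) = d := by have := Nat.find_min' h hx; omega
    rw [h2] at h1
    exact h1.symm
  have hnr : ∀ x, ¬ IsRoot 𝓛 x → ∀ i, ∃ d, ((θ (i + d)).map x).ht ≠ 0 := by
    intro x hx i
    unfold IsRoot at hx
    push Not at hx
    obtain ⟨A, hA⟩ := hx
    obtain ⟨j, hj⟩ := hθ A
    refine ⟨j, ?_⟩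
    rw [add_comm]
    exact hup _ _ (fun h => hA (hj.root h)) i
  refine ⟨e, fun x hx i => ?_, fun x y hx hxy i => ?_, fun x y hx hy hxy => ?_⟩
  · obtain ⟨d, hd⟩ := hnr x hx i
    filter_upwards [((θ (i + d)).isOpen_fiber (· = (θ (i + d)).map x)).mem_nhds rfl] with y hy
    have hy' : (θ (i + d)).map y = (θ (i + d)).map x := hy
    rw [he i d x hd, he i d y (by rw [hy']; exact hd), hy']
  · obtain ⟨d, hd⟩ := hnr x hx i
    have h1 := hxy (θ (i + d))
    rw [Fan.le_def] at h1
    rw [he i d x hd, he i d y (by omega), (h1.resolve_left hd).2]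
  · have key : ∀ i, Fan.S ((θ i).map x) ((θ i).map y) ∧ Fan.S ((θ i).map y) ((θ i).map x) := by
      intro i
      by_cases h1 : ((θ i).map x).ht = 0
      · exact ⟨Or.inl h1, Or.inr (Or.inl h1)⟩
      by_cases h2 : ((θ i).map y).ht = 0
      · exact ⟨Or.inr (Or.inl h2), Or.inl h2⟩
      have h3 : ((θ i).map x).br = ((θ i).map y).br := by
        have h4 := hxy i
        rwa [he i 0 x h1, he i 0 y h2] at h4
      exact ⟨Or.inr (Or.inr h3.le), Or.inr (Or.inr h3.ge)⟩
    refine ⟨(S_iff h𝓛).2 fun A => ?_, (S_iff h𝓛).2 fun A => ?_⟩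
    · obtain ⟨i, hi⟩ := hθ A
      exact hi.S (key i).1
    · obtain ⟨i, hi⟩ := hθ A
      exact hi.S (key i).2

end Code

/-! ### The Cantor fan -/

namespace CantorFan

/-- Coordinates on the Cantor fan: the height, and for each digit the height or zero. -/
noncomputable def coord : CantorFan → ℝ × (ℕ → ℝ) :=
  Quotient.lift (fun p => ((p.2 : ℝ), fun i => if p.1 i then (p.2 : ℝ) else 0)) (by
    rintro p q (rfl | ⟨h1, h2⟩)
    · rfl
    · simp [h1, h2])

theorem continuous_coord : Continuous coord := by
  refine continuous_quot_lift _ ?_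
  refine (continuous_subtype_val.comp continuous_snd).prodMk (continuous_pi fun i => ?_)
  have h : Continuous fun b : Bool => if b then (1 : ℝ) else 0 := continuous_of_discreteTopology
  have h2 : Continuous fun p : (ℕ → Bool) × unitInterval =>
      (if p.1 i then (1 : ℝ) else 0) * (p.2 : ℝ) :=
    (h.comp ((continuous_apply i).comp continuous_fst)).mul
      (continuous_subtype_val.comp continuous_snd)
  refine h2.congr fun p => ?_
  split_ifs <;> simp

theorem injective_coord : Function.Injective coord := by
  rintro ⟨p⟩ ⟨q⟩ h
  have h1 : (p.2 : ℝ) = q.2 := congrArg Prod.fst h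
  have h2 : ∀ i, (if p.1 i then (p.2 : ℝ) else 0) = if q.1 i then (q.2 : ℝ) else 0 := fun i =>
    congrFun (congrArg Prod.snd h) i
  apply Quotient.sound
  by_cases h0 : (p.2 : ℝ) = 0
  · exact Or.inr ⟨Subtype.ext h0, Subtype.ext (h1 ▸ h0)⟩
  · refine Or.inl (Prod.ext (funext fun i => ?_) (Subtype.ext h1))
    have h3 := h2 i
    rw [← h1] at h3
    cases hp : p.1 i <;> cases hq : q.1 i <;>
      simp only [hp, hq, if_true, Bool.false_eq_true, if_false] at h3 ⊢
    · exact absurd h3.symm h0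
    · exact absurd h3 h0

theorem isEmbedding_coord : IsEmbedding coord :=
  (continuous_coord.isClosedEmbedding injective_coord).isEmbedding

instance : T2Space CantorFan := isEmbedding_coord.t2Space

end CantorFan

/-! ### The embedding of the quotient -/

theorem proj_surjective {X : Type*} {𝓧 : RSStructure X} : Function.Surjective 𝓧.proj :=
  Quot.mk_surjective

section Quotient

variable {𝕃 : Type u} [TopologicalSpace 𝕃] {𝓛 : RSStructure 𝕃}

theorem continuous_proj : Continuous 𝓛.proj := continuous_quot_mk

theorem compactSpace_space (h𝓛 : 𝓛.IsProjFraisseLimit RSStructure.IsOrderedFan) :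
    CompactSpace 𝓛.Space := by
  have := h𝓛.isTopological.compact
  infer_instance

/-- The quotient of the limit embeds into the Cantor fan: a point is sent to the code of its branch
and its height. -/
theorem exists_injective_cantorFan (h𝓛 : 𝓛.IsProjFraisseLimit RSStructure.IsOrderedFan) :
    ∃ f : 𝓛.Space → CantorFan, Continuous f ∧ Function.Injective f := by
  obtain ⟨e, he1, he2, he3⟩ := exists_code h𝓛
  obtain ⟨h, hc, hb, hR, hT, hsep, hroot⟩ := exists_total_height h𝓛
  obtain ⟨ρ, hρ⟩ := exists_root h𝓛
  have hh0 : ∀ x, h x = 0 → 𝓛.symmR ρ x := fun x hx =>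
    hsep ρ x (IsRoot.TLE hρ x) (by rw [hroot ρ hρ, hx])
  have hnr : ∀ x, h x ≠ 0 → ¬ IsRoot 𝓛 x := fun x hx hr => hx (hroot x hr)
  let bit : 𝕃 → ℕ → Bool := fun x m => decide (e m.unpair.1 x = m.unpair.2)
  let F : 𝕃 → CantorFan := fun x => Quotient.mk _ (bit x, ⟨h x, hb x⟩)
  have hF : Continuous F := by
    rw [CantorFan.isEmbedding_coord.continuous_iff]
    refine hc.prodMk (continuous_pi fun i => ?_)
    change Continuous fun x => if bit x i then h x else 0
    rw [continuous_iff_continuousAt]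
    intro x
    by_cases hx : h x = 0
    · have h1 : (if bit x i then h x else 0) = 0 := by rw [hx, ite_self]
      change Filter.Tendsto _ _ (𝓝 (if bit x i then h x else 0))
      rw [h1]
      refine squeeze_zero (fun y => ?_) (fun y => ?_) (by
        have h2 := hc.tendsto x
        rwa [hx] at h2)
      · split_ifs
        exacts [(hb y).1, le_rfl]
      · split_ifs
        exacts [le_rfl, (hb y).1]
    · have h1 : (fun y => if bit x i then h y else 0) =ᶠ[𝓝 x] fun y =>
          if bit y i then h y else 0 := by
        filter_upwards [he1 x (hnr x hx) i.unpair.1] with y hy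
        simp only [bit, hy]
      refine ContinuousAt.congr ?_ h1
      cases bit x i
      · exact continuousAt_const
      · exact hc.continuousAt
  have hcompat : ∀ x y, 𝓛.symmR x y → F x = F y := by
    intro x y hxy
    have h1 := hR x y hxy
    apply Quotient.sound
    by_cases hx : h x = 0
    · exact Or.inr ⟨Subtype.ext hx, Subtype.ext (h1.symm.trans hx)⟩
    · have hy : h y ≠ 0 := h1 ▸ hx
      refine Or.inl (Prod.ext (funext fun i => ?_) (Subtype.ext h1))
      have h2 : e i.unpair.1 x = e i.unpair.1 y := by
        rcases hxy with h' | h'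
        · exact he2 x y (hnr x hx) (TLE.of_R h') _
        · exact (he2 y x (hnr y hy) (TLE.of_R h') _).symm
      simp only [bit, h2]
  refine ⟨Quot.lift F hcompat, continuous_quot_lift _ hF, ?_⟩
  rintro ⟨x⟩ ⟨y⟩ hxy
  refine Quot.sound ?_
  rcases Quotient.exact hxy with h1 | ⟨h1, h2⟩
  · have h2 : h x = h y := congrArg (fun p => (p.2 : ℝ)) h1
    have h3 : ∀ m, bit x m = bit y m := fun m => congrFun (congrArg Prod.fst h1) m
    by_cases hx : h x = 0
    · exact (symmR_equivalence h𝓛).trans ((symmR_equivalence h𝓛).symm (hh0 x hx))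
        (hh0 y (h2 ▸ hx))
    have h4 : ∀ i, e i x = e i y := by
      intro i
      have h5 := h3 (Nat.pair i (e i x))
      simp only [bit, Nat.unpair_pair, decide_true] at h5
      exact (of_decide_eq_true h5.symm).symm
    obtain ⟨h5, h6⟩ := he3 x y (hnr x hx) (hnr y (h2 ▸ hx)) h4
    rcases TLE.total_of_S h𝓛 h5 h6 with h7 | h7
    · exact hsep x y h7 h2
    · exact (hsep y x h7 h2.symm).symm
  · exact (symmR_equivalence h𝓛).trans
      ((symmR_equivalence h𝓛).symm (hh0 x (congrArg Subtype.val h1)))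
      (hh0 y (congrArg Subtype.val h2))

theorem t2Space_space (h𝓛 : 𝓛.IsProjFraisseLimit RSStructure.IsOrderedFan) :
    T2Space 𝓛.Space := by
  obtain ⟨f, hf, hi⟩ := exists_injective_cantorFan h𝓛
  exact T2Space.of_injective_continuous hi hf

theorem isClosedMap_proj (h𝓛 : 𝓛.IsProjFraisseLimit RSStructure.IsOrderedFan) :
    IsClosedMap 𝓛.proj := by
  have := h𝓛.isTopological.compact
  have := t2Space_space h𝓛
  exact continuous_proj.isClosedMap

/-! ### Connectedness -/

/-- Every vertex below the image of a point lifts to a vertex below this point. -/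
theorem exists_TLE_of_le (h𝓛 : 𝓛.IsProjFraisseLimit RSStructure.IsOrderedFan) (A : Approx 𝓛)
    {y : 𝕃} {b : Fan A.n A.k} (hb : b ≤ A.map y) : ∃ x, TLE 𝓛 x y ∧ A.map x = b := by
  have := h𝓛.isTopological.compact
  obtain ⟨x, hx⟩ := exists_forall_approx h𝓛 (fun B => {x | A.map x = b ∧ B.map x ≤ B.map y})
    (fun B => (A.isClosed_fiber (· = b)).inter (B.isClosed_fiber (· ≤ B.map y)))
    (fun B => by
      obtain ⟨C, hCA, hCB⟩ := exists_refines₂ h𝓛 A B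
      obtain ⟨q, hq', hq⟩ := hCA.exists_epi
      have key : ∃ c, c ≤ C.map y ∧ q c = b := by
        rw [hq] at hb
        rcases (Fan.ht_mono hb).eq_or_lt with h | h
        · exact ⟨_, le_rfl, (Fan.eq_of_le_of_le hb le_rfl h).symm⟩
        · obtain ⟨c, d, hcd, hd, hc, -⟩ := Fan.exists_edge (Fan.epi_root hq')
            (fun a b h => Fan.epi_R hq' h) b.ht (C.map y) h
          have hcy := hcd.le.trans hd
          exact ⟨c, hcy, Fan.eq_of_le_of_le (Fan.epi_monotone hq' hcy) hb hc⟩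
      obtain ⟨c, hc, hcb⟩ := key
      obtain ⟨x, rfl⟩ := C.epi.surjective c
      exact ⟨x, (hq x).trans hcb, hCB.le hc⟩)
    (fun B C hBC x hx => ⟨hx.1, hBC.le hx.2⟩)
  obtain ⟨B⟩ := nonempty_approx h𝓛
  exact ⟨x, fun B => (hx B).2, (hx B).1⟩

theorem exists_adjacent_colors {N : ℕ} {c c' : ℕ → Prop} (h : ∀ j ≤ N, c j ∨ c' j)
    (hc : ∃ j ≤ N, c j) (hc' : ∃ j ≤ N, c' j) :
    ∃ i ≤ N, ∃ j ≤ N, c i ∧ c' j ∧ (i = j ∨ i + 1 = j ∨ j + 1 = i) := by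
  by_contra! hcon
  obtain ⟨i, hi, hci⟩ := hc
  obtain ⟨j, hj, hcj⟩ := hc'
  have hup : ∀ d, i + d ≤ N → c (i + d) := by
    intro d
    induction d with
    | zero => exact fun _ => hci
    | succ d ih =>
      intro hd
      refine (h _ hd).resolve_right fun hcd => ?_
      exact (hcon (i + d) (by omega) (i + (d + 1)) hd (ih (by omega)) hcd).2.1 rfl
  have hdown : ∀ d ≤ i, c (i - d) := by
    intro d
    induction d with
    | zero => exact fun _ => hci
    | succ d ih =>
      intro hd
      refine (h _ (by omega)).resolve_right fun hcd => ?_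
      exact (hcon (i - d) (by omega) (i - (d + 1)) (by omega) (ih (by omega)) hcd).2.2 (by omega)
  have hcj' : c j := by
    rcases le_total i j with h1 | h1
    · have := hup (j - i) (by omega)
      rwa [Nat.add_sub_cancel' h1] at this
    · have := hdown (i - j) (by omega)
      rwa [Nat.sub_sub_self h1] at this
  exact (hcon j hj j hj hcj' hcj).1 rfl

theorem symmR_of_forall (h𝓛 : 𝓛.IsProjFraisseLimit RSStructure.IsOrderedFan) {x y : 𝕃}
    (h : ∀ A : Approx 𝓛, Fan.R (A.map x) (A.map y) ∨ Fan.R (A.map y) (A.map x)) :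
    𝓛.symmR x y := by
  by_contra hcon
  obtain ⟨A, hA⟩ := exists_not_symmR h𝓛 hcon
  have h1 := hA A (Approx.Refines.refl A)
  exact (h A).elim h1.1 h1.2

/-- The initial segments of the branches are connected: if two closed sets cover such a segment,
then in each approximation there are adjacent vertices whose fibres meet both sets. -/
theorem isPreconnected_segment (h𝓛 : 𝓛.IsProjFraisseLimit RSStructure.IsOrderedFan) (y : 𝕃) :
    IsPreconnected (𝓛.proj '' {x | TLE 𝓛 x y}) := by
  rw [isPreconnected_closed_iff]
  rintro t t' ht ht' hcov ⟨_, ⟨x₀, hx₀, rfl⟩, h₀⟩ ⟨_, ⟨x₁, hx₁, rfl⟩, h₁⟩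
  have hD : IsClosed {x | TLE 𝓛 x y} :=
    isClosed_TLE.preimage (continuous_id.prodMk continuous_const)
  have hT := hD.inter (ht.preimage continuous_proj)
  have hT' := hD.inter (ht'.preimage continuous_proj)
  obtain ⟨p, ⟨⟨hp1, hp2⟩, hp3, hp4⟩, hp⟩ := exists_pair h𝓛 (hT.prod hT')
    (fun A a b => Fan.R a b ∨ Fan.R b a) (fun A B hAB x y h => h.imp hAB.R hAB.R)
    (fun A => by
      let col : Set 𝓛.Space → ℕ → Prop := fun s j =>
        ∃ x, TLE 𝓛 x y ∧ 𝓛.proj x ∈ s ∧ (A.map x).ht = j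
      obtain ⟨i, hi, j, hj, ⟨x, hx1, hx2, hx3⟩, ⟨x', hx1', hx2', hx3'⟩, hij⟩ :=
        exists_adjacent_colors (N := (A.map y).ht) (c := col t) (c' := col t')
        (fun j hj => by
          obtain ⟨b, hb, hbj⟩ := Fan.exists_le hj
          obtain ⟨x, hx, hxb⟩ := exists_TLE_of_le h𝓛 A hb
          have hxj : (A.map x).ht = j := by rw [hxb, hbj]
          rcases hcov ⟨x, hx, rfl⟩ with h | h
          · exact Or.inl ⟨x, hx, h, hxj⟩
          · exact Or.inr ⟨x, hx, h, hxj⟩)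
        ⟨_, Fan.ht_mono (hx₀ A), x₀, hx₀, h₀, rfl⟩ ⟨_, Fan.ht_mono (hx₁ A), x₁, hx₁, h₁, rfl⟩
      refine ⟨(x, x'), ⟨⟨hx1, hx2⟩, hx1', hx2'⟩, ?_⟩
      change Fan.R (A.map x) (A.map x') ∨ Fan.R (A.map x') (A.map x)
      have h1 := hx1 A
      have h2 := hx1' A
      rcases hij with h | h | h
      · exact Or.inl (Or.inl (Fan.eq_of_le_of_le h1 h2 (by omega)))
      · refine Or.inl (Or.inr ⟨by omega, ?_⟩)
        rw [Fan.le_def] at *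
        omega
      · refine Or.inr (Or.inr ⟨by omega, ?_⟩)
        rw [Fan.le_def] at *
        omega)
  have h1 : 𝓛.proj p.1 = 𝓛.proj p.2 := (proj_eq_iff h𝓛).2 (symmR_of_forall h𝓛 hp)
  refine ⟨𝓛.proj p.1, ⟨p.1, hp1, rfl⟩, hp2, ?_⟩
  rw [h1]
  exact hp4

theorem connectedSpace_space (h𝓛 : 𝓛.IsProjFraisseLimit RSStructure.IsOrderedFan) :
    ConnectedSpace 𝓛.Space := by
  obtain ⟨ρ, hρ⟩ := exists_root h𝓛
  have : PreconnectedSpace 𝓛.Space := by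
    refine ⟨isPreconnected_of_forall (𝓛.proj ρ) fun p _ => ?_⟩
    obtain ⟨y, rfl⟩ := proj_surjective p
    exact ⟨𝓛.proj '' {x | TLE 𝓛 x y}, subset_univ _, ⟨ρ, IsRoot.TLE hρ y, rfl⟩,
      ⟨y, TLE.refl y, rfl⟩, isPreconnected_segment h𝓛 y⟩
  exact ⟨⟨𝓛.proj ρ⟩⟩

theorem exists_refines_two_le (h𝓛 : 𝓛.IsProjFraisseLimit RSStructure.IsOrderedFan)
    (A : Approx 𝓛) : ∃ B : Approx 𝓛, B.Refines A ∧ 2 ≤ B.k := by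
  obtain ⟨B, hBA, hB⟩ := exists_double h𝓛 A
  refine ⟨B, hBA, ?_⟩
  obtain ⟨x, hx⟩ := A.epi.surjective (Fan.vtx A.n A.k 0 A.k)
  have h1 := hB x
  rw [hx, Fan.ht_vtx A.hn le_rfl] at h1
  have h2 := (B.map x).ht_le
  have h3 := A.hk
  omega

theorem nontrivial_space (h𝓛 : 𝓛.IsProjFraisseLimit RSStructure.IsOrderedFan) :
    Nontrivial 𝓛.Space := by
  obtain ⟨ρ, hρ⟩ := exists_root h𝓛
  obtain ⟨A⟩ := nonempty_approx h𝓛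
  obtain ⟨B, -, hB⟩ := exists_refines_two_le h𝓛 A
  obtain ⟨x, hx⟩ := B.epi.surjective (Fan.vtx B.n B.k 0 B.k)
  refine ⟨𝓛.proj ρ, 𝓛.proj x, fun h => ?_⟩
  have h1 : (B.map x).ht = B.k := by rw [hx, Fan.ht_vtx B.hn le_rfl]
  have h2 := hρ B
  rcases (proj_eq_iff h𝓛).1 h with h3 | h3
  · have := (B.R_map h3).ht_le
    omega
  · have := Fan.ht_mono (B.R_map h3).le
    omega

/-- A property that holds near the fibre of `p` holds on all fibres near `p`. -/
theorem eventually_proj (h𝓛 : 𝓛.IsProjFraisseLimit RSStructure.IsOrderedFan) {p : 𝓛.Space}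
    {P : 𝕃 → Prop} (h : ∀ x, 𝓛.proj x = p → ∀ᶠ y in 𝓝 x, P y) :
    ∀ᶠ q in 𝓝 p, ∀ x, 𝓛.proj x = q → P x :=
  (isClosedMap_proj h𝓛).eventually_nhds_fiber p h

/-! ### Endpoints -/

/-- A continuous real function that is injective on an interval has no maximum inside it. -/
theorem not_isMax_of_injOn {g : ℝ → ℝ} {a s b : ℝ} (has : a < s) (hsb : s < b)
    (hc : ContinuousOn g (Icc a b)) (hi : InjOn g (Icc a b)) (hmax : ∀ t ∈ Icc a b, g t ≤ g s) :
    False := by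
  have hs : s ∈ Icc a b := ⟨has.le, hsb.le⟩
  have ha : a ∈ Icc a b := ⟨le_rfl, (has.trans hsb).le⟩
  have hb : b ∈ Icc a b := ⟨(has.trans hsb).le, le_rfl⟩
  have h1 : g a < g s := (hmax a ha).lt_of_ne fun h => has.ne (hi ha hs h)
  have h2 : g b < g s := (hmax b hb).lt_of_ne fun h => hsb.ne' (hi hb hs h)
  obtain ⟨u, hu, hgu⟩ := intermediate_value_Icc has.le (hc.mono (Icc_subset_Icc_right hsb.le))
    (show max (g a) (g b) ∈ Icc (g a) (g s) from ⟨le_max_left _ _, max_le h1.le h2.le⟩)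
  obtain ⟨w, hw, hgw⟩ := intermediate_value_Icc' hsb.le (hc.mono (Icc_subset_Icc_left has.le))
    (show max (g a) (g b) ∈ Icc (g b) (g s) from ⟨le_max_right _ _, max_le h1.le h2.le⟩)
  have huw : u = w := hi ⟨hu.1, hu.2.trans hsb.le⟩ ⟨has.le.trans hw.1, hw.2⟩ (hgu.trans hgw.symm)
  have hus : u = s := le_antisymm hu.2 (huw ▸ hw.1)
  rw [hus] at hgu
  exact absurd hgu (max_lt h1 h2).ne'

/-- The endpoints are dense.  Given a vertex `a` of an approximation, a new branch that ends in a
stretch over `a` is added; a point of maximal height over the top of this new branch is an endpoint,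
because an arc through it stays on one branch near this point, so that the height is injective on
the arc. -/
theorem dense_endpoints (h𝓛 : 𝓛.IsProjFraisseLimit RSStructure.IsOrderedFan) :
    Dense {x : 𝓛.Space | IsEndpoint x} := by
  have := h𝓛.isTopological.compact
  have := t2Space_space h𝓛
  obtain ⟨e, he1, he2, he3⟩ := exists_code h𝓛
  obtain ⟨h, hc, hb, hR, hT, hsep, hroot⟩ := exists_total_height h𝓛
  rw [dense_iff_inter_open]
  rintro U hU ⟨p, hp⟩
  obtain ⟨x, rfl⟩ := proj_surjective p
  obtain ⟨A', hA'⟩ := exists_fiber_subset h𝓛 (hU.preimage continuous_proj) hp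
  obtain ⟨A, hAA', hk2⟩ := exists_refines_two_le h𝓛 A'
  set i := (A.map x).br with hi
  set j := (A.map x).ht with hj
  have hin : i < A.n := by
    have := (A.map x).prop
    have := A.hn
    omega
  have hjk : j ≤ A.k := (A.map x).ht_le
  have hpat := Climb.isPattern_add_branch (n := A.n) (k := A.k) j hin
  obtain ⟨φ, hφ, hAφ⟩ := exists_lift h𝓛 A (Nat.succ_pos _) A.hk (hpat.isEpi A.hk)
  let B : Approx 𝓛 := ⟨A.n + 1, A.k, Nat.succ_pos _, A.hk, φ, hφ⟩
  let top : Fan (A.n + 1) A.k := Fan.vtx (A.n + 1) A.k (i + 1) A.k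
  have htop1 : top.ht = A.k := Fan.ht_vtx (by omega) le_rfl
  have htop2 : top.br = i + 1 := Fan.br_vtx (by omega) le_rfl (by omega)
  have hcomp : IsCompact {y | φ y = top} := (B.isClosed_fiber (· = top)).isCompact
  obtain ⟨z, hz, hzmax⟩ := hcomp.exists_isMaxOn (hφ.surjective top) hc.continuousOn
  have hz' : φ z = top := hz
  have hAz : A.map z = A.map x := by
    rw [hAφ, hz']
    unfold Climb.patMap
    rw [htop1, htop2]
    simp only [if_neg (Nat.not_succ_le_self i), if_true]
    have h1 : (Climb.cap (min j A.k)).toFun A.k = j := by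
      change min A.k (min j A.k) = j
      omega
    rw [h1, Nat.add_sub_cancel, hi, hj, Fan.vtx_br_ht]
  refine ⟨𝓛.proj z, hA' z (hAA'.eq hAz), ?_⟩
  rintro α hα ⟨s, hs⟩
  by_contra! hcon
  have hs0 : (0 : ℝ) < s := s.2.1.lt_of_ne fun h0 => hcon.1 (by
    rw [← hs, show s = 0 from Subtype.ext h0.symm])
  have hs1 : (s : ℝ) < 1 := s.2.2.lt_of_ne fun h0 => hcon.2 (by
    rw [← hs, show s = 1 from Subtype.ext h0])
  -- near `z` all points lie over the last two vertices of the new branch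
  have hnear : ∀ᶠ q in 𝓝 (𝓛.proj z), ∀ y, 𝓛.proj y = q → (φ y).br = i + 1 ∧ A.k ≤ (φ y).ht + 1 := by
    refine eventually_proj h𝓛 fun y hy => ?_
    refine (B.isOpen_fiber fun b => b.br = i + 1 ∧ A.k ≤ b.ht + 1).mem_nhds ?_
    change (φ y).br = i + 1 ∧ A.k ≤ (φ y).ht + 1
    rcases (proj_eq_iff h𝓛).1 hy with h1 | h1
    · have h2 := (B.R_map h1).ht_le
      have h3 := (B.R_map h1).le
      change φ y ≤ φ z at h3
      change (φ z).ht ≤ (φ y).ht + 1 at h2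
      rw [hz', Fan.le_def] at h3
      rw [hz'] at h2
      omega
    · have h3 := (B.R_map h1).le
      change φ z ≤ φ y at h3
      rw [hz', Fan.le_def] at h3
      omega
  have hnr : ∀ y, (φ y).br = i + 1 → ¬ IsRoot 𝓛 y := by
    intro y hy hr
    have := Fan.br_eq_zero (hr B)
    change (φ y).br = 0 at this
    omega
  have hpr : Continuous fun t : ℝ => α (projIcc 0 1 zero_le_one t) :=
    hα.continuous.comp continuous_projIcc
  have hps : α (projIcc 0 1 zero_le_one s) = 𝓛.proj z := by
    rw [projIcc_val]
    exact hs
  have hev : ∀ᶠ t in 𝓝 (s : ℝ), ∀ y, 𝓛.proj y = α (projIcc 0 1 zero_le_one t) →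
      (φ y).br = i + 1 ∧ A.k ≤ (φ y).ht + 1 := by
    have h1 := hpr.tendsto (s : ℝ)
    simp only [hps] at h1
    exact h1.eventually hnear
  obtain ⟨ε, hε, hball⟩ := Metric.eventually_nhds_iff.1
    (hev.and ((lt_mem_nhds hs0).and (gt_mem_nhds hs1)))
  let J : Set ℝ := Icc (s - ε / 2) (s + ε / 2)
  have hJ : ∀ t ∈ J, (∀ y, 𝓛.proj y = α (projIcc 0 1 zero_le_one t) →
      (φ y).br = i + 1 ∧ A.k ≤ (φ y).ht + 1) ∧ 0 < t ∧ t < 1 := by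
    rintro t ⟨h1, h2⟩
    exact hball (by rw [Real.dist_eq, abs_lt]; constructor <;> linarith)
  have hsJ : (s : ℝ) ∈ J := ⟨by linarith, by linarith⟩
  choose σ hσ using fun t : ℝ => proj_surjective (𝓧 := 𝓛) (α (projIcc 0 1 zero_le_one t))
  -- the branch is constant along the arc near `z`
  have hconst : ∀ m, ∀ t ∈ J, e m (σ t) = e m z := by
    intro m
    have hcongr : ∀ y y', 𝓛.proj y = 𝓛.proj y' → ¬ IsRoot 𝓛 y → ¬ IsRoot 𝓛 y' →
        e m y = e m y' := by
      intro y y' hyy hy hy'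
      rcases (proj_eq_iff h𝓛).1 hyy with h1 | h1
      · exact he2 y y' hy (TLE.of_R h1) m
      · exact (he2 y' y hy' (TLE.of_R h1) m).symm
    have hcont : ContinuousOn (fun t => e m (σ t)) J := by
      intro t ht
      have hnrt : ∀ y, 𝓛.proj y = α (projIcc 0 1 zero_le_one t) → ¬ IsRoot 𝓛 y := fun y hy =>
        hnr y ((hJ t ht).1 y hy).1
      have h1 : ∀ᶠ q in 𝓝 (α (projIcc 0 1 zero_le_one t)), ∀ y, 𝓛.proj y = q →
          e m y = e m (σ t) := by
        refine eventually_proj h𝓛 fun y hy => ?_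
        rw [← hcongr y (σ t) (hy.trans (hσ t).symm) (hnrt y hy) (hnrt _ (hσ t))]
        exact he1 y (hnrt y hy) m
      have h2 : ∀ᶠ t' in 𝓝 t, e m (σ t') = e m (σ t) := by
        filter_upwards [(hpr.tendsto t).eventually h1] with t' ht'
        exact ht' _ (hσ t')
      exact (continuousAt_const.congr (h2.mono fun _ h => h.symm)).continuousWithinAt
    intro t ht
    rw [isPreconnected_Icc.constant hcont ht hsJ]
    have h3 : 𝓛.proj (σ s) = 𝓛.proj z := (hσ s).trans hps
    exact hcongr _ _ h3 (hnr _ ((hJ s hsJ).1 _ (hσ s)).1) (hnr z (by rw [hz', htop2]))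
  let hbar : 𝓛.Space → ℝ := Quot.lift h hR
  have hbarc : Continuous hbar := continuous_quot_lift _ hc
  have hbarσ : ∀ t, hbar (α (projIcc 0 1 zero_le_one t)) = h (σ t) := by
    intro t
    rw [← hσ t]
    rfl
  have hcomparable : ∀ t ∈ J, ∀ y, ¬ IsRoot 𝓛 y → (∀ m, e m y = e m z) →
      TLE 𝓛 (σ t) y ∨ TLE 𝓛 y (σ t) := by
    intro t ht y hy hyz
    obtain ⟨h1, h2⟩ := he3 (σ t) y (hnr _ ((hJ t ht).1 _ (hσ t)).1) hy fun m =>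
      (hconst m t ht).trans (hyz m).symm
    exact TLE.total_of_S h𝓛 h1 h2
  refine not_isMax_of_injOn (g := fun t => hbar (α (projIcc 0 1 zero_le_one t)))
    (show (s : ℝ) - ε / 2 < s by linarith) (show (s : ℝ) < s + ε / 2 by linarith)
    (hbarc.comp hpr).continuousOn ?_ ?_
  · intro t ht t' ht' htt
    simp only [hbarσ] at htt
    have h1 : 𝓛.symmR (σ t) (σ t') := by
      rcases hcomparable t ht (σ t') (hnr _ ((hJ t' ht').1 _ (hσ t')).1)
        (fun m => hconst m t' ht') with h1 | h1
      · exact hsep _ _ h1 htt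
      · exact (hsep _ _ h1 htt.symm).symm
    have h2 := (proj_eq_iff h𝓛).2 h1
    rw [hσ, hσ] at h2
    have h3 := hα.injective h2
    have ht1 := hJ t ht
    have ht1' := hJ t' ht'
    rw [projIcc_of_mem _ ⟨ht1.2.1.le, ht1.2.2.le⟩,
      projIcc_of_mem _ ⟨ht1'.2.1.le, ht1'.2.2.le⟩] at h3
    exact congrArg Subtype.val h3
  · intro t ht
    simp only [hbarσ]
    have hzs : h (σ s) = h z := hR _ _ ((proj_eq_iff h𝓛).1 ((hσ s).trans hps))
    rw [hzs]
    rcases hcomparable t ht z (hnr z (by rw [hz', htop2])) (fun _ => rfl) with h1 | h1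
    · exact hT _ _ h1
    · refine hzmax ?_
      change φ (σ t) = top
      have h2 := h1 B
      change φ z ≤ φ (σ t) at h2
      rw [hz'] at h2
      refine (Fan.eq_of_le_of_le h2 le_rfl ?_).symm
      have h3 := Fan.ht_mono h2
      have h4 := (φ (σ t)).ht_le
      omega

theorem isLelekFan_space (h𝓛 : 𝓛.IsProjFraisseLimit RSStructure.IsOrderedFan) :
    IsLelekFan 𝓛.Space where
  compact := compactSpace_space h𝓛
  connected := connectedSpace_space h𝓛
  nontrivial := nontrivial_space h𝓛
  exists_embedding := by
    obtain ⟨f, hf, hi⟩ := exists_injective_cantorFan h𝓛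
    have := compactSpace_space h𝓛
    exact ⟨f, (hf.isClosedEmbedding hi).isEmbedding⟩
  dense_endpoints := dense_endpoints h𝓛

end Quotient

/-! ### Homeomorphism groups -/

section Homeo

variable {X : Type*} [TopologicalSpace X]

theorem continuous_homeo_toContinuousMap :
    Continuous fun h : X ≃ₜ X => (⟨h, h.continuous⟩ : C(X, X)) :=
  continuous_induced_dom

theorem continuous_homeo_eval [LocallyCompactSpace X] :
    Continuous fun p : (X ≃ₜ X) × X => p.1 p.2 :=
  (continuous_eval (F := C(X, X))).comp (continuous_homeo_toContinuousMap.prodMap continuous_id)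

theorem isTopologicalGroup_homeo [CompactSpace X] [T2Space X] : IsTopologicalGroup (X ≃ₜ X) where
  continuous_mul := continuous_induced_rng.2 <|
    (continuous_homeo_toContinuousMap.comp continuous_fst).compCM
      (continuous_homeo_toContinuousMap.comp continuous_snd)
  continuous_inv := by
    refine continuous_induced_rng.2 (ContinuousMap.continuous_compactOpen.2 fun K hK U hU => ?_)
    have h1 : {h : X ≃ₜ X | MapsTo (⇑(h⁻¹)) K U} = {h : X ≃ₜ X | MapsTo h Uᶜ Kᶜ} := by
      ext h
      constructor
      · intro hm x hx hxK
        refine hx ?_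
        have := hm hxK
        rwa [show (h⁻¹) (h x) = x from h.symm_apply_apply x] at this
      · intro hm x hx
        by_contra hxU
        have := hm hxU
        rw [show h ((h⁻¹) x) = x from h.apply_symm_apply x] at this
        exact this hx
    change IsOpen {h : X ≃ₜ X | MapsTo (⇑(h⁻¹)) K U}
    rw [h1]
    exact (ContinuousMap.isOpen_setOfPred_mapsTo hU.isClosed_compl.isCompact
      hK.isClosed.isOpen_compl).preimage continuous_homeo_toContinuousMap

/-- A neighbourhood of a homeomorphism contains all homeomorphisms that are uniformly close. -/
theorem exists_uniform_nhds [T2Space X] {f : X ≃ₜ X} {O : Set (X ≃ₜ X)} (hO : O ∈ 𝓝 f) :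
    ∃ V : Set (X × X), IsOpen V ∧ (∀ p, (p, p) ∈ V) ∧ ∀ g : X ≃ₜ X, (∀ p, (f p, g p) ∈ V) →
      g ∈ O := by
  let l : Filter (X ≃ₜ X) := Filter.comap (fun g => range fun p => (f p, g p))
    (𝓝ˢ (diagonal X)).smallSets
  have hl : Filter.Tendsto id l (𝓝 f) := by
    rw [nhds_induced, Filter.tendsto_comap_iff, ContinuousMap.tendsto_nhds_compactOpen]
    intro K hK U hU hm
    have hV : (f '' K)ᶜ ×ˢ univ ∪ univ ×ˢ U ∈ 𝓝ˢ (diagonal X) := by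
      refine IsOpen.mem_nhdsSet ?_ |>.2 ?_
      · exact ((hK.image f.continuous).isClosed.isOpen_compl.prod isOpen_univ).union
          (isOpen_univ.prod hU)
      · rintro ⟨p, q⟩ hpq
        obtain rfl : p = q := hpq
        by_cases hp : p ∈ f '' K
        · obtain ⟨k, hk, rfl⟩ := hp
          exact Or.inr ⟨mem_univ _, hm hk⟩
        · exact Or.inl ⟨hp, mem_univ _⟩
    filter_upwards [(Filter.eventually_smallSets_subset.2 hV).comap _] with g hg k hk
    rcases hg ⟨k, rfl⟩ with h | h
    · exact absurd ⟨k, hk, rfl⟩ h.1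
    · exact h.2
  obtain ⟨s, hs, hsO⟩ := Filter.mem_comap.1 (hl hO)
  obtain ⟨t, ht, hts⟩ := (Filter.hasBasis_smallSets _).mem_iff.1 hs
  obtain ⟨V, hVo, hdV, hVt⟩ := mem_nhdsSet_iff_exists.1 ht
  exact ⟨V, hVo, fun p => hdV rfl, fun g hg =>
    hsO (hts (show (range fun p => (f p, g p)) ∈ t.powerset from by
      rintro _ ⟨p, rfl⟩
      exact hVt (hg p)))⟩

end Homeo

/-! ### The closure of the induced homeomorphisms -/

section Closure

variable {𝕃 : Type u} [TopologicalSpace 𝕃] {𝓛 : RSStructure 𝕃}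

/-- Adjacent vertices of a suitable approximation have close fibres in the quotient space. -/
theorem exists_approx_close (h𝓛 : 𝓛.IsProjFraisseLimit RSStructure.IsOrderedFan)
    {V : Set (𝓛.Space × 𝓛.Space)} (hV : IsOpen V) (hd : ∀ p, (p, p) ∈ V) :
    ∃ A : Approx 𝓛, ∀ x y, Fan.R (A.map x) (A.map y) ∨ Fan.R (A.map y) (A.map x) →
      (𝓛.proj x, 𝓛.proj y) ∈ V := by
  by_contra! hcon
  obtain ⟨p, hp, h⟩ := exists_pair h𝓛
    (hV.isClosed_compl.preimage (continuous_proj.prodMap continuous_proj))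
    (fun A a b => Fan.R a b ∨ Fan.R b a) (fun A B hAB x y h => h.imp hAB.R hAB.R)
    (fun A => by
      obtain ⟨x, y, h1, h2⟩ := hcon A
      exact ⟨(x, y), h2, h1⟩)
  refine hp ?_
  change (𝓛.proj p.1, 𝓛.proj p.2) ∈ V
  rw [(proj_eq_iff h𝓛).2 (symmR_of_forall h𝓛 h)]
  exact hd _

/-- The branch order is the image of a compact relation. -/
theorem isClosed_branchLE (h𝓛 : 𝓛.IsProjFraisseLimit RSStructure.IsOrderedFan) :
    IsClosed {p : 𝓛.Space × 𝓛.Space | 𝓛.branchLE p.1 p.2} := by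
  have := h𝓛.isTopological.compact
  have := t2Space_space h𝓛
  have h1 : {p : 𝓛.Space × 𝓛.Space | 𝓛.branchLE p.1 p.2} =
      Prod.map 𝓛.proj 𝓛.proj '' {p | 𝓛.S p.1 p.2} := by
    ext ⟨p, q⟩
    constructor
    · rintro ⟨x, y, rfl, rfl, h⟩
      exact ⟨(x, y), h, rfl⟩
    · rintro ⟨⟨x, y⟩, h, h'⟩
      exact ⟨x, y, congrArg Prod.fst h', congrArg Prod.snd h', h⟩
  rw [h1]
  exact (h𝓛.isTopological.isClosed_S.isCompact.image
    (continuous_proj.prodMap continuous_proj)).isClosed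

theorem inducedHom_proj (g : 𝓛.aut) (x : 𝕃) : 𝓛.inducedHom g (𝓛.proj x) = 𝓛.proj (g.1 x) := rfl

theorem branchLE_of_mem_closure (h𝓛 : 𝓛.IsProjFraisseLimit RSStructure.IsOrderedFan)
    {h : 𝓛.Space ≃ₜ 𝓛.Space}
    (hh : h ∈ closure ((𝓛.inducedHom.range : Set (𝓛.Space ≃ₜ 𝓛.Space)))) {p q : 𝓛.Space}
    (hpq : 𝓛.branchLE p q) : 𝓛.branchLE (h p) (h q) := by
  have := compactSpace_space h𝓛
  have := t2Space_space h𝓛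
  have hev : ∀ r : 𝓛.Space, Continuous fun h : 𝓛.Space ≃ₜ 𝓛.Space => h r := fun r =>
    continuous_homeo_eval.comp (continuous_id.prodMk continuous_const)
  have hcl : IsClosed {h : 𝓛.Space ≃ₜ 𝓛.Space | 𝓛.branchLE (h p) (h q)} :=
    (isClosed_branchLE h𝓛).preimage ((hev p).prodMk (hev q))
  refine closure_minimal ?_ hcl hh
  rintro _ ⟨g, rfl⟩
  obtain ⟨x, y, rfl, rfl, hS⟩ := hpq
  exact ⟨g.1 x, g.1 y, rfl, rfl, (g.2.2 x y).2 hS⟩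

/-! ### Homeomorphisms that preserve the order of the branches -/

theorem Fan.br_eq_of_le {n k : ℕ} {a b : Fan n k} (h : a ≤ b) (ha : a.ht ≠ 0) : a.br = b.br := by
  rw [Fan.le_def] at h
  exact (h.resolve_left ha).2

theorem S_iff_of_TLE (h𝓛 : 𝓛.IsProjFraisseLimit RSStructure.IsOrderedFan) {x x' y : 𝕃}
    (hx : ¬ IsRoot 𝓛 x) (h : TLE 𝓛 x x') :
    (𝓛.S x y ↔ 𝓛.S x' y) ∧ (𝓛.S y x ↔ 𝓛.S y x') := by
  unfold IsRoot at hx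
  push Not at hx
  obtain ⟨A₀, hA₀⟩ := hx
  have key : ∀ A : Approx 𝓛, ∃ C : Approx 𝓛, C.Refines A ∧ (C.map x).ht ≠ 0 ∧ (C.map x').ht ≠ 0 ∧
      (C.map x).br = (C.map x').br := by
    intro A
    obtain ⟨C, hCA, hC⟩ := exists_refines₂ h𝓛 A A₀
    have h1 : (C.map x).ht ≠ 0 := fun h' => hA₀ (hC.root h')
    have h2 := Fan.ht_mono (h C)
    exact ⟨C, hCA, h1, by omega, Fan.br_eq_of_le (h C) h1⟩
  refine ⟨⟨fun hS => (S_iff h𝓛).2 fun A => ?_, fun hS => (S_iff h𝓛).2 fun A => ?_⟩,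
    fun hS => (S_iff h𝓛).2 fun A => ?_, fun hS => (S_iff h𝓛).2 fun A => ?_⟩
  all_goals
    obtain ⟨C, hC, h1, h2, h3⟩ := key A
    refine hC.S ?_
    have h4 := C.S_map hS
    unfold Fan.S at *
    omega

theorem S_iff_of_symmR (h𝓛 : 𝓛.IsProjFraisseLimit RSStructure.IsOrderedFan) {x x' y : 𝕃}
    (hx : ¬ IsRoot 𝓛 x) (hx' : ¬ IsRoot 𝓛 x') (h : 𝓛.symmR x x') :
    (𝓛.S x y ↔ 𝓛.S x' y) ∧ (𝓛.S y x ↔ 𝓛.S y x') := by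
  rcases h with h | h
  · exact S_iff_of_TLE h𝓛 hx (TLE.of_R h)
  · have := S_iff_of_TLE h𝓛 (y := y) hx' (TLE.of_R h)
    exact ⟨this.1.symm, this.2.symm⟩

/-- Points of the quotient that are related by the branch order in both directions lie on a common
branch. -/
theorem exists_TLE_of_branchLE (h𝓛 : 𝓛.IsProjFraisseLimit RSStructure.IsOrderedFan)
    {p q : 𝓛.Space} (h₁ : 𝓛.branchLE p q) (h₂ : 𝓛.branchLE q p) :
    ∃ x y, 𝓛.proj x = p ∧ 𝓛.proj y = q ∧ (TLE 𝓛 x y ∨ TLE 𝓛 y x) := by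
  obtain ⟨x, y, rfl, rfl, hS⟩ := h₁
  obtain ⟨y', x', hy, hx, hS'⟩ := h₂
  by_cases hx0 : IsRoot 𝓛 x
  · exact ⟨x, y, rfl, rfl, Or.inl (hx0.TLE y)⟩
  by_cases hx0' : IsRoot 𝓛 x'
  · exact ⟨x', y, hx, rfl, Or.inl (hx0'.TLE y)⟩
  by_cases hy0 : IsRoot 𝓛 y
  · exact ⟨x, y, rfl, rfl, Or.inr (hy0.TLE x)⟩
  by_cases hy0' : IsRoot 𝓛 y'
  · exact ⟨x, y', rfl, hy, Or.inr (hy0'.TLE x)⟩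
  have h1 := (S_iff_of_symmR h𝓛 (y := x') hy0' hy0 ((proj_eq_iff h𝓛).1 hy)).1.1 hS'
  have h2 := (S_iff_of_symmR h𝓛 (y := y) hx0' hx0 ((proj_eq_iff h𝓛).1 hx)).2.1 h1
  exact ⟨x, y, rfl, rfl, TLE.total_of_S h𝓛 hS h2⟩

theorem branchLE_of_TLE (h𝓛 : 𝓛.IsProjFraisseLimit RSStructure.IsOrderedFan) {x y : 𝕃}
    (h : TLE 𝓛 x y) : 𝓛.branchLE (𝓛.proj x) (𝓛.proj y) ∧ 𝓛.branchLE (𝓛.proj y) (𝓛.proj x) :=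
  ⟨⟨x, y, rfl, rfl, (TLE.S h𝓛 h).1⟩, ⟨y, x, rfl, rfl, (TLE.S h𝓛 h).2⟩⟩

theorem exists_branches (h𝓛 : 𝓛.IsProjFraisseLimit RSStructure.IsOrderedFan) (A : Approx 𝓛) :
    ∃ B : Approx 𝓛, B.Refines A ∧ 2 ≤ B.n ∧ 2 ≤ B.k := by
  obtain ⟨B, hBA, hk⟩ := exists_refines_two_le h𝓛 A
  obtain ⟨φ, hφ, h⟩ := exists_lift h𝓛 B (Nat.succ_pos _) B.hk
    ((Climb.isPattern_add_branch (n := B.n) (k := B.k) 0 (i := 0) B.hn).isEpi B.hk)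
  refine ⟨⟨B.n + 1, B.k, Nat.succ_pos _, B.hk, φ, hφ⟩,
    (Approx.refines_of_eq fun x y hxy => ?_).trans hBA, ?_, hk⟩
  · rw [h, h]
    exact congrArg _ hxy
  have := B.hn
  change 2 ≤ B.n + 1
  omega

/-- The apex is the only point of the quotient that lies on all branches. -/
theorem apex_unique (h𝓛 : 𝓛.IsProjFraisseLimit RSStructure.IsOrderedFan) {ρ y : 𝕃}
    (hρ : IsRoot 𝓛 ρ)
    (hy : ∀ q, 𝓛.branchLE (𝓛.proj y) q ∧ 𝓛.branchLE q (𝓛.proj y)) : 𝓛.symmR ρ y := by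
  by_contra hne
  obtain ⟨A, hA⟩ := exists_not_symmR h𝓛 hne
  obtain ⟨B, hBA, hn, hk⟩ := exists_branches h𝓛 A
  have hB := (hA B hBA).1
  have hy2 : 2 ≤ (B.map y).ht := by
    by_contra hcon
    refine hB ?_
    rcases Nat.eq_zero_or_pos (B.map y).ht with h | h
    · exact Or.inl (by rw [Fan.eq_root (hρ B), Fan.eq_root h])
    · exact Or.inr ⟨by rw [hρ B]; omega, Or.inl (hρ B)⟩
  -- the top of another branch is not comparable with `y`
  let i := if (B.map y).br = 0 then 1 else 0
  have hi : i < B.n ∧ i ≠ (B.map y).br := by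
    simp only [i]
    split_ifs <;> omega
  obtain ⟨w, hw⟩ := B.epi.surjective (Fan.vtx B.n B.k i B.k)
  have hw1 : (B.map w).ht = B.k := by rw [hw, Fan.ht_vtx hi.1 le_rfl]
  have hw2 : (B.map w).br = i := by rw [hw, Fan.br_vtx hi.1 le_rfl (by omega)]
  obtain ⟨y', w', hy', hw', h⟩ := exists_TLE_of_branchLE h𝓛 (hy (𝓛.proj w)).1 (hy (𝓛.proj w)).2
  have hadj : ∀ a a', 𝓛.proj a' = 𝓛.proj a → 2 ≤ (B.map a).ht →
      (B.map a').ht ≠ 0 ∧ (B.map a').br = (B.map a).br := by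
    intro a a' haa ha
    rcases (proj_eq_iff h𝓛).1 haa with h1 | h1
    · have h2 := (B.R_map h1).ht_le
      have h3 : (B.map a').ht ≠ 0 := by omega
      exact ⟨h3, Fan.br_eq_of_le (B.R_map h1).le h3⟩
    · have h2 := Fan.ht_mono (B.R_map h1).le
      exact ⟨by omega, (Fan.br_eq_of_le (B.R_map h1).le (by omega)).symm⟩
  obtain ⟨h1, h2⟩ := hadj y y' hy' hy2
  obtain ⟨h3, h4⟩ := hadj w w' hw' (by omega)
  rcases h with h | h
  · have := Fan.br_eq_of_le (h B) h1
    omega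
  · have := Fan.br_eq_of_le (h B) h3
    omega

theorem map_apex (h𝓛 : 𝓛.IsProjFraisseLimit RSStructure.IsOrderedFan) {h : 𝓛.Space ≃ₜ 𝓛.Space}
    (hh : ∀ p q, 𝓛.branchLE p q → 𝓛.branchLE (h p) (h q)) {ρ : 𝕃} (hρ : IsRoot 𝓛 ρ) :
    h (𝓛.proj ρ) = 𝓛.proj ρ := by
  obtain ⟨y, hy⟩ := proj_surjective (h (𝓛.proj ρ))
  rw [← hy]
  refine ((proj_eq_iff h𝓛).2 (apex_unique h𝓛 hρ fun q => ?_)).symm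
  rw [hy]
  obtain ⟨x, hx⟩ := proj_surjective (h.symm q)
  have hq : q = h (𝓛.proj x) := by rw [hx, h.apply_symm_apply]
  have h1 := branchLE_of_TLE h𝓛 (hρ.TLE x)
  rw [hq]
  exact ⟨hh _ _ h1.1, hh _ _ h1.2⟩

/-- A homeomorphism that preserves the order of the branches preserves the order on each branch: it
maps the points of a branch to pairwise comparable points, so the height is injective along the
image of a branch, and it is smallest at the apex. -/
theorem height_le_of_TLE (h𝓛 : 𝓛.IsProjFraisseLimit RSStructure.IsOrderedFan)
    {h : 𝓛.Space ≃ₜ 𝓛.Space} (hh : ∀ p q, 𝓛.branchLE p q → 𝓛.branchLE (h p) (h q)) {f : 𝓛.Space → ℝ}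
    (hf : ∀ x y, TLE 𝓛 x y → f (𝓛.proj x) ≤ f (𝓛.proj y)) {x y : 𝕃} (hxy : TLE 𝓛 x y) :
    f (h (𝓛.proj x)) ≤ f (h (𝓛.proj y)) := by
  obtain ⟨ht, hc, hb, hR, hT, hsep, hroot⟩ := exists_total_height h𝓛
  obtain ⟨ρ, hρ⟩ := exists_root h𝓛
  have hρ' : IsRoot 𝓛 ρ := hρ
  let H : 𝓛.Space → ℝ := Quot.lift ht hR
  have hH : ∀ x, H (𝓛.proj x) = ht x := fun _ => rfl
  have hHc : Continuous H := continuous_quot_lift _ hc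
  have hcomp : ∀ {a b}, TLE 𝓛 a b → ∃ a' b', 𝓛.proj a' = h (𝓛.proj a) ∧
      𝓛.proj b' = h (𝓛.proj b) ∧ (TLE 𝓛 a' b' ∨ TLE 𝓛 b' a') := fun hab =>
    exists_TLE_of_branchLE h𝓛 (hh _ _ (branchLE_of_TLE h𝓛 hab).1)
      (hh _ _ (branchLE_of_TLE h𝓛 hab).2)
  have hinj : ∀ {a b}, TLE 𝓛 a b → H (h (𝓛.proj a)) = H (h (𝓛.proj b)) →
      𝓛.proj a = 𝓛.proj b := by
    intro a b hab heq
    obtain ⟨a', b', ha, hb, h'⟩ := hcomp hab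
    apply h.injective
    rw [← ha, ← hb, hH, hH] at heq
    rw [← ha, ← hb, proj_eq_iff h𝓛]
    rcases h' with h' | h'
    · exact hsep _ _ h' heq
    · exact (hsep _ _ h' heq.symm).symm
  have hmono : H (h (𝓛.proj x)) ≤ H (h (𝓛.proj y)) := by
    by_contra! hlt
    have h0 : H (h (𝓛.proj ρ)) ≤ H (h (𝓛.proj y)) := by
      rw [map_apex h𝓛 hh hρ', hH, hroot ρ hρ]
      obtain ⟨w, hw⟩ := proj_surjective (h (𝓛.proj y))
      rw [← hw, hH]
      exact (hb w).1
    -- otherwise the height of the image of `y` is also attained below `x`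
    obtain ⟨_, ⟨z, hz, rfl⟩, hzy⟩ := (isPreconnected_segment h𝓛 x).intermediate_value
      (f := fun p => H (h p)) ⟨ρ, hρ'.TLE x, rfl⟩ ⟨x, TLE.refl x, rfl⟩
      (hHc.comp h.continuous).continuousOn ⟨h0, hlt.le⟩
    have h1 := hinj (TLE.trans hz hxy) hzy
    have h2 : ht z = ht y := hR _ _ ((proj_eq_iff h𝓛).1 h1)
    have h3 : ht x = ht y := le_antisymm (hT _ _ hxy) (h2 ▸ hT _ _ hz)
    rw [(proj_eq_iff h𝓛).2 (hsep _ _ hxy h3)] at hlt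
    exact lt_irrefl _ hlt
  obtain ⟨x', y', hx', hy', h'⟩ := hcomp hxy
  rw [← hx', ← hy'] at hmono ⊢
  rcases h' with h' | h'
  · exact hf _ _ h'
  · rw [(proj_eq_iff h𝓛).2 (hsep _ _ h' (le_antisymm (hT _ _ h') hmono))]

end Closure

/-! ### Approximation by automorphisms -/

section Approximation

variable {𝕃 : Type u} [TopologicalSpace 𝕃] {𝓛 : RSStructure 𝕃}

/-- Rounding of a height function `u` to a function on the vertices of a sufficiently fine
approximation.  The value at a vertex is the maximum of the rounded values of `u` at chosen points
over the vertices below it; the maximum makes it monotone, and an error below `1` on each side makes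
it climb by at most one along an edge. -/
theorem exists_rounding (h𝓛 : 𝓛.IsProjFraisseLimit RSStructure.IsOrderedFan) {u : 𝕃 → ℝ}
    (hu : Continuous u) (h0 : ∀ x, 0 ≤ u x) (hT : ∀ x y, TLE 𝓛 x y → u x ≤ u y)
    (hR : ∀ x y, 𝓛.symmR x y → u x = u y) :
    ∃ A : Approx 𝓛, ∀ B : Approx 𝓛, B.Refines A → ∃ t : Fan B.n B.k → ℕ,
      (∀ x, (t (B.map x) : ℝ) ≤ u x + 3 / 4 ∧ u x ≤ t (B.map x) + 3 / 4) ∧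
      (∀ a b, a ≤ b → t a ≤ t b) ∧ ∀ a b, Fan.R a b → t b ≤ t a + 1 := by
  have hclosed : IsClosed {p : 𝕃 × 𝕃 | u p.2 + 1 / 4 ≤ u p.1} :=
    isClosed_le ((hu.comp continuous_snd).add continuous_const) (hu.comp continuous_fst)
  obtain ⟨A₁, hA₁⟩ : ∃ A : Approx 𝓛, ∀ x y, A.map x ≤ A.map y → u x < u y + 1 / 4 := by
    by_contra! hcon
    obtain ⟨p, hp, h⟩ := exists_pair h𝓛 hclosed (fun A a b => a ≤ b)
      (fun A B hAB x y h => hAB.le h)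
      (fun A => by
        obtain ⟨x, y, h1, h2⟩ := hcon A
        exact ⟨(x, y), h2, h1⟩)
    have h1 : u p.2 + 1 / 4 ≤ u p.1 := hp
    linarith [hT _ _ h]
  obtain ⟨A₂, hA₂⟩ : ∃ A : Approx 𝓛, ∀ x y, Fan.R (A.map y) (A.map x) → u x < u y + 1 / 4 := by
    by_contra! hcon
    obtain ⟨p, hp, h⟩ := exists_pair h𝓛 hclosed (fun A a b => Fan.R b a)
      (fun A B hAB x y h => hAB.R h)
      (fun A => by
        obtain ⟨x, y, h1, h2⟩ := hcon A
        exact ⟨(x, y), h2, h1⟩)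
    have h1 : u p.2 + 1 / 4 ≤ u p.1 := hp
    linarith [hR _ _ (Or.inl ((R_iff h𝓛).2 h))]
  obtain ⟨A, hAA₁, hAA₂⟩ := exists_refines₂ h𝓛 A₁ A₂
  refine ⟨A, fun B hB => ?_⟩
  have h1 : ∀ x y, B.map x ≤ B.map y → u x < u y + 1 / 4 := fun x y h =>
    hA₁ x y ((hB.trans hAA₁).le h)
  have h2 : ∀ x y, Fan.R (B.map y) (B.map x) → u x < u y + 1 / 4 := fun x y h =>
    hA₂ x y ((hB.trans hAA₂).R h)
  choose r hr using B.epi.surjective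
  have hfin : ∀ b : Fan B.n B.k, (Set.toFinite {a | a ≤ b}).toFinset.Nonempty := fun b =>
    ⟨b, by rw [Set.Finite.mem_toFinset]; exact le_refl b⟩
  let t : Fan B.n B.k → ℕ := fun b =>
    (Set.toFinite {a | a ≤ b}).toFinset.sup' (hfin b) fun a => ⌊u (r a) + 1 / 2⌋₊
  have ht1 : ∀ a b, a ≤ b → ⌊u (r a) + 1 / 2⌋₊ ≤ t b := fun a b hab =>
    Finset.le_sup' (fun a => ⌊u (r a) + 1 / 2⌋₊) (by rw [Set.Finite.mem_toFinset]; exact hab)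
  have ht2 : ∀ b N, (∀ a ≤ b, ⌊u (r a) + 1 / 2⌋₊ ≤ N) → t b ≤ N := fun b N h =>
    Finset.sup'_le _ _ fun a ha => h a (by rw [Set.Finite.mem_toFinset] at ha; exact ha)
  have hbd : ∀ x, (t (B.map x) : ℝ) ≤ u x + 3 / 4 ∧ u x ≤ t (B.map x) + 3 / 4 := by
    intro x
    constructor
    · have h3 : t (B.map x) ≤ ⌊u x + 3 / 4⌋₊ := ht2 _ _ fun a ha => by
        refine Nat.floor_le_floor ?_
        linarith [h1 (r a) x (by rw [hr]; exact ha)]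
      exact (Nat.cast_le.2 h3).trans (Nat.floor_le (by linarith [h0 x]))
    · have h3 := ht1 (B.map x) (B.map x) le_rfl
      have h4 := Nat.lt_floor_add_one (u (r (B.map x)) + 1 / 2)
      have h5 : ((⌊u (r (B.map x)) + 1 / 2⌋₊ : ℕ) : ℝ) ≤ t (B.map x) := Nat.cast_le.2 h3
      linarith [h1 x (r (B.map x)) (by rw [hr])]
  refine ⟨t, hbd, fun a b hab => ht2 _ _ fun c hc => ht1 c b (hc.trans hab), fun a b hab => ?_⟩
  have h3 := (hbd (r b)).1
  have h4 := (hbd (r a)).2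
  have h5 := h2 (r b) (r a) (by rw [hr, hr]; exact hab)
  rw [hr] at h3 h4
  have h6 : (t b : ℝ) < t a + 2 := by linarith
  have h7 : t b < t a + 2 := by exact_mod_cast h6
  omega

/-- A homeomorphism that preserves the order of the branches is a uniform limit of homeomorphisms
that are induced by automorphisms of the limit.  The image of an approximation `A` under the
homeomorphism is rounded to an epimorphism onto the same fan; the rounding is done in a lift of `A`
of larger height, so that the vertices close to the root, where the branch is not continuous,
are sent to the root. -/
theorem exists_aut_close (h𝓛 : 𝓛.IsProjFraisseLimit RSStructure.IsOrderedFan)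
    {h : 𝓛.Space ≃ₜ 𝓛.Space} (hh : ∀ p q, 𝓛.branchLE p q → 𝓛.branchLE (h p) (h q))
    {V : Set (𝓛.Space × 𝓛.Space)} (hV : IsOpen V) (hd : ∀ p, (p, p) ∈ V) :
    ∃ g : 𝓛.aut, ∀ p, (h p, 𝓛.inducedHom g p) ∈ V := by
  have := h𝓛.isTopological.compact
  have := t2Space_space h𝓛
  obtain ⟨ρ, hρ⟩ := exists_root h𝓛
  obtain ⟨A, hA⟩ := exists_approx_close h𝓛 hV hd
  have hpat : Climb.IsPattern A.n (A.k + 2) A.n A.k id fun _ => Climb.lower 2 :=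
    Climb.isPattern_same _ (Nat.add_sub_cancel _ 2)
  obtain ⟨φ, hφ, hAφ⟩ := exists_lift h𝓛 A A.hn (Nat.succ_pos _) (hpat.isEpi A.hk)
  let P : Approx 𝓛 := ⟨A.n, A.k + 2, A.hn, Nat.succ_pos _, φ, hφ⟩
  have hAht : ∀ x, (A.map x).ht = (φ x).ht - 2 := fun x => by rw [hAφ, hpat.ht_patMap]; rfl
  have hAbr : ∀ x, (A.map x).ht ≠ 0 → (A.map x).br = (φ x).br := fun x hx => by
    rw [hAφ] at hx ⊢
    exact (hpat.br_patMap _ hx).2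
  obtain ⟨H', hc, hb, hR, hT, hroot⟩ := exists_height h𝓛 P
  let H : 𝓛.Space → ℝ := Quot.lift H' hR
  have hH : ∀ x, H (𝓛.proj x) = H' x := fun _ => rfl
  have hHc : Continuous H := continuous_quot_lift _ hc
  let u : 𝕃 → ℝ := fun x => H (h (𝓛.proj x))
  have hu : ∀ x x', 𝓛.proj x' = h (𝓛.proj x) → u x = H' x' := fun x x' hx => by
    change H (h (𝓛.proj x)) = _
    rw [← hx, hH]
  have huc : Continuous u := hHc.comp (h.continuous.comp continuous_proj)
  have hu0 : ∀ x, 0 ≤ u x := fun x => by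
    obtain ⟨x', hx'⟩ := proj_surjective (h (𝓛.proj x))
    rw [hu x x' hx']
    exact (Nat.cast_nonneg _).trans (hb x').1
  have huT : ∀ x y, TLE 𝓛 x y → u x ≤ u y := fun x y hxy => height_le_of_TLE h𝓛 hh hT hxy
  have huR : ∀ x y, 𝓛.symmR x y → u x = u y := fun x y hxy => by
    change H (h (𝓛.proj x)) = H (h (𝓛.proj y))
    rw [(proj_eq_iff h𝓛).2 hxy]
  have huρ : u ρ = 0 := by
    change H (h (𝓛.proj ρ)) = 0
    rw [map_apex h𝓛 hh hρ, hH, hroot ρ hρ]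
  obtain ⟨B₁, hB₁⟩ := exists_rounding h𝓛 huc hu0 huT huR
  -- away from the root the branch does not depend on the representative
  have hht : ∀ x, 2 ≤ H' x → (φ x).ht ≠ 0 := by
    intro x hx h0
    have h1 := (hb x).2
    change H' x ≤ ((φ x).ht : ℝ) + 1 at h1
    rw [h0] at h1
    norm_num at h1
    linarith
  have hbrR : ∀ x y, 𝓛.proj x = 𝓛.proj y → 2 ≤ H' x → (φ x).br = (φ y).br := by
    intro x y hxy hx
    have h1 := (proj_eq_iff h𝓛).1 hxy
    have hy : 2 ≤ H' y := hR x y h1 ▸ hx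
    rcases h1 with h1 | h1
    · exact Fan.br_eq_of_le (P.R_map h1).le (hht x hx)
    · exact (Fan.br_eq_of_le (P.R_map h1).le (hht y hy)).symm
  obtain ⟨B₂, hB₂⟩ : ∃ B : Approx 𝓛, ∀ x y x' y', 𝓛.proj x' = h (𝓛.proj x) →
      𝓛.proj y' = h (𝓛.proj y) → 2 ≤ u x → 2 ≤ u y → Fan.S (B.map x) (B.map y) →
      (φ x').br ≤ (φ y').br := by
    by_contra! hcon
    let F : Approx 𝓛 → Set ((𝕃 × 𝕃) × (𝕃 × 𝕃)) := fun B =>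
      ({p | 𝓛.proj p.2.1 = h (𝓛.proj p.1.1)} ∩ {p | 𝓛.proj p.2.2 = h (𝓛.proj p.1.2)}) ∩
      ({p | 2 ≤ u p.1.1} ∩ {p | 2 ≤ u p.1.2}) ∩
      ((fun p => p.1) ⁻¹' {p | Fan.S (B.map p.1) (B.map p.2)} ∩
        (fun p => p.2) ⁻¹' {p | (φ p.2).br < (φ p.1).br})
    obtain ⟨p, hp⟩ := exists_forall_approx h𝓛 F
      (fun B => by
        refine ((IsClosed.inter ?_ ?_).inter (IsClosed.inter ?_ ?_)).inter (IsClosed.inter ?_ ?_)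
        · exact isClosed_eq (continuous_proj.comp (by fun_prop))
            (h.continuous.comp (continuous_proj.comp (by fun_prop)))
        · exact isClosed_eq (continuous_proj.comp (by fun_prop))
            (h.continuous.comp (continuous_proj.comp (by fun_prop)))
        · exact isClosed_le continuous_const (by fun_prop)
        · exact isClosed_le continuous_const (by fun_prop)
        · exact (B.isClosed_fiber₂ Fan.S).preimage continuous_fst
        · exact (P.isClosed_fiber₂ fun a b => b.br < a.br).preimage continuous_snd)
      (fun B => by
        obtain ⟨x, y, x', y', h1, h2, h3, h4, h5, h6⟩ := hcon B
        exact ⟨((x, y), (x', y')), ⟨⟨h1, h2⟩, h3, h4⟩, h5, h6⟩)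
      (fun B C hBC p hp => ⟨hp.1, hBC.S hp.2.1, hp.2.2⟩)
    obtain ⟨⟨⟨h1, h2⟩, h3, h4⟩, -, h6⟩ := hp A
    have hS : 𝓛.S p.1.1 p.1.2 := (S_iff h𝓛).2 fun B => (hp B).2.1
    obtain ⟨x', y', hx', hy', hS'⟩ := hh _ _ ⟨p.1.1, p.1.2, rfl, rfl, hS⟩
    have h3' : 2 ≤ H' x' := (hu _ _ hx').symm ▸ h3
    have h4' : 2 ≤ H' y' := (hu _ _ hy').symm ▸ h4
    have h7 := P.S_map hS'
    change Fan.S (φ x') (φ y') at h7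
    have h8 := hbrR x' p.2.1 (hx'.trans h1.symm) h3'
    have h9 := hbrR y' p.2.2 (hy'.trans h2.symm) h4'
    have h10 := hht _ h3'
    have h11 := hht _ h4'
    have h12 : (φ p.2.2).br < (φ p.2.1).br := h6
    unfold Fan.S at h7
    omega
  obtain ⟨B, hBB₁, hBB₂⟩ := exists_refines₂ h𝓛 B₁ B₂
  obtain ⟨t, ht, htmono, htR⟩ := hB₁ B hBB₁
  have hbr : ∀ x y x' y', 𝓛.proj x' = h (𝓛.proj x) → 𝓛.proj y' = h (𝓛.proj y) → 2 ≤ u x →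
      2 ≤ u y → Fan.S (B.map x) (B.map y) → (φ x').br ≤ (φ y').br :=
    fun x y x' y' h1 h2 h3 h4 h5 => hB₂ x y x' y' h1 h2 h3 h4 (hBB₂.S h5)
  choose r hr using B.epi.surjective
  choose s hs using fun b => proj_surjective (𝓧 := 𝓛) (h (𝓛.proj (r b)))
  -- values of `t` that are at least 3 occur only where `u` is at least 2
  have ht3 : ∀ b, 3 ≤ t b → ∀ x, B.map x = b → 2 ≤ u x := by
    rintro b hb3 x rfl
    have h1 := (ht x).1
    have h2 : (3 : ℝ) ≤ t (B.map x) := by exact_mod_cast hb3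
    linarith
  have htroot : t Fan.root = 0 := by
    have h1 := (ht ρ).1
    rw [huρ, Fan.eq_root (hρ B)] at h1
    have h2 : (t (Fan.root : Fan B.n B.k) : ℝ) < 1 := by linarith
    have h3 : t (Fan.root : Fan B.n B.k) < 1 := by exact_mod_cast h2
    omega
  -- heights are lowered by 2 as in the lift `φ` of `A`; `t` may exceed the height of `φ`
  let q : Fan B.n B.k → Fan A.n A.k := fun b =>
    Fan.vtx A.n A.k (φ (s b)).br (min (t b) (A.k + 2) - 2)
  have hsb : ∀ b, 3 ≤ t b → (φ (s b)).br < A.n := by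
    intro b hb3
    refine Fan.br_lt (hht _ ?_)
    rw [← hu _ _ (hs b)]
    exact ht3 b hb3 _ (hr b)
  have hqht : ∀ b, (q b).ht = min (t b) (A.k + 2) - 2 := by
    intro b
    by_cases hb3 : 3 ≤ t b
    · exact Fan.ht_vtx (hsb b hb3) (by omega)
    · have h1 : min (t b) (A.k + 2) - 2 = 0 := by omega
      simp only [q, h1, Fan.ht_vtx_zero]
  have hqbr : ∀ b, (q b).ht ≠ 0 → 3 ≤ t b ∧ (q b).br = (φ (s b)).br := by
    intro b hb0
    rw [hqht] at hb0
    have hb3 : 3 ≤ t b := by omega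
    exact ⟨hb3, Fan.br_vtx (hsb b hb3) (by omega) hb0⟩
  have hqS : ∀ a b, Fan.S a b → Fan.S (q a) (q b) := by
    intro a b hab
    by_cases ha : (q a).ht = 0
    · exact Or.inl ha
    by_cases hb0 : (q b).ht = 0
    · exact Or.inr (Or.inl hb0)
    obtain ⟨ha3, ha'⟩ := hqbr a ha
    obtain ⟨hb3, hb'⟩ := hqbr b hb0
    refine Or.inr (Or.inr ?_)
    rw [ha', hb']
    exact hbr _ _ _ _ (hs a) (hs b) (ht3 a ha3 _ (hr a)) (ht3 b hb3 _ (hr b)) (by rwa [hr, hr])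
  have hq : RSStructure.IsEpi (Fan.str B.n B.k) (Fan.str A.n A.k) q := by
    refine Fan.isEpi_of A.hk ?_ ?_ hqS ?_
    · apply Fan.eq_root
      rw [hqht, htroot]
      omega
    · intro a b hab
      have h1 := htmono a b hab.le
      have h2 := htR a b hab
      have h3 := hqht a
      have h4 := hqht b
      have h5 : q a ≤ q b := Fan.le_of_S (hqS _ _ (Fan.S_of_le hab.le).1)
        (hqS _ _ (Fan.S_of_le hab.le).2) (by omega)
      rcases (Fan.ht_mono h5).eq_or_lt with h6 | h6
      · exact Or.inl (Fan.eq_of_le_of_le h5 le_rfl h6)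
      · exact Or.inr ⟨by omega, h5⟩
    · intro i hi
      obtain ⟨z, hz⟩ := hφ.surjective (Fan.vtx A.n (A.k + 2) i (A.k + 2))
      obtain ⟨x, hx⟩ := proj_surjective (h.symm (𝓛.proj z))
      have hx' : 𝓛.proj z = h (𝓛.proj x) := by rw [hx, h.apply_symm_apply]
      have hzht : (φ z).ht = A.k + 2 := by rw [hz, Fan.ht_vtx hi le_rfl]
      have hzbr : (φ z).br = i := by rw [hz, Fan.br_vtx hi le_rfl (by omega)]
      have h1 : (A.k : ℝ) + 2 ≤ u x := by
        rw [hu x z hx']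
        have h2 := (hb z).1
        change ((φ z).ht : ℝ) ≤ _ at h2
        rw [hzht] at h2
        push_cast at h2
        exact h2
      have h2 : (A.k : ℝ) + 1 < t (B.map x) := by linarith [(ht x).2]
      have h3 : A.k + 1 < t (B.map x) := by exact_mod_cast h2
      have hk := A.hk
      have h4 : (q (B.map x)).ht = A.k := by rw [hqht]; omega
      have h5 := hqbr (B.map x) (by omega)
      have h6 := ht3 _ h5.1
      have h7 := hbr _ _ _ _ (hs (B.map x)) hx' (h6 _ (hr _)) (h6 _ rfl)
        (Fan.S_of_le (hr _).le).1
      have h8 := hbr _ _ _ _ hx' (hs (B.map x)) (h6 _ rfl) (h6 _ (hr _))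
        (Fan.S_of_le (hr _).ge).1
      refine ⟨B.map x, Fan.ext ?_ ?_⟩
      · rw [Fan.br_vtx hi le_rfl (by omega), h5.2]
        omega
      · rw [Fan.ht_vtx hi le_rfl, h4]
  obtain ⟨g, hg⟩ := exists_aut h𝓛 A.hn A.hk A.epi (hq.comp B.epi)
  refine ⟨g, fun p => ?_⟩
  obtain ⟨x, rfl⟩ := proj_surjective p
  obtain ⟨z, hz⟩ := proj_surjective (h (𝓛.proj x))
  rw [inducedHom_proj, ← hz]
  refine hA _ _ ?_
  have hg' : A.map (g.1 x) = q (B.map x) := (hg x).symm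
  rw [hg']
  have h1 := (hb z).1
  have h2 := (hb z).2
  change ((φ z).ht : ℝ) ≤ _ at h1
  change _ ≤ ((φ z).ht : ℝ) + 1 at h2
  rw [← hu x z hz] at h1 h2
  have h3 := (ht x).1
  have h4 := (ht x).2
  have h5 : ((φ z).ht : ℝ) < t (B.map x) + 1 := by linarith
  have h6 : (t (B.map x) : ℝ) < (φ z).ht + 2 := by linarith
  have h5' : (φ z).ht < t (B.map x) + 1 := by exact_mod_cast h5
  have h6' : t (B.map x) < (φ z).ht + 2 := by exact_mod_cast h6
  have h7 := hqht (B.map x)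
  have h8 := hAht z
  have h9 := (φ z).ht_le
  change (φ z).ht ≤ A.k + 2 at h9
  have hbreq : (q (B.map x)).ht ≠ 0 → (A.map z).ht ≠ 0 → (q (B.map x)).br = (A.map z).br := by
    intro ha hz0
    obtain ⟨h10, h11⟩ := hqbr _ ha
    have h12 := ht3 _ h10
    have h13 := hbr _ _ _ _ (hs (B.map x)) hz (h12 _ (hr _)) (h12 _ rfl)
      (Fan.S_of_le (hr _).le).1
    have h14 := hbr _ _ _ _ hz (hs (B.map x)) (h12 _ rfl) (h12 _ (hr _))
      (Fan.S_of_le (hr _).ge).1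
    rw [h11, hAbr z hz0]
    omega
  have hS₁ : Fan.S (q (B.map x)) (A.map z) := by
    unfold Fan.S
    omega
  have hS₂ : Fan.S (A.map z) (q (B.map x)) := by
    unfold Fan.S
    omega
  rcases Nat.lt_trichotomy (q (B.map x)).ht (A.map z).ht with h10 | h10 | h10
  · exact Or.inr (Or.inr ⟨by omega, Fan.le_of_S hS₁ hS₂ h10.le⟩)
  · exact Or.inl (Or.inl (Fan.eq_of_le_of_le (Fan.le_of_S hS₁ hS₂ h10.le) le_rfl h10).symm)
  · exact Or.inl (Or.inr ⟨by omega, Fan.le_of_S hS₂ hS₁ h10.le⟩)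

theorem mem_closure_iff_branchLE (h𝓛 : 𝓛.IsProjFraisseLimit RSStructure.IsOrderedFan)
    (h : 𝓛.Space ≃ₜ 𝓛.Space) :
    h ∈ closure ((𝓛.inducedHom.range : Set (𝓛.Space ≃ₜ 𝓛.Space))) ↔
      ∀ p q, 𝓛.branchLE p q → 𝓛.branchLE (h p) (h q) := by
  have := t2Space_space h𝓛
  refine ⟨fun hh p q => branchLE_of_mem_closure h𝓛 hh, fun hh => ?_⟩
  rw [mem_closure_iff_nhds]
  intro O hO
  obtain ⟨V, hV, hd, hVO⟩ := exists_uniform_nhds hO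
  obtain ⟨g, hg⟩ := exists_aut_close h𝓛 hh hV hd
  exact ⟨𝓛.inducedHom g, hVO _ hg, g, rfl⟩

end Approximation

/-! ### Words as epimorphisms of fans -/

namespace Climb

/-- The label of the letter of a word at position `b`. -/
def wordLabel (w : FreeMonoid (ℕ × Climb)) (b : ℕ) : ℕ := (w.toList.getD b (0, const)).1

/-- The map of the letter of a word at position `b`. -/
def wordMap (w : FreeMonoid (ℕ × Climb)) (b : ℕ) : Climb := (w.toList.getD b (0, const)).2

theorem IsPattern.patMap_comp {N K m l n k : ℕ} {β β' : ℕ → ℕ} {f f' : ℕ → Climb}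
    (h : IsPattern N K m l β f) (a : Fan N K) :
    patMap n k (fun b => β' (β b)) (fun b => (f' (β b)).comp (f b)) a =
      patMap n k β' f' (patMap m l β f a) := by
  have h1 := h.ht_patMap a
  by_cases h0 : f a.br a.ht = 0
  · have h2 : patMap m l β f a = Fan.root := Fan.eq_root (h1.trans h0)
    rw [h2]
    unfold patMap
    rw [comp_apply, h0, Fan.ht_root, Climb.zero, Climb.zero, Fan.vtx_zero, Fan.vtx_zero]
  · have h2 := (h.br_patMap a (by omega)).2
    unfold patMap at h1 h2 ⊢
    rw [comp_apply, h1, h2]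

theorem patMap_relabel {N K m l n k : ℕ} {w : FreeMonoid (ℕ × Climb)} {β : ℕ → ℕ} {f : ℕ → Climb}
    (hN : w.toList.length = N) (h1 : 1 ≤ N) (h : IsPattern N K m l (wordLabel w) (wordMap w))
    (a : Fan N K) :
    patMap n k (wordLabel (relabel β f w)) (wordMap (relabel β f w)) a =
      patMap n k β f (patMap m l (wordLabel w) (wordMap w) a) := by
  rw [← h.patMap_comp]
  have hb : a.br < w.toList.length := by
    have := a.prop
    omega
  have h2 : (relabel β f w).toList.getD a.br (0, const) =
      (β (wordLabel w a.br), (f (wordLabel w a.br)).comp (wordMap w a.br)) := by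
    unfold relabel wordLabel wordMap
    rw [FreeMonoid.toList_map, List.getD_eq_getElem _ _ (by rwa [List.length_map]),
      List.getElem_map, List.getD_eq_getElem _ _ hb]
  have h3 : wordLabel (relabel β f w) a.br = β (wordLabel w a.br) := congrArg Prod.fst h2
  have h4 : wordMap (relabel β f w) a.br = (f (wordLabel w a.br)).comp (wordMap w a.br) :=
    congrArg Prod.snd h2
  unfold patMap
  rw [h3, h4]

/-- A good word is a pattern on fans of sufficiently large height. -/
theorem Good.eventually_isPattern {m l : ℕ} {w : FreeMonoid (ℕ × Climb)} (h : Good m l w) :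
    ∀ᶠ K in Filter.atTop, IsPattern w.toList.length K m l (wordLabel w) (wordMap w) := by
  have hget : ∀ b, ∀ hb : b < w.toList.length, w.toList.getD b (0, const) = w.toList[b] :=
    fun b hb => List.getD_eq_getElem _ _ hb
  have hmem : ∀ b, b < w.toList.length → w.toList.getD b (0, const) ∈ w.toList := fun b hb => by
    rw [hget b hb]
    exact List.getElem_mem hb
  have hK : ∀ᶠ K in Filter.atTop, ∀ p ∈ {p | p ∈ w.toList}, (∃ i, p.2 i = l) → p.2 K = l := by
    refine (Filter.eventually_all_finite (List.finite_toSet w.toList)).2 fun p hp => ?_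
    by_cases hi : ∃ i, p.2 i = l
    · obtain ⟨i, hi⟩ := hi
      filter_upwards [Filter.eventually_ge_atTop i] with K hK _
      exact le_antisymm (h.le p hp K) (hi ▸ p.2.monotone hK)
    · exact Filter.Eventually.of_forall fun K h' => absurd h' hi
  filter_upwards [hK] with K hK
  refine ⟨fun b b' hbb' hb' => ?_, fun b hb => h.lt _ (hmem b hb), fun b hb => h.le _ (hmem b hb) K,
    fun i hi => ?_⟩
  · unfold wordLabel
    rw [hget b (hbb'.trans_lt hb'), hget b' hb']
    rcases hbb'.eq_or_lt with rfl | hlt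
    · exact le_rfl
    · exact List.pairwise_iff_getElem.1 h.sorted b b' _ _ hlt
  · obtain ⟨p, hp, hpi, hpl⟩ := h.full i hi
    obtain ⟨b, hb, hbp⟩ := List.getElem_of_mem hp
    have h1 : w.toList.getD b (0, const) = p := (hget b hb).trans hbp
    refine ⟨b, hb, ?_, ?_⟩
    · unfold wordLabel
      rw [h1, hpi]
    · unfold wordMap
      rw [h1]
      exact hK p hp hpl

end Climb

/-! ### Extreme amenability -/

section Amenable

variable {𝕃 : Type u} [TopologicalSpace 𝕃] {𝓛 : RSStructure 𝕃}

theorem exists_refines_translates (h𝓛 : 𝓛.IsProjFraisseLimit RSStructure.IsOrderedFan)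
    (A : Approx 𝓛) (Γ : Finset 𝓛.aut) :
    ∃ C : Approx 𝓛, ∀ g ∈ Γ, ∃ q : Fan C.n C.k → Fan A.n A.k, ∀ x, A.map (g.1 x) = q (C.map x) := by
  classical
  induction Γ using Finset.induction_on with
  | empty => exact ⟨A, fun g hg => absurd hg (Finset.notMem_empty g)⟩
  | insert g Γ _ ih =>
    obtain ⟨C, hC⟩ := ih
    obtain ⟨B, hB, q, hq⟩ := exists_refines_of_continuous h𝓛 (A.continuous.comp g.1.continuous) C
    obtain ⟨r, hr⟩ := hB
    refine ⟨B, fun g' hg' => ?_⟩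
    rcases Finset.mem_insert.1 hg' with rfl | hg'
    · exact ⟨q, fun x => congrFun hq x⟩
    · obtain ⟨q', hq'⟩ := hC g' hg'
      exact ⟨q' ∘ r, fun x => by rw [hq', hr]; rfl⟩

theorem isEpi_map_aut (A : Approx 𝓛) (g : 𝓛.aut) :
    RSStructure.IsEpi 𝓛 (Fan.str A.n A.k) fun x => A.map (g.1 x) := by
  have key : ∀ {r : 𝕃 → 𝕃 → Prop} (_ : ∀ x y, r (g.1 x) (g.1 y) ↔ r x y) (a b : Fan A.n A.k),
      (∃ x y, A.map x = a ∧ A.map y = b ∧ r x y) ↔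
        ∃ x y, A.map (g.1 x) = a ∧ A.map (g.1 y) = b ∧ r x y := by
    intro r hr a b
    constructor
    · rintro ⟨x, y, h1, h2, h3⟩
      refine ⟨g.1.symm x, g.1.symm y, by simpa using h1, by simpa using h2, ?_⟩
      rw [← hr]
      simpa using h3
    · rintro ⟨x, y, h1, h2, h3⟩
      exact ⟨g.1 x, g.1 y, h1, h2, (hr x y).2 h3⟩
  exact ⟨A.continuous.comp g.1.continuous, A.epi.surjective.comp g.1.surjective,
    fun a b => (A.epi.map_R a b).trans (key g.2.1 a b),
    fun a b => (A.epi.map_S a b).trans (key g.2.2 a b)⟩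

/-- The Ramsey property of the patterns gives almost fixed points.  A word `w` over the labelled
maps codes an epimorphism from the fans with `w.toList.length` branches and sufficiently large
height `K`; up to the stabilizer of the approximation `A`, the translates of a point `x₀` are
therefore a colouring of the words, and the Ramsey theorem provides a word all of whose images under
the given finitely many patterns have almost the same colour. -/
theorem exists_almost_fixed (h𝓛 : 𝓛.IsProjFraisseLimit RSStructure.IsOrderedFan) {X : Type v}
    [UniformSpace X] [CompactSpace X] [Nonempty X] (a : 𝓛.aut → X → X)
    (hmul : ∀ g g' x, a (g * g') x = a g (a g' x)) (hone : ∀ x, a 1 x = x)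
    (hcont : ∀ W ∈ uniformity X, ∃ A : Approx 𝓛, ∀ g : 𝓛.aut, (∀ x, A.map (g.1 x) = A.map x) →
      ∀ x, (x, a g x) ∈ W)
    (Γ : Finset 𝓛.aut) {E : Set (X × X)} (hE : E ∈ uniformity X) :
    ∃ y, ∀ g ∈ Γ, (y, a g y) ∈ E := by
  classical
  obtain ⟨W', hW', hWsymm', hWE'⟩ := comp_symm_mem_uniformity_sets hE
  obtain ⟨W, hW, hWsymm, hWE⟩ := comp_symm_mem_uniformity_sets hW'
  obtain ⟨A, hA⟩ := hcont W hW
  obtain ⟨x₀⟩ := ‹Nonempty X›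
  obtain ⟨C, hC⟩ := exists_refines_translates h𝓛 A (insert 1 Γ)
  have hφ : ∀ N K : ℕ, ∃ φ : 𝕃 → Fan N K, 1 ≤ N → 1 ≤ K →
      RSStructure.IsEpi 𝓛 (Fan.str N K) φ := by
    intro N K
    by_cases h : 1 ≤ N ∧ 1 ≤ K
    · obtain ⟨φ, hφ⟩ := exists_approx h𝓛 h.1 h.2
      exact ⟨φ, fun _ _ => hφ⟩
    · exact ⟨fun _ => Fan.root, fun h1 h2 => absurd ⟨h1, h2⟩ h⟩
  choose φ hφ using hφ
  let D : FreeMonoid (ℕ × Climb) → ℕ → 𝓛.aut → Prop := fun w K g =>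
    ∀ x, A.map (g.1 x) =
      Climb.patMap A.n A.k (Climb.wordLabel w) (Climb.wordMap w) (φ w.toList.length K x)
  -- words that are not realized by an automorphism get the junk value `1`
  let G : FreeMonoid (ℕ × Climb) → ℕ → 𝓛.aut := fun w K =>
    if h : ∃ g, D w K g then h.choose else 1
  have hG : ∀ w K g, D w K g → D w K (G w K) := by
    intro w K g hg
    have h : ∃ g, D w K g := ⟨g, hg⟩
    simp only [G, dif_pos h]
    exact h.choose_spec
  have hlim : ∀ w, ∃ p, Filter.Tendsto (fun K => a (G w K) x₀) (Filter.hyperfilter ℕ) (𝓝 p) := by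
    intro w
    obtain ⟨p, -, hp⟩ := isCompact_univ.ultrafilter_le_nhds
      ((Filter.hyperfilter ℕ).map fun K => a (G w K) x₀) (by simp)
    exact ⟨p, hp⟩
  -- the colour of a word must not depend on the height `K`, hence the limit along an ultrafilter
  choose F hF using hlim
  obtain ⟨x, hx⟩ := Climb.exists_good_near F C.n C.k A.n A.k C.hn
  have hpat : ∀ g ∈ insert 1 Γ, ∃ q : (ℕ → ℕ) × (ℕ → Climb),
      Climb.IsPattern C.n C.k A.n A.k q.1 q.2 ∧
        ∀ x, A.map (g.1 x) = Climb.patMap A.n A.k q.1 q.2 (C.map x) := by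
    intro g hg
    obtain ⟨q, hq⟩ := hC g hg
    have hqe : RSStructure.IsEpi (Fan.str C.n C.k) (Fan.str A.n A.k) q := by
      have h1 := isEpi_map_aut A g
      rw [show (fun x => A.map (g.1 x)) = q ∘ C.map from funext hq] at h1
      exact RSStructure.IsEpi.of_comp h1 C.epi
    obtain ⟨β, f, hβ, rfl⟩ := Climb.exists_pattern A.hn A.hk hqe
    exact ⟨(β, f), hβ, hq⟩
  have : Nonempty ((ℕ → ℕ) × (ℕ → Climb)) := ⟨(id, fun _ => Climb.const)⟩
  choose! Q hQ hQmap using hpat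
  obtain ⟨w, hw, hwQ⟩ := hx (interior {z | (x, z) ∈ W})
    (interior_mem_nhds.2 (UniformSpace.ball_mem_nhds x hW))
    (Q '' ((insert 1 Γ : Finset 𝓛.aut) : Set 𝓛.aut))
    ((Finset.finite_toSet _).image Q) (by
      rintro _ ⟨g, hg, rfl⟩
      exact hQ g (Finset.mem_coe.1 hg))
  have hlen : 1 ≤ w.toList.length := by
    obtain ⟨p, hp, -⟩ := hw.full 0 C.hn
    exact List.length_pos_of_mem hp
  have hev1 : ∀ᶠ K in (Filter.hyperfilter ℕ : Filter ℕ), 1 ≤ K ∧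
      Climb.IsPattern w.toList.length K C.n C.k (Climb.wordLabel w) (Climb.wordMap w) := by
    have h1 := (Filter.eventually_ge_atTop 1).and hw.eventually_isPattern
    rw [← Nat.cofinite_eq_atTop] at h1
    exact Filter.hyperfilter_le_cofinite h1
  have hev2 : ∀ᶠ K in (Filter.hyperfilter ℕ : Filter ℕ), ∀ g ∈ insert 1 Γ,
      (x, a (G (Climb.relabel (Q g).1 (Q g).2 w) K) x₀) ∈ W := by
    refine (Filter.eventually_all_finset _).2 fun g hg => ?_
    have h1 := hwQ (Q g) ⟨g, hg, rfl⟩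
    filter_upwards [(hF (Climb.relabel (Q g).1 (Q g).2 w)).eventually
      (isOpen_interior.mem_nhds h1)] with K hK
    exact interior_subset (s := {z | (x, z) ∈ W}) hK
  obtain ⟨K, ⟨hK1, hKpat⟩, hK2⟩ := (hev1.and hev2).exists
  obtain ⟨t, ht⟩ := exists_aut h𝓛 C.hn C.hk C.epi
    ((hKpat.isEpi C.hk).comp (hφ w.toList.length K hlen hK1))
  -- the translates of `y = t x₀` are close to `x`
  have key : ∀ g ∈ insert 1 Γ, (x, a g (a t x₀)) ∈ W' := by
    intro g hg
    set w' := Climb.relabel (Q g).1 (Q g).2 w with hw'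
    have hlen' : w'.toList.length = w.toList.length := by
      rw [hw']
      unfold Climb.relabel
      rw [FreeMonoid.toList_map, List.length_map]
    have hD : D w' K (g * t) := by
      intro z
      change A.map (g.1 (t.1 z)) = _
      rw [hQmap g hg, hlen', Climb.patMap_relabel rfl hlen hKpat, ← ht z]
      rfl
    have hD' := hG w' K _ hD
    set s := G w' K * (g * t)⁻¹ with hs
    have hsA : ∀ z, A.map (s.1 z) = A.map z := by
      intro z
      have h1 := hD' ((g * t)⁻¹.1 z)
      have h2 := hD ((g * t)⁻¹.1 z)
      rw [← h1] at h2
      have h3 : (g * t).1 ((g * t)⁻¹.1 z) = z := (g * t).1.apply_symm_apply z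
      rw [h3] at h2
      exact h2.symm
    have h1 := hA s hsA (a g (a t x₀))
    rw [← hmul, ← hmul, hs, inv_mul_cancel_right, hmul g t] at h1
    exact hWE ⟨_, hK2 g hg, SetRel.symm W h1⟩
  refine ⟨a t x₀, fun g hg => ?_⟩
  have h1 := key 1 (Finset.mem_insert_self _ _)
  rw [hone] at h1
  exact hWE' ⟨x, SetRel.symm W' h1, key g (Finset.mem_insert_of_mem hg)⟩

/-- An action of the automorphism group of the limit on a compact space that is continuous for the
topology given by the stabilizers of approximations has a fixed point. -/
theorem exists_fixed (h𝓛 : 𝓛.IsProjFraisseLimit RSStructure.IsOrderedFan) {X : Type v}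
    [UniformSpace X] [CompactSpace X] [T2Space X] [Nonempty X] (a : 𝓛.aut → X → X)
    (hmul : ∀ g g' x, a (g * g') x = a g (a g' x)) (hone : ∀ x, a 1 x = x)
    (hc : ∀ g, Continuous (a g))
    (hcont : ∀ W ∈ uniformity X, ∃ A : Approx 𝓛, ∀ g : 𝓛.aut, (∀ x, A.map (g.1 x) = A.map x) →
      ∀ x, (x, a g x) ∈ W) :
    ∃ y, ∀ g, a g y = y := by
  classical
  let ι := Finset 𝓛.aut × {E : Set (X × X) // E ∈ uniformity X ∧ IsClosed E}
  let T : ι → Set X := fun i => {y | ∀ g ∈ i.1, (y, a g y) ∈ i.2.1}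
  have hT : ∀ i, IsClosed (T i) := fun i => by
    have : T i = ⋂ g ∈ i.1, {y | (y, a g y) ∈ i.2.1} := by
      ext y
      simp [T]
    rw [this]
    exact isClosed_biInter fun g _ => i.2.2.2.preimage (continuous_id.prodMk (hc g))
  have hdir : Directed (· ⊇ ·) T := by
    intro i j
    refine ⟨(i.1 ∪ j.1, ⟨i.2.1 ∩ j.2.1, Filter.inter_mem i.2.2.1 j.2.2.1,
      i.2.2.2.inter j.2.2.2⟩), fun y hy g hg => (hy g (Finset.mem_union_left _ hg)).1,
      fun y hy g hg => (hy g (Finset.mem_union_right _ hg)).2⟩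
  have : Nonempty ι := ⟨(∅, ⟨univ, Filter.univ_mem, isClosed_univ⟩)⟩
  obtain ⟨y, hy⟩ := IsCompact.nonempty_iInter_of_directed_nonempty_isCompact_isClosed T hdir
    (fun i => exists_almost_fixed h𝓛 a hmul hone hcont i.1 i.2.2.1) (fun i => (hT i).isCompact) hT
  refine ⟨y, fun g => ?_⟩
  have h1 : ∀ E ∈ uniformity X, (y, a g y) ∈ E := by
    intro E hE
    obtain ⟨E', ⟨hE', hcl⟩, hEE'⟩ := uniformity_hasBasis_closed.mem_iff.1 hE
    exact hEE' (mem_iInter.1 hy ({g}, ⟨E', hE', hcl⟩) g (Finset.mem_singleton_self g))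
  exact (eq_of_uniformity fun {V} hV => h1 V hV).symm

/-- Automorphisms in the stabilizer of a sufficiently fine approximation are close to the
identity of the quotient space. -/
theorem exists_approx_nhds_one (h𝓛 : 𝓛.IsProjFraisseLimit RSStructure.IsOrderedFan)
    {O : Set (𝓛.Space ≃ₜ 𝓛.Space)} (hO : O ∈ 𝓝 1) :
    ∃ A : Approx 𝓛, ∀ g : 𝓛.aut, (∀ x, A.map (g.1 x) = A.map x) → 𝓛.inducedHom g ∈ O := by
  have := t2Space_space h𝓛
  obtain ⟨V, hV, hd, hVO⟩ := exists_uniform_nhds hO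
  obtain ⟨A, hA⟩ := exists_approx_close h𝓛 hV hd
  refine ⟨A, fun g hg => hVO _ fun p => ?_⟩
  obtain ⟨x, rfl⟩ := proj_surjective p
  exact hA x (g.1 x) (Or.inl (Or.inl (hg x).symm))

/-- A fixed point of the dense subgroup of induced homeomorphisms is fixed by the closure. -/
theorem extremelyAmenable_closure (h𝓛 : 𝓛.IsProjFraisseLimit RSStructure.IsOrderedFan)
    (H : Subgroup (𝓛.Space ≃ₜ 𝓛.Space))
    (hH : (H : Set (𝓛.Space ≃ₜ 𝓛.Space)) =
      closure ((𝓛.inducedHom.range : Set (𝓛.Space ≃ₜ 𝓛.Space)))) :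
    ExtremelyAmenable.{u, v} H := by
  intro X _ _ _ _ _ _
  let _ : UniformSpace X := uniformSpaceOfCompactR1
  have hmem : ∀ g, 𝓛.inducedHom g ∈ H := fun g => by
    rw [← SetLike.mem_coe, hH]
    exact subset_closure ⟨g, rfl⟩
  let ι : 𝓛.aut →* H := 𝓛.inducedHom.codRestrict H hmem
  obtain ⟨y, hy⟩ := exists_fixed h𝓛 (fun g (x : X) => ι g • x)
    (fun g g' x => by rw [map_mul, mul_smul]) (fun x => by rw [map_one, one_smul])
    (fun g => continuous_const_smul _) (fun W hW => by
      obtain ⟨W', ⟨hW', hW'o⟩, hWW'⟩ := uniformity_hasBasis_open.mem_iff.1 hW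
      have h1 : ∀ᶠ h in 𝓝 (1 : H), ∀ x ∈ (univ : Set X), (x, h • x) ∈ W' := by
        refine isCompact_univ.eventually_forall_of_forall_eventually fun x _ => ?_
        have h2 : Continuous fun p : H × X => (p.2, p.1 • p.2) :=
          continuous_snd.prodMk continuous_smul
        refine h2.continuousAt.eventually (hW'o.mem_nhds ?_)
        change (x, (1 : H) • x) ∈ W'
        rw [one_smul]
        exact refl_mem_uniformity hW'
      rw [nhds_subtype_eq_comap] at h1
      obtain ⟨O, hO, hOs⟩ := Filter.mem_comap.1 h1
      obtain ⟨A, hA⟩ := exists_approx_nhds_one h𝓛 hO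
      exact ⟨A, fun g hg x => hWW' (hOs (show ι g ∈ _ from hA g hg) x (mem_univ x))⟩)
  refine ⟨y, fun h => ?_⟩
  have hcl : IsClosed {h : H | h • y = y} :=
    isClosed_eq (continuous_id.smul continuous_const) continuous_const
  have h1 : h ∈ closure (range ι) := by
    rw [closure_subtype]
    have h2 : h.1 ∈ closure ((𝓛.inducedHom.range : Set (𝓛.Space ≃ₜ 𝓛.Space))) := hH ▸ h.2
    refine closure_mono ?_ h2
    rintro _ ⟨g, rfl⟩
    exact ⟨ι g, ⟨g, rfl⟩, rfl⟩
  refine closure_minimal ?_ hcl h1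
  rintro _ ⟨g, rfl⟩
  exact hy g

end Amenable

theorem theorem2p10 {𝕃 : Type u} [TopologicalSpace 𝕃] (𝓛 : RSStructure 𝕃)
    (h𝓛 : 𝓛.IsProjFraisseLimit RSStructure.IsOrderedFan) :
    Equivalence 𝓛.symmR ∧ IsLelekFan 𝓛.Space ∧
    ∃ H : Subgroup (𝓛.Space ≃ₜ 𝓛.Space),
      (H : Set (𝓛.Space ≃ₜ 𝓛.Space)) =
        closure ((𝓛.inducedHom.range : Set (𝓛.Space ≃ₜ 𝓛.Space))) ∧
      ExtremelyAmenable.{u, v} H ∧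
      ∀ h : 𝓛.Space ≃ₜ 𝓛.Space,
        h ∈ H ↔ ∀ p q, 𝓛.branchLE p q → 𝓛.branchLE (h p) (h q) := by
  have := compactSpace_space h𝓛
  have := t2Space_space h𝓛
  have := isTopologicalGroup_homeo (X := 𝓛.Space)
  exact ⟨symmR_equivalence h𝓛, isLelekFan_space h𝓛, 𝓛.inducedHom.range.topologicalClosure, rfl,
    extremelyAmenable_closure h𝓛 _ rfl, mem_closure_iff_branchLE h𝓛⟩
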